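/- Write $H_2(p)=-p\log_2 p-(1-p)\log_2(1-p)$, and let $H_2^{-1}:[0,1]\to[0,\tfrac12]$ be the inverse of $H_2$ on $[0,\tfrac12]$. For $0\le\delta<\tfrac12$ put $$\kappa_{GV}(\delta)=1-H_2(\delta),\qquad \kappa_Z(\delta)=\sup_{0<\kappa<1-H_2(\delta)}\kappa\Bigl(1-\frac{\delta}{H_2^{-1}(1-\kappa)}\Bigr)$$ (the Gilbert–Varshamov and the Zyablov rate), and $\kappa_{GV}(\delta)=\kappa_Z(\delta)=0$ for $\delta\ge\tfrac12$. Distances are Hamming distances. Algorithms are randomized random access machines with logarithmic cost. There are absolute constants $A$ and $c$ such that for every $0<\epsilon\le1$ the following two statements hold. (1) There is a randomized algorithm that, given vectors $x_0,\dots,x_{n-1}\in\{0,1\}^m$ ($m\ge1$) among which a unique pair $\{x_i,x_j\}$, $i<j$, attains the minimum pairwise distance $d_{\min}$ (neither the pair nor $d_{\min}$ being known to the algorithm), always halts within time $$A\,\epsilon^{-1}\,n\log_2^2 n\cdot 2^{\left(1-\kappa_Z((1+\epsilon)\delta)-\delta H_2\left(\frac{1-\epsilon}{2}\right)\right)m}\,m^{c},\qquad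 \delta:=d_{\min}/m,$$ and with probability at least $1-1/n^2$ outputs $i$, $j$ and $d_{\min}$. (2) There is a randomized algorithm that does the same within time $$A\,\epsilon^{-1}\,n\log_2^2 n\cdot 2^{\left(1-\kappa_{GV}((1+\epsilon)\delta)-\delta H_2\left(\frac{1-\epsilon}{2}\right)\right)m}\,m^{c}$$ (so the exponent is $(H_2((1+\epsilon)\delta)-\delta H_2(\frac{1-\epsilon}{2}))m$ when $(1+\epsilon)\delta\le\frac12$), provided that it is given black-box access to unique decoders of an ensemble of $O(1+\epsilon^{-1}\log m)$ binary codes of length $m$ that meet the Gilbert–Varshamov bound: for each $k\ge0$ with $(1+\epsilon)^k\le m$, a code $C_k\subseteq\{0,1\}^m$ of minimum distance at least $d_k=2r_k+1$, $r_k=\lfloor(1+\epsilon)^k\rfloor$, with $|C_k|\ge2^{\kappa_{GV}(d_k/m)m}$, and a map that sends every word within distance $r_k$ of a codeword to that codeword. Moreover, every decoding radius between $d_{\min}/2$ and $d_{\min}$ works. Let $\{x_i,x_j\}$ be the unique closest pair of $x_0,\dots,x_{n-1}\in\{0,1\}^m$, let $C\subseteq\{0,1\}^m$ be a code of minimum distance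 at least $d$ with decoding radius $r=\lfloor\frac{d-1}{2}\rfloor$ satisfying $d_{\min}/2\le r\le d_{\min}$, and let $D:\{0,1\}^m\to\{0,1\}^m$ send every word within distance $r$ of a codeword to that codeword. Put $\mathrm{Dec}(v)=D(v)$ if $v$ and $D(v)$ have distance at most $r$, and $\mathrm{Dec}(v)=v$ otherwise. Then for at least $|C|\binom{d_{\min}}{r}$ of the shifts $y\in\{0,1\}^m$ one has $\mathrm{Dec}(y+x_i)=\mathrm{Dec}(y+x_j)\neq\mathrm{Dec}(y+x_k)$ for all $k\ne i,j$. -/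

import Mathlib

open MeasureTheory

/-! ## Entropy and the two rate functions -/

/-- The binary entropy function, in bits. -/
noncomputable def H2 (p : ℝ) : ℝ := Real.binEntropy p / Real.log 2

/-- The inverse of the binary entropy function on its increasing branch `[0, 1/2]`. -/
noncomputable def H2inv (y : ℝ) : ℝ := Function.invFunOn H2 (Set.Icc 0 (1 / 2)) y

/-- The Gilbert-Varshamov rate `1 - H2 δ` on `[0, 1/2]`, continued by `0` to the right. -/
noncomputable def kappaGV (δ : ℝ) : ℝ := if δ < 1 / 2 then 1 - H2 δ else 0

/-- The rate given by the Zyablov bound on `[0, 1/2]`, continued by `0` to the right. -/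
noncomputable def kappaZ (δ : ℝ) : ℝ :=
  if δ < 1 / 2 then
    sSup ((fun κ : ℝ => κ * (1 - δ / H2inv (1 - κ))) '' Set.Ioo 0 (1 - H2 δ))
  else 0

/-! ## Binary vectors, codes, unique decoding -/

/-- Binary vectors of length `m`. -/
abbrev BVec (m : ℕ) : Type := Fin m → ZMod 2

/-- `C` has minimum distance at least `d`. -/
def HasMinDist {m : ℕ} (C : Finset (BVec m)) (d : ℕ) : Prop :=
  ∀ v ∈ C, ∀ w ∈ C, v ≠ w → d ≤ hammingDist v w

/-- `D` decodes `C` up to radius `r`; nothing is asked of `D` on words that are farther than `r`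
from every codeword. -/
def Decodes {m : ℕ} (C : Finset (BVec m)) (r : ℕ) (D : BVec m → BVec m) : Prop :=
  ∀ v : BVec m, ∀ w ∈ C, hammingDist v w ≤ r → D v = w

/-- The decoding subroutine: run `D`, and keep its answer only if it is within distance `r`. -/
def dec {m : ℕ} (D : BVec m → BVec m) (r : ℕ) (v : BVec m) : BVec m :=
  if hammingDist v (D v) ≤ r then D v else v

/-- The pair `i < j` is the unique pair of indices with minimum pairwise distance. -/
def IsUniqueClosestPair {n m : ℕ} (x : Fin n → BVec m) (i j : Fin n) : Prop :=
  i < j ∧ ∀ k l : Fin n, k < l → (k, l) ≠ (i, j) →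
    hammingDist (x i) (x j) < hammingDist (x k) (x l)

/-- The shift `y` is good: after shifting by `y` and decoding, the vectors `i` and `j` coincide and
differ from all the others, so that they are adjacent in every sorting of the decoded list. -/
def IsGoodShift {n m : ℕ} (x : Fin n → BVec m) (i j : Fin n) (D : BVec m → BVec m) (r : ℕ)
    (y : BVec m) : Prop :=
  dec D r (y + x i) = dec D r (y + x j) ∧
    ∀ k : Fin n, k ≠ i → k ≠ j → dec D r (y + x k) ≠ dec D r (y + x i)

/-- The `k`-th decoding radius of the geometric search. -/
noncomputable def searchRadius (ε : ℝ) (k : ℕ) : ℕ := ⌊(1 + ε) ^ k⌋₊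

/-- An ensemble of codes of length `m` meeting the Gilbert-Varshamov bound, with decoders `D k`, one
for each of the (at most `1 + ε⁻¹ log₂ m`) indices `k` with `(1 + ε) ^ k ≤ m`. The `k`-th code has
decoding radius `searchRadius ε k`. The functions `D k` with `(1 + ε) ^ k > m` are arbitrary. -/
def IsGVEnsemble (ε : ℝ) (m : ℕ) (C : ℕ → Finset (BVec m)) (D : ℕ → BVec m → BVec m) : Prop :=
  ∀ k : ℕ, (1 + ε) ^ k ≤ (m : ℝ) →
    HasMinDist (C k) (2 * searchRadius ε k + 1) ∧
    (2 : ℝ) ^ (kappaGV (((2 * searchRadius ε k + 1 : ℕ) : ℝ) / m) * m) ≤ ((C k).card : ℝ) ∧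
    Decodes (C k) (searchRadius ε k) (D k)

/-! ## Randomized random access machines with logarithmic cost

A program has variables and a heap, both holding natural numbers, it can toss fair coins and it can
call decoders given as black boxes. -/

/-- Programs. The arguments named `v`, `a`, `b`, `k` are names of variables. -/
inductive Cmd : Type
  /-- do nothing -/
  | skip : Cmd
  /-- `v := c` for the literal `c` -/
  | const (v c : ℕ) : Cmd
  /-- `v := a + b` -/
  | add (v a b : ℕ) : Cmd
  /-- `v := a - b`, truncated at `0` -/
  | sub (v a b : ℕ) : Cmd
  /-- `v := heap[a]` -/
  | load (v a : ℕ) : Cmd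
  /-- `heap[a] := b` -/
  | store (a b : ℕ) : Cmd
  /-- `v :=` a random bit -/
  | flip (v : ℕ) : Cmd
  /-- apply the decoder number `k` to the word stored from address `a` on, and write the result
  from address `b` on -/
  | query (k a b : ℕ) : Cmd
  /-- sequential composition -/
  | seq (p q : Cmd) : Cmd
  /-- `if a < b then p else q` -/
  | ite (a b : ℕ) (p q : Cmd) : Cmd
  /-- `while a < b do p` -/
  | loop (a b : ℕ) (p : Cmd) : Cmd

/-- The program never calls a decoder. -/
def Cmd.QueryFree : Cmd → Prop
  | .query _ _ _ => False
  | .seq p q => p.QueryFree ∧ q.QueryFree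
  | .ite _ _ p q => p.QueryFree ∧ q.QueryFree
  | .loop _ _ p => p.QueryFree
  | _ => True

/-- Memory contents together with the coin tosses that have not been used yet. -/
structure RAMState where
  vars : ℕ → ℕ
  heap : ℕ → ℕ
  coins : ℕ → Bool

/-- Assign the value `c` to the variable `v`. -/
def RAMState.set (s : RAMState) (v c : ℕ) : RAMState :=
  { s with vars := Function.update s.vars v c }

/-- The word of length `m` stored in the heap from address `a` on. -/
def RAMState.readWord (s : RAMState) (m a : ℕ) : BVec m := fun k => (s.heap (a + k) : ZMod 2)

/-- Write a word into the heap from address `a` on. -/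
def RAMState.writeWord {m : ℕ} (s : RAMState) (a : ℕ) (w : BVec m) : RAMState :=
  { s with heap := fun p =>
      if h : a ≤ p ∧ p - a < m then (w ⟨p - a, h.2⟩).val else s.heap p }

/-- The logarithmic cost of handling a number: its bit length plus one. -/
def bitCost (a : ℕ) : ℕ := a.size + 1

/-- `Exec D p s s' t`: started in `s`, with `D` as the decoders for words of length `m`, the
program `p` halts in `s'` after time `t`. Every instruction is charged the bit lengths of all the
numbers and heap addresses that it handles. -/
inductive Exec {m : ℕ} (D : ℕ → BVec m → BVec m) : Cmd → RAMState → RAMState → ℕ → Prop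
  | skip (s : RAMState) : Exec D .skip s s 1
  | const (s : RAMState) (v c : ℕ) : Exec D (.const v c) s (s.set v c) (bitCost c)
  | add (s : RAMState) (v a b : ℕ) :
      Exec D (.add v a b) s (s.set v (s.vars a + s.vars b))
        (bitCost (s.vars a) + bitCost (s.vars b))
  | sub (s : RAMState) (v a b : ℕ) :
      Exec D (.sub v a b) s (s.set v (s.vars a - s.vars b))
        (bitCost (s.vars a) + bitCost (s.vars b))
  | load (s : RAMState) (v a : ℕ) :
      Exec D (.load v a) s (s.set v (s.heap (s.vars a)))
        (bitCost (s.vars a) + bitCost (s.heap (s.vars a)))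
  | store (s : RAMState) (a b : ℕ) :
      Exec D (.store a b) s { s with heap := Function.update s.heap (s.vars a) (s.vars b) }
        (bitCost (s.vars a) + bitCost (s.vars b))
  | flip (s : RAMState) (v : ℕ) :
      Exec D (.flip v) s
        { s.set v (s.coins 0).toNat with coins := fun k => s.coins (k + 1) } 1
  | query (s : RAMState) (k a b : ℕ) :
      Exec D (.query k a b) s
        (s.writeWord (s.vars b) (D (s.vars k) (s.readWord m (s.vars a))))
        (bitCost (s.vars k)
          + ∑ l : Fin m, (bitCost (s.vars a + l) + bitCost (s.heap (s.vars a + l))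
              + bitCost (s.vars b + l)) + 1)
  | seq {p q : Cmd} {s s' s'' : RAMState} {t t' : ℕ} :
      Exec D p s s' t → Exec D q s' s'' t' → Exec D (.seq p q) s s'' (t + t')
  | iteTrue {a b : ℕ} {p q : Cmd} {s s' : RAMState} {t : ℕ} :
      s.vars a < s.vars b → Exec D p s s' t →
      Exec D (.ite a b p q) s s' (bitCost (s.vars a) + bitCost (s.vars b) + t)
  | iteFalse {a b : ℕ} {p q : Cmd} {s s' : RAMState} {t : ℕ} :
      ¬ s.vars a < s.vars b → Exec D q s s' t →
      Exec D (.ite a b p q) s s' (bitCost (s.vars a) + bitCost (s.vars b) + t)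
  | loopTrue {a b : ℕ} {p : Cmd} {s s' s'' : RAMState} {t t' : ℕ} :
      s.vars a < s.vars b → Exec D p s s' t → Exec D (.loop a b p) s' s'' t' →
      Exec D (.loop a b p) s s'' (bitCost (s.vars a) + bitCost (s.vars b) + t + t')
  | loopFalse {a b : ℕ} {p : Cmd} {s : RAMState} :
      ¬ s.vars a < s.vars b →
      Exec D (.loop a b p) s s (bitCost (s.vars a) + bitCost (s.vars b))

/-- The initial state on input `x`: the variables `0` and `1` hold `n` and `m`, the heap cell
`i * m + k` holds the `k`-th bit of `x i`, everything else is `0`. -/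
def inputState {n m : ℕ} (x : Fin n → BVec m) (ω : ℕ → Bool) : RAMState where
  vars := fun v => if v = 0 then n else if v = 1 then m else 0
  heap := fun a =>
    if h : a < n * m then
      (x (finProdFinEquiv.symm ⟨a, h⟩).1 (finProdFinEquiv.symm ⟨a, h⟩).2).val
    else 0
  coins := ω

/-- The law of an infinite sequence of independent fair coin tosses. -/
noncomputable def coinLaw : Measure (ℕ → Bool) :=
  Measure.infinitePi fun _ : ℕ => (PMF.uniformOfFintype Bool).toMeasure

/-- On input `x`, the randomized program `p` with decoders `D` halts within time `T` for every
outcome of the coin tosses, and with probability at least `1 - 1 / n ^ 2` it halts with `i`, `j` and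
the distance of `x i` and `x j` in the variables `0`, `1` and `2`. -/
def Finds {n m : ℕ} (p : Cmd) (D : ℕ → BVec m → BVec m) (x : Fin n → BVec m) (i j : Fin n)
    (T : ℝ) : Prop :=
  (∀ ω : ℕ → Bool, ∃ (s : RAMState) (t : ℕ), Exec D p (inputState x ω) s t ∧ (t : ℝ) ≤ T) ∧
  1 - 1 / (n : ℝ) ^ 2 ≤ coinLaw.real {ω : ℕ → Bool | ∃ (s : RAMState) (t : ℕ),
    Exec D p (inputState x ω) s t ∧
      s.vars 0 = (i : ℕ) ∧ s.vars 1 = (j : ℕ) ∧ s.vars 2 = hammingDist (x i) (x j)}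

/-- The time bound `A ε⁻¹ n (log₂ n)² 2 ^ ((1 - κ((1 + ε) δ) - δ H2((1 - ε) / 2)) m) m ^ c`, where
`δ = d / m`, for a rate function `κ`. -/
noncomputable def timeBound (κ : ℝ → ℝ) (A : ℝ) (c : ℕ) (ε : ℝ) (n m d : ℕ) : ℝ :=
  A * ε⁻¹ * n * Real.logb 2 n ^ 2 *
    (2 : ℝ) ^ ((1 - κ ((1 + ε) * ((d : ℝ) / m)) - (d : ℝ) / m * H2 ((1 - ε) / 2)) * m) *
    (m : ℝ) ^ c

/-! # Closest pairs by searching in Hamming balls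

Let `K` be half the minimum distance, rounded up. The words within distance `K` of the vectors are
generated level by level and kept in a table indexed by words; the word half-way between the closest
pair is reached first from one of the two, so the pair shows up as a collision. If the balls turn
out to have more than `n` words, all pairs are examined instead. The time is thus about
`n * min n V`, where `V` is the size of a ball of radius `K`. For `δ ≤ 1 / 4` the number `V`, and
for larger `δ` by the sphere packing and Singleton bounds the number `n`, is at most a polynomial
factor times `2 ^ ((1 - κ((1 + ε) δ) - δ H2((1 - ε) / 2)) m)` for both rate functions `κ`. The program
makes no errors, and needs neither coins nor decoders. -/

/-! ## Combinatorics of binary words -/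

/-! The algorithmic claims rest on one estimate. Let `d` be the minimum distance, `δ = d / m`, `K =
⌈d / 2⌉`, and `V` the number of words in a ball of radius `K`. Since `κ` is at most the
Gilbert–Varshamov rate, which is nonincreasing, and since `H2 ≤ 1`, the allowed exponent is at least
`(H2 δ - δ) m` for `δ < 1 / 2` and at least `(1 - δ) m` beyond. So it suffices to find the pair in
about `n * min n V` steps and to bound `min n V` by a polynomial times the corresponding power of
two (`min_card_ballCard_le`).

For `δ ≤ 1 / 4`, `V` is roughly `2 ^ (H2 (δ / 2) m)`, and concavity of the entropy gives `H2 (δ / 2)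
+ δ ≤ H2 δ` (`H2_half_add_le`). That inequality fails near `1 / 2`, but there the vectors are so far
apart that they must be few: for `1 / 4 ≤ δ < 1 / 2` sphere packing bounds `n` by roughly `2 ^ ((1 -
H2 (δ / 2)) m)`, and `1 + δ ≤ H2 δ + H2 (δ / 2)` (`one_add_le_H2_add_H2_half`). For `δ ≥ 1 / 2` the
Singleton bound is enough.

The search is correct because of a collision (`Covers.le_hammingDist`). A word half-way between the
closest pair is at distance `⌊d / 2⌋` from one of the two. Whichever vector reaches it first is then
within `d` of that one, so by uniqueness it belongs to the pair, and the other member collides with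
it. It is therefore enough to remember the first vector to reach each word. Flipping bits in
increasing order of position generates every choice of flips once (`sum_choose_searchLevel`). When
the balls have at least `n` words, comparing all pairs fits the same bound (`run_closestPairCmd`).

The claim about shifts is independent of the search. For a codeword `c` and an `r`-subset `S` of the
positions where the pair differs, shift by `c + x i + indWord S`. The two shifted vectors are then
at distances `r` and `d - r ≤ r` from `c`, and a third vector decoded to `c` would be within `d` of
`x j`, against uniqueness (`card_mul_choose_le_ncard_goodShift`). -/

/-- The indicator word of a set of positions. -/
def indWord {m : ℕ} (S : Finset (Fin m)) : BVec m := fun k => if k ∈ S then 1 else 0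

theorem hammingDist_add_indWord {m : ℕ} (v : BVec m) (S : Finset (Fin m)) :
    hammingDist (v + indWord S) v = S.card := by
  unfold hammingDist
  congr 1
  ext k
  by_cases h : k ∈ S <;> simp [indWord, h]

theorem indWord_injective {m : ℕ} : Function.Injective (indWord (m := m)) := by
  intro S T h
  ext k
  have := congrFun h k
  by_cases h1 : k ∈ S <;> by_cases h2 : k ∈ T <;> simp_all [indWord]

theorem BVec.add_self {m : ℕ} (v : BVec m) : v + v = 0 := by
  ext k
  exact CharTwo.add_self_eq_zero (v k)

theorem hammingDist_add_left {m : ℕ} (y v w : BVec m) :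
    hammingDist (y + v) (y + w) = hammingDist v w := by
  unfold hammingDist
  congr 1
  ext k
  simp

/-- The positions at which two words differ. -/
def diffSet {m : ℕ} (v w : BVec m) : Finset (Fin m) := {k | v k ≠ w k}

theorem card_diffSet {m : ℕ} (v w : BVec m) : (diffSet v w).card = hammingDist v w := rfl

theorem ZMod.two_eq_add_one {a b : ZMod 2} (h : a ≠ b) : a = b + 1 := by
  revert a b
  decide

/-- Walking from `v` along part of the differences meets the walk from `w` along the rest. This
supplies both the good shifts and the half-way word of the search. -/
theorem add_indWord_eq_add_indWord {m : ℕ} {v w : BVec m} {S : Finset (Fin m)}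
    (hS : S ⊆ diffSet v w) : v + indWord S = w + indWord (diffSet v w \ S) := by
  ext k
  by_cases h : k ∈ S
  · have h1 : v k ≠ w k := by simpa [diffSet] using hS h
    have h2 := ZMod.two_eq_add_one h1
    simp only [Pi.add_apply, indWord, h, if_true, Finset.mem_sdiff, not_true, and_false, if_false]
    rw [h2, add_assoc, CharTwo.add_self_eq_zero]
  · by_cases h1 : v k = w k
    · simp [indWord, h, diffSet, h1]
    · have h2 := ZMod.two_eq_add_one h1
      simp [indWord, h, diffSet, h2]

theorem IsUniqueClosestPair.eq_of_hammingDist_le {n m : ℕ} {x : Fin n → BVec m} {i j k l : Fin n}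
    (h : IsUniqueClosestPair x i j) (hkl : k ≠ l)
    (hd : hammingDist (x k) (x l) ≤ hammingDist (x i) (x j)) :
    (k = i ∧ l = j) ∨ (k = j ∧ l = i) := by
  rcases lt_or_gt_of_ne hkl with hlt | hlt
  · by_contra hne
    have := h.2 k l hlt (fun he => hne (Or.inl (by simpa using he)))
    omega
  · by_contra hne
    have := h.2 l k hlt (fun he => hne (Or.inr (by simpa [and_comm] using he)))
    rw [hammingDist_comm (x l)] at this
    omega

theorem IsUniqueClosestPair.hammingDist_le {n m : ℕ} {x : Fin n → BVec m} {i j k l : Fin n}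
    (h : IsUniqueClosestPair x i j) (hkl : k ≠ l) :
    hammingDist (x i) (x j) ≤ hammingDist (x k) (x l) := by
  by_contra hlt
  rcases h.eq_of_hammingDist_le hkl (by omega) with ⟨rfl, rfl⟩ | ⟨rfl, rfl⟩
  · exact hlt le_rfl
  · rw [hammingDist_comm] at hlt
    exact hlt le_rfl

/-! ### Good shifts -/

/-- Every decoding radius between half the minimum distance and the minimum distance works: each
codeword `c` and each `r`-subset `S` of the positions where `x i` and `x j` differ give the good
shift `c + x i + indWord S`. -/
theorem card_mul_choose_le_ncard_goodShift {n m : ℕ} {x : Fin n → BVec m} {i j : Fin n}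
    {C : Finset (BVec m)} {r : ℕ} {D : BVec m → BVec m} (hx : IsUniqueClosestPair x i j)
    (hD : Decodes C r D) (h1 : hammingDist (x i) (x j) ≤ 2 * r)
    (h2 : r ≤ hammingDist (x i) (x j)) :
    C.card * (hammingDist (x i) (x j)).choose r ≤
      {y : BVec m | IsGoodShift x i j D r y}.ncard := by
  classical
  set F : BVec m × Finset (Fin m) → BVec m := fun p => x i + (p.1 + indWord p.2) with hF
  have key : ∀ c S, x i + F (c, S) = c + indWord S := by
    intro c S
    simp only [hF]
    rw [← add_assoc, BVec.add_self, zero_add]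
  -- Distinct choices give distinct shifts: `c + indWord S` is within `r` of `c`, so `D` recovers
  -- `c`, and then `S` is determined.
  have hinj : Set.InjOn F (C ×ˢ (diffSet (x i) (x j)).powersetCard r : Finset _) := by
    rintro ⟨c, S⟩ hc ⟨c', S'⟩ hc' he
    simp only [Finset.coe_product, Set.mem_prod, Finset.mem_coe, Finset.mem_powersetCard] at hc hc'
    have he' : c + indWord S = c' + indWord S' := by
      rw [← key, ← key, he]
    have e1 : D (c + indWord S) = c :=
      hD _ c hc.1 (by rw [hammingDist_add_indWord, hc.2.2])
    have e2 : D (c' + indWord S') = c' :=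
      hD _ c' hc'.1 (by rw [hammingDist_add_indWord, hc'.2.2])
    have e3 : c = c' := by rw [← e1, ← e2, he']
    subst e3
    exact Prod.ext rfl (indWord_injective (add_left_cancel he'))
  have hcard : C.card * (hammingDist (x i) (x j)).choose r =
      ((C ×ˢ (diffSet (x i) (x j)).powersetCard r).image F).card := by
    rw [Finset.card_image_of_injOn hinj, Finset.card_product, Finset.card_powersetCard,
      card_diffSet]
  rw [hcard, ← Set.ncard_coe_finset]
  refine Set.ncard_le_ncard ?_ (Set.toFinite _)
  intro y hy
  simp only [Finset.coe_image, Finset.coe_product, Set.mem_image, Set.mem_prod, Finset.mem_coe,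
    Finset.mem_powersetCard, Prod.exists] at hy
  obtain ⟨c, S, ⟨hc, hS, hSr⟩, rfl⟩ := hy
  have ei : F (c, S) + x i = c + indWord S := by rw [add_comm, key]
  have ej : F (c, S) + x j = c + indWord (diffSet (x i) (x j) \ S) := by
    have := add_indWord_eq_add_indWord hS
    calc F (c, S) + x j = c + (x i + indWord S) + x j := by simp only [hF]; abel
      _ = c + indWord (diffSet (x i) (x j) \ S) + (x j + x j) := by rw [this]; abel
      _ = _ := by rw [BVec.add_self, add_zero]
  have di : hammingDist (F (c, S) + x i) c = r := by rw [ei, hammingDist_add_indWord, hSr]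
  have dj : hammingDist (F (c, S) + x j) c = hammingDist (x i) (x j) - r := by
    rw [ej, hammingDist_add_indWord, Finset.card_sdiff_of_subset hS, card_diffSet, hSr]
  have hdec : ∀ v, hammingDist v c ≤ r → dec D r v = c := by
    intro v hv
    simp [dec, hD v c hc hv, hv]
  have hi := hdec _ di.le
  have hj := hdec (F (c, S) + x j) (by omega)
  refine ⟨hi.trans hj.symm, fun k hki hkj hk => ?_⟩
  rw [hi] at hk
  -- In the branch where `dec` returns its argument, that argument is `c` itself, at distance `0`.
  have dk : hammingDist (F (c, S) + x k) c ≤ r := by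
    unfold dec at hk
    split_ifs at hk with h
    · rwa [hk] at h
    · simp [hk]
  -- The comparison is with `x j`, not `x i`: the distances to `c` then add up to at most `r + (d -
  -- r) = d`.
  have tri := hammingDist_triangle_right (F (c, S) + x k) (F (c, S) + x j) c
  rw [hammingDist_add_left] at tri
  rcases hx.eq_of_hammingDist_le hkj (by omega) with h | h
  · exact hki h.1
  · exact hkj h.1

/-! ### Packing bounds on the number of vectors -/

/-- The sphere packing bound. -/
theorem card_mul_choose_le_two_pow {n m e : ℕ} {x : Fin n → BVec m}
    (hx : ∀ k l, k ≠ l → 2 * e < hammingDist (x k) (x l)) : n * m.choose e ≤ 2 ^ m := by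
  classical
  have hinj : Set.InjOn (fun p : Fin n × Finset (Fin m) => x p.1 + indWord p.2)
      ((Finset.univ : Finset (Fin n)) ×ˢ (Finset.univ : Finset (Fin m)).powersetCard e :
        Finset _) := by
    rintro ⟨k, S⟩ hS ⟨l, T⟩ hT he
    simp only [Finset.coe_product, Set.mem_prod, Finset.mem_coe, Finset.mem_powersetCard] at hS hT
    simp only at he
    have hkl : k = l := by
      by_contra hne
      have t := hammingDist_triangle_left (x k) (x l) (x k + indWord S)
      rw [hammingDist_add_indWord, he, hammingDist_add_indWord, hS.2.2, hT.2.2] at t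
      have := hx k l hne
      omega
    subst hkl
    exact Prod.ext rfl (indWord_injective (add_left_cancel he))
  have h := Finset.card_le_card (Finset.subset_univ (Finset.image
    (fun p : Fin n × Finset (Fin m) => x p.1 + indWord p.2)
      ((Finset.univ : Finset (Fin n)) ×ˢ (Finset.univ : Finset (Fin m)).powersetCard e)))
  rw [Finset.card_image_of_injOn hinj, Finset.card_product, Finset.card_powersetCard] at h
  simpa [ZMod.card] using h

/-- The Singleton bound. -/
theorem card_le_two_pow_of_le_hammingDist {n m d : ℕ} {x : Fin n → BVec m} (hd : 1 ≤ d)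
    (hdm : d ≤ m) (hx : ∀ k l, k ≠ l → d ≤ hammingDist (x k) (x l)) : n ≤ 2 ^ (m - d + 1) := by
  have hle : m - d + 1 ≤ m := by omega
  have hinj : Function.Injective
      (fun k : Fin n => fun t : Fin (m - d + 1) => x k (Fin.castLE hle t)) := by
    intro k l he
    by_contra hne
    have h1 := hx k l hne
    -- Words that agree in the first `m - d + 1` places can differ only in the remaining `d - 1`.
    have h2 : diffSet (x k) (x l) ⊆ Finset.univ \ Finset.univ.image (Fin.castLE hle) := by
      intro t ht
      simp only [Finset.mem_sdiff, Finset.mem_univ, true_and, Finset.mem_image, not_exists]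
      rintro u rfl
      have := congrFun he u
      simp [diffSet] at ht
      exact ht this
    have h3 := Finset.card_le_card h2
    rw [card_diffSet, Finset.card_sdiff_of_subset (Finset.subset_univ _),
      Finset.card_image_of_injective _ (Fin.castLE_injective hle)] at h3
    simp at h3
    omega
  have h := Fintype.card_le_of_injective _ hinj
  simpa [ZMod.card] using h

/-! ## Entropy -/

theorem H2_nonneg {p : ℝ} (h0 : 0 ≤ p) (h1 : p ≤ 1) : 0 ≤ H2 p :=
  div_nonneg (Real.binEntropy_nonneg h0 h1) (Real.log_nonneg one_le_two)

theorem H2_le_one (p : ℝ) : H2 p ≤ 1 := by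
  rw [H2, div_le_one (Real.log_pos one_lt_two)]
  exact Real.binEntropy_le_log_two

theorem H2_mono {p q : ℝ} (h0 : 0 ≤ p) (hpq : p ≤ q) (hq : q ≤ 1 / 2) : H2 p ≤ H2 q := by
  have := Real.binEntropy_strictMonoOn.monotoneOn (a := p) (b := q)
    ⟨h0, by linarith⟩ ⟨by linarith, by linarith⟩ hpq
  exact div_le_div_of_nonneg_right this (Real.log_nonneg one_le_two)

theorem concaveOn_H2 : ConcaveOn ℝ (Set.Icc 0 1) H2 := by
  have h := Real.strictConcave_binEntropy.concaveOn.smul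
    (c := (Real.log 2)⁻¹) (inv_nonneg.2 (Real.log_nonneg one_le_two))
  have e : H2 = fun p => (Real.log 2)⁻¹ • Real.binEntropy p := by
    ext p
    rw [H2, div_eq_inv_mul, smul_eq_mul]
  rw [e]
  exact h

/-- Since `0 ^ 0 = 1`, the entropy formula below needs no separate treatment of `k = 0` and `k = m`.
-/
theorem natCast_pow_self_pos (a : ℕ) : (0 : ℝ) < (a : ℝ) ^ a := by
  rcases Nat.eq_zero_or_pos a with rfl | h
  · simp
  · have : (0 : ℝ) < a := by exact_mod_cast h
    positivity

/-- `2 ^ (m H2(k / m))` is the reciprocal of the largest probability of the binomial law. -/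
theorem two_rpow_H2_mul {m k : ℕ} (hm : 1 ≤ m) (hk : k ≤ m) :
    (2 : ℝ) ^ (H2 ((k : ℝ) / m) * m) * ((k : ℝ) ^ k * ((m - k : ℕ) : ℝ) ^ (m - k)) =
      (m : ℝ) ^ m := by
  have hm0 : (0 : ℝ) < m := by exact_mod_cast hm
  have hl2 : Real.log 2 ≠ 0 := (Real.log_pos one_lt_two).ne'
  have hpos := natCast_pow_self_pos
  apply Real.log_injOn_pos
  · exact Set.mem_Ioi.2 (mul_pos (Real.rpow_pos_of_pos two_pos _) (mul_pos (hpos _) (hpos _)))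
  · exact Set.mem_Ioi.2 (hpos m)
  rw [Real.log_mul (Real.rpow_pos_of_pos two_pos _).ne' (mul_pos (hpos _) (hpos _)).ne',
    Real.log_rpow two_pos, Real.log_mul (hpos _).ne' (hpos _).ne', Real.log_pow, Real.log_pow,
    Real.log_pow, H2, Real.binEntropy]
  have e : (1 : ℝ) - k / m = ((m - k : ℕ) : ℝ) / m := by
    rw [Nat.cast_sub hk]; field_simp
  have hterm : ∀ a : ℕ, (a : ℝ) / m * Real.log ((a : ℝ) / m)⁻¹ * m =
      a * Real.log m - a * Real.log a := by
    intro a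
    rcases Nat.eq_zero_or_pos a with rfl | h
    · simp
    · have ha : (0 : ℝ) < a := by exact_mod_cast h
      rw [inv_div, Real.log_div hm0.ne' ha.ne']
      field_simp
  rw [e]
  have h1 := hterm k
  have h2 := hterm (m - k)
  have h3 : ((m - k : ℕ) : ℝ) = m - k := Nat.cast_sub hk
  have h4 : ((k : ℝ) / m * Real.log ((k : ℝ) / m)⁻¹ +
      ((m - k : ℕ) : ℝ) / m * Real.log (((m - k : ℕ) : ℝ) / m)⁻¹) / Real.log 2 * m * Real.log 2 =
      (k : ℝ) / m * Real.log ((k : ℝ) / m)⁻¹ * m +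
      ((m - k : ℕ) : ℝ) / m * Real.log (((m - k : ℕ) : ℝ) / m)⁻¹ * m := by
    field_simp
  rw [h4, h1, h2]
  have h5 : ((m - k : ℕ) : ℝ) * Real.log m = m * Real.log m - k * Real.log m := by
    rw [h3]; ring
  rw [h5]; ring

/-- The term with index `k` in the expansion of `(k + (m - k)) ^ m` is at most the whole sum `m ^
m`. -/
theorem choose_le_two_rpow_H2 {m k : ℕ} (hm : 1 ≤ m) (hk : k ≤ m) :
    (m.choose k : ℝ) ≤ (2 : ℝ) ^ (H2 ((k : ℝ) / m) * m) := by
  have h : k ^ k * (m - k) ^ (m - k) * m.choose k ≤ m ^ m := by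
    have e := add_pow k (m - k) m
    rw [Nat.add_sub_cancel' hk] at e
    rw [e]
    exact Finset.single_le_sum (f := fun t => k ^ t * (m - k) ^ (m - t) * m.choose t)
      (fun _ _ => Nat.zero_le _) (Finset.mem_range.2 (by omega))
  have h' : (k : ℝ) ^ k * ((m - k : ℕ) : ℝ) ^ (m - k) * m.choose k ≤ (m : ℝ) ^ m := by
    exact_mod_cast h
  rw [← two_rpow_H2_mul hm hk, mul_comm] at h'
  exact le_of_mul_le_mul_right h' (mul_pos (natCast_pow_self_pos _) (natCast_pow_self_pos _))

/-- The term with index `k` is the largest one in the expansion of `(k + (m - k)) ^ m`. -/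
theorem binomial_term_le {m k t : ℕ} (hk : k ≤ m) (ht : t ≤ m) :
    k ^ t * (m - k) ^ (m - t) * m.choose t ≤ k ^ k * (m - k) ^ (m - k) * m.choose k := by
  rcases hk.eq_or_lt with rfl | hkm
  · rcases ht.eq_or_lt with rfl | h
    · exact le_rfl
    · rw [Nat.sub_self, zero_pow (by omega)]; simp
  set f : ℕ → ℕ := fun t => k ^ t * (m - k) ^ (m - t) * m.choose t with hf
  obtain ⟨l, rfl⟩ : ∃ l, m = k + l := ⟨m - k, by omega⟩
  have hl : 0 < l := by omega
  simp only [Nat.add_sub_cancel_left] at hf ⊢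
  -- The ratio of consecutive terms is `k (m - s) / ((s + 1) l)`: at least `1` for `s < k`, at most
  -- `1` for `s ≥ k`.
  have hstep : ∀ s, s < k + l → f (s + 1) * ((s + 1) * l) = f s * (k * (k + l - s)) := by
    intro s hs
    have e := Nat.choose_succ_right_eq (k + l) s
    obtain ⟨u, hu⟩ : ∃ u, k + l - s = u + 1 := ⟨k + l - s - 1, by omega⟩
    have hu' : k + l - (s + 1) = u := by omega
    simp only [hf, hu', hu] at e ⊢
    calc k ^ (s + 1) * l ^ u * (k + l).choose (s + 1) * ((s + 1) * l)
        = k ^ (s + 1) * l ^ u * l * ((k + l).choose (s + 1) * (s + 1)) := by ring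
      _ = _ := by rw [e]; ring
  have hup : ∀ s, s < k → f s ≤ f (s + 1) := by
    intro s hs
    have h1 : (s + 1) * l ≤ k * (k + l - s) := by
      have : s + 1 ≤ k := hs
      calc (s + 1) * l ≤ k * l := Nat.mul_le_mul_right _ this
        _ ≤ _ := Nat.mul_le_mul_left _ (by omega)
    have h2 := hstep s (by omega)
    have h3 : f s * ((s + 1) * l) ≤ f (s + 1) * ((s + 1) * l) := by
      rw [h2]; exact Nat.mul_le_mul_left _ h1
    exact Nat.le_of_mul_le_mul_right h3 (by positivity)
  have hdown : ∀ s, k ≤ s → s < k + l → f (s + 1) ≤ f s := by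
    intro s hs hs'
    have h1 : k * (k + l - s) ≤ (s + 1) * l := by
      calc k * (k + l - s) ≤ k * l := Nat.mul_le_mul_left _ (by omega)
        _ ≤ _ := Nat.mul_le_mul_right _ (by omega)
    have h2 := hstep s hs'
    have h3 : f (s + 1) * ((s + 1) * l) ≤ f s * ((s + 1) * l) := by
      rw [h2]; exact Nat.mul_le_mul_left _ h1
    exact Nat.le_of_mul_le_mul_right h3 (by positivity)
  have hfk : f t ≤ f k := by
    rcases le_total t k with h | h
    · have : ∀ u, u ≤ k → f (k - u) ≤ f k := by
        intro u
        induction u with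
        | zero => simp
        | succ u ih =>
          intro hu
          have := hup (k - (u + 1)) (by omega)
          rw [show k - (u + 1) + 1 = k - u by omega] at this
          exact this.trans (ih (by omega))
      have := this (k - t) (by omega)
      rwa [show k - (k - t) = t by omega] at this
    · have : ∀ u, k + u ≤ k + l → f (k + u) ≤ f k := by
        intro u
        induction u with
        | zero => simp
        | succ u ih =>
          intro hu
          exact (hdown (k + u) (by omega) (by omega)).trans (ih (by omega))
      have := this (t - k) (by omega)
      rwa [show k + (t - k) = t by omega] at this
  simpa [hf] using hfk

/-- The same expansion has `m + 1` terms, none larger than the one with index `k`. -/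
theorem two_rpow_H2_le_choose {m k : ℕ} (hm : 1 ≤ m) (hk : k ≤ m) :
    (2 : ℝ) ^ (H2 ((k : ℝ) / m) * m) ≤ (m + 1) * m.choose k := by
  have h : m ^ m ≤ (m + 1) * (k ^ k * (m - k) ^ (m - k) * m.choose k) := by
    have e := add_pow k (m - k) m
    rw [Nat.add_sub_cancel' hk] at e
    rw [e]
    calc _ ≤ ∑ _t ∈ Finset.range (m + 1), k ^ k * (m - k) ^ (m - k) * m.choose k :=
          Finset.sum_le_sum fun t ht =>
            binomial_term_le hk (by have := Finset.mem_range.1 ht; omega)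
      _ = _ := by simp
  have h' : (m : ℝ) ^ m ≤
      (m + 1) * ((k : ℝ) ^ k * ((m - k : ℕ) : ℝ) ^ (m - k) * m.choose k) := by
    exact_mod_cast h
  rw [← two_rpow_H2_mul hm hk] at h'
  have hp := mul_pos (natCast_pow_self_pos k) (natCast_pow_self_pos (m - k))
  refine le_of_mul_le_mul_right (h'.trans (le_of_eq ?_)) hp
  ring

/-- This factor `m` pays for rounding `d / 2` up or down. -/
theorem choose_succ_le_mul_choose (m k : ℕ) : m.choose (k + 1) ≤ m * m.choose k := by
  have e := Nat.choose_succ_right_eq m k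
  calc m.choose (k + 1) ≤ m.choose (k + 1) * (k + 1) := Nat.le_mul_of_pos_right _ (by omega)
    _ = m.choose k * (m - k) := e
    _ ≤ m.choose k * m := Nat.mul_le_mul_left _ (Nat.sub_le _ _)
    _ = _ := mul_comm _ _

/-! ## Numerical comparison of exponents -/

theorem H2_half : H2 (1 / 2) = 1 := by
  rw [H2, one_div, Real.binEntropy_two_inv, div_self (Real.log_pos one_lt_two).ne']

theorem H2_quarter_mul : H2 (1 / 4) * Real.log 2 = 2 * Real.log 2 - 3 / 4 * Real.log 3 := by
  have h4 : Real.log 4 = 2 * Real.log 2 := by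
    rw [show (4 : ℝ) = 2 ^ 2 by norm_num, Real.log_pow]; norm_num
  rw [H2, div_mul_cancel₀ _ (Real.log_pos one_lt_two).ne', Real.binEntropy,
    show ((1 : ℝ) / 4)⁻¹ = 4 by norm_num, show ((1 : ℝ) - 1 / 4)⁻¹ = 4 / 3 by norm_num,
    Real.log_div (by norm_num) (by norm_num), h4]
  ring

theorem H2_eighth_mul : H2 (1 / 8) * Real.log 2 = 3 * Real.log 2 - 7 / 8 * Real.log 7 := by
  have h8 : Real.log 8 = 3 * Real.log 2 := by
    rw [show (8 : ℝ) = 2 ^ 3 by norm_num, Real.log_pow]; norm_num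
  rw [H2, div_mul_cancel₀ _ (Real.log_pos one_lt_two).ne', Real.binEntropy,
    show ((1 : ℝ) / 8)⁻¹ = 8 by norm_num, show ((1 : ℝ) - 1 / 8)⁻¹ = 8 / 7 by norm_num,
    Real.log_div (by norm_num) (by norm_num), h8]
  ring

/-- Multiplied by `8 log 2`, this is `3 ^ 6 * 2 ^ 10 ≤ 7 ^ 7`, that is, `746496 ≤ 823543`. -/
theorem H2_eighth_add_quarter_le : H2 (1 / 8) + 1 / 4 ≤ H2 (1 / 4) := by
  have hl : (0 : ℝ) < Real.log 2 := Real.log_pos one_lt_two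
  have h : 6 * Real.log 3 + 10 * Real.log 2 ≤ 7 * Real.log 7 := by
    have := Real.log_le_log (x := 3 ^ 6 * 2 ^ 10) (y := 7 ^ 7) (by norm_num) (by norm_num)
    rw [Real.log_mul (by norm_num) (by norm_num), Real.log_pow, Real.log_pow, Real.log_pow] at this
    exact_mod_cast this
  refine le_of_mul_le_mul_right ?_ hl
  rw [add_mul, H2_quarter_mul, H2_eighth_mul]
  linarith

/-- Multiplied by `8 log 2`, this is `3 ^ 6 * 7 ^ 7 ≤ 2 ^ 30`. -/
theorem one_add_quarter_le_H2_quarter_add : 1 + 1 / 4 ≤ H2 (1 / 4) + H2 (1 / 8) := by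
  have hl : (0 : ℝ) < Real.log 2 := Real.log_pos one_lt_two
  have h : 6 * Real.log 3 + 7 * Real.log 7 ≤ 30 * Real.log 2 := by
    have := Real.log_le_log (x := 3 ^ 6 * 7 ^ 7) (y := 2 ^ 30) (by norm_num) (by norm_num)
    rw [Real.log_mul (by norm_num) (by norm_num), Real.log_pow, Real.log_pow, Real.log_pow] at this
    exact_mod_cast this
  refine le_of_mul_le_mul_right ?_ hl
  rw [add_mul (H2 (1 / 4)), H2_quarter_mul, H2_eighth_mul]
  linarith

theorem half_le_H2_quarter : 1 / 2 ≤ H2 (1 / 4) := by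
  have hl : (0 : ℝ) < Real.log 2 := Real.log_pos one_lt_two
  have h : Real.log 3 ≤ 2 * Real.log 2 := by
    have := Real.log_le_log (x := 3) (y := 2 ^ 2) (by norm_num) (by norm_num)
    rw [Real.log_pow] at this
    exact_mod_cast this
  refine le_of_mul_le_mul_right ?_ hl
  rw [H2_quarter_mul]
  linarith

/-- By concavity, the slope of `H2` between `δ / 2` and `δ` is at least the one between `1 / 8` and
`1 / 4`. -/
theorem H2_half_add_le {δ : ℝ} (h0 : 0 ≤ δ) (h1 : δ ≤ 1 / 4) : H2 (δ / 2) + δ ≤ H2 δ := by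
  rcases h0.eq_or_lt with rfl | hpos
  · simp
  rcases h1.eq_or_lt with rfl | hlt
  · have := H2_eighth_add_quarter_le
    norm_num at this ⊢
    exact this
  -- A secant of the convex function `-H2` is moved in two stages: `s1` moves its right end from `δ`
  -- to `1 / 4`, `s2` its left end from `δ / 2` to `1 / 8`.
  have s1 := concaveOn_H2.neg.secant_mono (a := δ / 2) (x := δ) (y := 1 / 4)
    ⟨by linarith, by linarith⟩ ⟨by linarith, by linarith⟩ ⟨by norm_num, by norm_num⟩
    (by linarith) (by linarith) hlt.le
  have s2 := concaveOn_H2.neg.secant_mono (a := 1 / 4) (x := δ / 2) (y := 1 / 8)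
    ⟨by linarith, by linarith⟩ ⟨by linarith, by linarith⟩ ⟨by norm_num, by norm_num⟩
    (by linarith) (by norm_num) (by linarith)
  have k := H2_eighth_add_quarter_le
  simp only [Pi.neg_apply] at s1 s2
  have e1 : (-H2 (1 / 4) - -H2 (δ / 2)) / (1 / 4 - δ / 2) =
      (-H2 (δ / 2) - -H2 (1 / 4)) / (δ / 2 - 1 / 4) := by
    rw [← neg_div_neg_eq]; congr 1 <;> ring
  have e2 : (-H2 (1 / 8) - -H2 (1 / 4)) / (1 / 8 - 1 / 4 : ℝ) ≤ -2 := by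
    rw [show (1 / 8 - 1 / 4 : ℝ) = -(1 / 8) by norm_num, div_neg, neg_le_neg_iff,
      le_div_iff₀ (by norm_num)]
    linarith
  have e3 := (s1.trans (e1.le.trans s2)).trans e2
  rw [div_le_iff₀ (by linarith)] at e3
  linarith

/-- The left side is affine and the right side concave in `δ`, so the endpoints suffice. The weights
`2 - 4 * δ` and `4 * δ - 1` express `δ` through `1 / 4` and `1 / 2`. -/
theorem one_add_le_H2_add_H2_half {δ : ℝ} (h0 : 1 / 4 ≤ δ) (h1 : δ ≤ 1 / 2) :
    1 + δ ≤ H2 δ + H2 (δ / 2) := by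
  have concave : ∀ {x y a b : ℝ}, x ∈ Set.Icc (0 : ℝ) 1 → y ∈ Set.Icc (0 : ℝ) 1 → 0 ≤ a → 0 ≤ b →
      a + b = 1 → a • H2 x + b • H2 y ≤ H2 (a • x + b • y) :=
    fun hx hy ha hb hab => concaveOn_H2.2 hx hy ha hb hab
  have c1 := concave (x := 1 / 4) (y := 1 / 2) ⟨by norm_num, by norm_num⟩
    ⟨by norm_num, by norm_num⟩ (a := 2 - 4 * δ) (b := 4 * δ - 1) (by linarith) (by linarith)
    (by ring)
  have c2 := concave (x := 1 / 8) (y := 1 / 4) ⟨by norm_num, by norm_num⟩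
    ⟨by norm_num, by norm_num⟩ (a := 2 - 4 * δ) (b := 4 * δ - 1) (by linarith) (by linarith)
    (by ring)
  simp only [smul_eq_mul] at c1 c2
  rw [show (2 - 4 * δ) * (1 / 4) + (4 * δ - 1) * (1 / 2) = δ by ring, H2_half] at c1
  rw [show (2 - 4 * δ) * (1 / 8) + (4 * δ - 1) * (1 / 4) = δ / 2 by ring] at c2
  have k1 := mul_le_mul_of_nonneg_left one_add_quarter_le_H2_quarter_add
    (show 0 ≤ 2 - 4 * δ by linarith)
  have k2 := mul_le_mul_of_nonneg_left half_le_H2_quarter (show 0 ≤ 4 * δ - 1 by linarith)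
  linarith

/-! ## Rates -/

/-- The entropy increases up to `1 / 2`, and the continuation by `0` is harmless because `H2 ≤ 1`.
This removes `ε` from the rate term. -/
theorem kappaGV_le_one_sub {δ : ℝ} (h0 : 0 ≤ δ) {ε : ℝ} (hε : 0 ≤ ε) :
    kappaGV ((1 + ε) * δ) ≤ 1 - H2 δ := by
  unfold kappaGV
  split_ifs with h
  · have := H2_mono h0 (show δ ≤ (1 + ε) * δ by nlinarith) h.le
    linarith
  · linarith [H2_le_one δ]

theorem kappaGV_eq_zero {δ : ℝ} {ε : ℝ} (hε : 0 ≤ ε) (h1 : 1 / 2 ≤ δ) :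
    kappaGV ((1 + ε) * δ) = 0 := by
  unfold kappaGV
  rw [if_neg]
  nlinarith

/-- Each member of the supremum is at most its `κ`, which is below `1 - H2 δ`. So a bound in terms
of the Gilbert–Varshamov rate covers both statements. -/
theorem kappaZ_le_kappaGV {δ : ℝ} (h0 : 0 ≤ δ) : kappaZ δ ≤ kappaGV δ := by
  unfold kappaZ kappaGV
  split_ifs with h
  · refine Real.sSup_le ?_ (by linarith [H2_le_one δ])
    rintro _ ⟨κ, ⟨hκ0, hκ1⟩, rfl⟩
    -- `H2inv` is a chosen preimage: it is known to lie in `[0, 1 / 2]` only once the intermediate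
    -- value theorem provides a preimage there.
    have hinv : 0 ≤ H2inv (1 - κ) := by
      have hex : ∃ a ∈ Set.Icc (0 : ℝ) (1 / 2), H2 a = 1 - κ := by
        have hc : ContinuousOn H2 (Set.Icc 0 (1 / 2)) :=
          (Real.binEntropy_continuous.div_const _).continuousOn
        refine intermediate_value_Icc (by norm_num) hc ⟨?_, ?_⟩
        · have := H2_nonneg h0 (by linarith)
          simp only [H2, Real.binEntropy_zero, zero_div] at this ⊢
          simp only [H2] at hκ1
          linarith
        · rw [H2_half]; linarith
      exact (Function.invFunOn_mem hex).1
    have : 0 ≤ δ / H2inv (1 - κ) := div_nonneg h0 hinv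
    simp only
    nlinarith
  · exact le_rfl

/-! ## The number of words that the search handles -/

/-- The number of words in a Hamming ball. -/
def ballCard (m ρ : ℕ) : ℕ := ∑ l ∈ Finset.range (ρ + 1), m.choose l

theorem two_rpow_le_two_rpow {a b : ℝ} (h : a ≤ b) : (2 : ℝ) ^ a ≤ (2 : ℝ) ^ b :=
  Real.rpow_le_rpow_of_exponent_le one_le_two h

/-- Spheres of radius at most `d / 2` have at most `2 ^ (H2 (δ / 2) m)` words. Only the outermost
radius can exceed `d / 2`, by rounding, and it costs one more factor `m`. -/
theorem ballCard_le_of_le_quarter {m d : ℕ} (hm : 1 ≤ m) (hd : (d : ℝ) / m ≤ 1 / 4) :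
    (ballCard m ((d + 1) / 2) : ℝ) ≤
      2 * m * (2 : ℝ) ^ ((H2 ((d : ℝ) / m) - (d : ℝ) / m) * m) := by
  have hm0 : (0 : ℝ) < m := by exact_mod_cast hm
  have hm1 : (1 : ℝ) ≤ m := by exact_mod_cast hm
  set X := (2 : ℝ) ^ ((H2 ((d : ℝ) / m) - (d : ℝ) / m) * m) with hX
  have hδ : 0 ≤ (d : ℝ) / m := by positivity
  have hd4 : 4 * d ≤ m := by
    rw [div_le_iff₀ hm0] at hd
    have : (4 : ℝ) * d ≤ m := by linarith
    exact_mod_cast this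
  have hch : ∀ l, 2 * l ≤ d → (m.choose l : ℝ) ≤ X := by
    intro l hl
    refine (choose_le_two_rpow_H2 hm (by omega)).trans (two_rpow_le_two_rpow ?_)
    refine mul_le_mul_of_nonneg_right ?_ hm0.le
    have h1 : (l : ℝ) / m ≤ (d : ℝ) / m / 2 := by
      rw [div_div, mul_comm, ← div_div]
      have : (l : ℝ) ≤ d / 2 := by
        have : (2 : ℝ) * l ≤ d := by exact_mod_cast hl
        linarith
      exact div_le_div_of_nonneg_right this hm0.le
    have := H2_mono (by positivity) h1 (by linarith)
    linarith [H2_half_add_le hδ hd]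
  have hX0 : 0 < X := Real.rpow_pos_of_pos two_pos _
  rcases Nat.eq_zero_or_pos d with h0 | hdpos
  · have := hch 0 (by omega)
    subst h0
    simp only [ballCard, Nat.choose_zero_right, Nat.cast_one] at this ⊢
    norm_num
    nlinarith
  obtain ⟨k, hk⟩ : ∃ k, (d + 1) / 2 = k + 1 := ⟨(d + 1) / 2 - 1, by omega⟩
  rw [hk, ballCard, Finset.sum_range_succ, Nat.cast_add, Nat.cast_sum]
  have h1 : ∑ l ∈ Finset.range (k + 1), (m.choose l : ℝ) ≤ (k + 1) * X := by
    calc _ ≤ ∑ _l ∈ Finset.range (k + 1), X := Finset.sum_le_sum fun l hl =>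
          hch l (by have := Finset.mem_range.1 hl; omega)
      _ = _ := by simp
  have h2 : (m.choose (k + 1) : ℝ) ≤ m * X := by
    calc (m.choose (k + 1) : ℝ) ≤ m * m.choose k := by
          exact_mod_cast choose_succ_le_mul_choose m k
      _ ≤ _ := mul_le_mul_of_nonneg_left (hch k (by omega)) hm0.le
  have h3 : ((k : ℝ) + 1) ≤ m := by
    have : k + 1 ≤ m := by omega
    exact_mod_cast this
  nlinarith

/-- Balls of radius `k = ⌈d / 2⌉ - 1` are disjoint, as `2 * k < d`. Passing to radius `k + 1`, which
is at least `d / 2`, gives `n * 2 ^ (H2 (δ / 2) m) ≤ m * (m + 1) * 2 ^ m`. The numerical inequality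
for `δ ≥ 1 / 4` then finishes. -/
theorem card_le_of_quarter_le {n m d : ℕ} {x : Fin n → BVec m} (hm : 1 ≤ m)
    (h4 : 1 / 4 ≤ (d : ℝ) / m) (h2 : (d : ℝ) / m < 1 / 2)
    (hx : ∀ k l, k ≠ l → d ≤ hammingDist (x k) (x l)) :
    (n : ℝ) ≤ m * (m + 1) * (2 : ℝ) ^ ((H2 ((d : ℝ) / m) - (d : ℝ) / m) * m) := by
  have hm0 : (0 : ℝ) < m := by exact_mod_cast hm
  have hd2 : 2 * d < m := by
    rw [div_lt_iff₀ hm0] at h2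
    have : (2 : ℝ) * d < m := by linarith
    exact_mod_cast this
  have hd0 : 0 < d := by
    rcases Nat.eq_zero_or_pos d with rfl | h
    · norm_num at h4
    · exact h
  obtain ⟨k, hk⟩ : ∃ k, (d + 1) / 2 = k + 1 := ⟨(d + 1) / 2 - 1, by omega⟩
  have hpack := card_mul_choose_le_two_pow (e := k) (x := x) fun a b hab =>
    lt_of_lt_of_le (by omega) (hx a b hab)
  have a1 : (n : ℝ) * m.choose (k + 1) ≤ m * 2 ^ m := by
    calc (n : ℝ) * m.choose (k + 1) ≤ n * (m * m.choose k) := by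
          exact_mod_cast Nat.mul_le_mul_left n (choose_succ_le_mul_choose m k)
      _ = m * (n * m.choose k) := by ring
      _ ≤ _ := by exact_mod_cast Nat.mul_le_mul_left m hpack
  have a2 := two_rpow_H2_le_choose (k := k + 1) hm (by omega)
  have a3 : (2 : ℝ) ^ (H2 ((d : ℝ) / m / 2) * m) ≤ (2 : ℝ) ^ (H2 (((k + 1 : ℕ) : ℝ) / m) * m) := by
    refine two_rpow_le_two_rpow (mul_le_mul_of_nonneg_right ?_ hm0.le)
    refine H2_mono (by positivity) ?_ ?_
    · rw [div_right_comm]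
      refine div_le_div_of_nonneg_right ?_ hm0.le
      have : (d : ℝ) ≤ 2 * (k + 1 : ℕ) := by exact_mod_cast (by omega : d ≤ 2 * (k + 1))
      linarith
    · rw [div_le_iff₀ hm0]
      have : (2 : ℝ) * (k + 1 : ℕ) ≤ m := by exact_mod_cast (by omega : 2 * (k + 1) ≤ m)
      linarith
  have a4 := one_add_le_H2_add_H2_half h4 h2.le
  set Y := (2 : ℝ) ^ (H2 ((d : ℝ) / m / 2) * m) with hY
  have hY0 : 0 < Y := Real.rpow_pos_of_pos two_pos _
  have a5 : (n : ℝ) * Y ≤ m * (m + 1) * 2 ^ m := by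
    calc (n : ℝ) * Y ≤ n * ((m + 1) * m.choose (k + 1)) :=
          mul_le_mul_of_nonneg_left (a3.trans a2) (Nat.cast_nonneg _)
      _ = (m + 1) * (n * m.choose (k + 1)) := by ring
      _ ≤ (m + 1) * (m * 2 ^ m) := mul_le_mul_of_nonneg_left a1 (by positivity)
      _ = _ := by ring
  have a6 : (2 : ℝ) ^ m ≤ (2 : ℝ) ^ ((H2 ((d : ℝ) / m) - (d : ℝ) / m) * m) * Y := by
    rw [hY, ← Real.rpow_add two_pos, ← Real.rpow_natCast]
    refine two_rpow_le_two_rpow ?_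
    nlinarith
  refine le_of_mul_le_mul_right (a5.trans ?_) hY0
  rw [mul_assoc _ _ Y]
  exact mul_le_mul_of_nonneg_left a6 (by positivity)

/-- The ball is the smaller bound for `δ ≤ 1 / 4`. From there on the estimate is for `n`: by sphere
packing below `1 / 2`, and by Singleton beyond, where the rate is not positive. -/
theorem min_card_ballCard_le {n m : ℕ} {x : Fin n → BVec m} {i j : Fin n} (hm : 1 ≤ m)
    (hx : IsUniqueClosestPair x i j) {κ : ℝ → ℝ} (hκ : ∀ t, 0 ≤ t → κ t ≤ kappaGV t) {ε : ℝ}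
    (hε : 0 < ε) :
    ((min n (ballCard m ((hammingDist (x i) (x j) + 1) / 2)) : ℕ) : ℝ) ≤
      2 * (m : ℝ) ^ 2 * (2 : ℝ) ^ ((1 - κ ((1 + ε) * ((hammingDist (x i) (x j) : ℝ) / m)) -
        (hammingDist (x i) (x j) : ℝ) / m * H2 ((1 - ε) / 2)) * m) := by
  have hm0 : (0 : ℝ) < m := by exact_mod_cast hm
  have hm1 : (1 : ℝ) ≤ m := by exact_mod_cast hm
  have hmd : ∀ k l, k ≠ l → hammingDist (x i) (x j) ≤ hammingDist (x k) (x l) :=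
    fun k l hkl => hx.hammingDist_le hkl
  have hdm : hammingDist (x i) (x j) ≤ m := by
    simpa using hammingDist_le_card_fintype (x := x i) (y := x j)
  generalize hammingDist (x i) (x j) = d at *
  have hδ : 0 ≤ (d : ℝ) / m := by positivity
  have hk := hκ ((1 + ε) * ((d : ℝ) / m)) (by positivity)
  have hdH : (d : ℝ) / m * H2 ((1 - ε) / 2) ≤ (d : ℝ) / m :=
    mul_le_of_le_one_right hδ (H2_le_one _)
  rcases lt_or_ge ((d : ℝ) / m) (1 / 2) with h2 | h2
  · have hexp : (2 : ℝ) ^ ((H2 ((d : ℝ) / m) - (d : ℝ) / m) * m) ≤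
        (2 : ℝ) ^ ((1 - κ ((1 + ε) * ((d : ℝ) / m)) - (d : ℝ) / m * H2 ((1 - ε) / 2)) * m) := by
      refine two_rpow_le_two_rpow (mul_le_mul_of_nonneg_right ?_ hm0.le)
      linarith [kappaGV_le_one_sub hδ hε.le]
    have hpos : 0 < (2 : ℝ) ^ ((H2 ((d : ℝ) / m) - (d : ℝ) / m) * m) :=
      Real.rpow_pos_of_pos two_pos _
    rcases le_total ((d : ℝ) / m) (1 / 4) with h4 | h4
    · calc ((min n (ballCard m ((d + 1) / 2)) : ℕ) : ℝ) ≤ (ballCard m ((d + 1) / 2) : ℝ) := by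
            exact_mod_cast min_le_right _ _
        _ ≤ 2 * m * (2 : ℝ) ^ ((H2 ((d : ℝ) / m) - (d : ℝ) / m) * m) :=
            ballCard_le_of_le_quarter hm h4
        _ ≤ _ := mul_le_mul (by nlinarith) hexp hpos.le (by positivity)
    · calc ((min n (ballCard m ((d + 1) / 2)) : ℕ) : ℝ) ≤ (n : ℝ) := by
            exact_mod_cast min_le_left _ _
        _ ≤ m * (m + 1) * (2 : ℝ) ^ ((H2 ((d : ℝ) / m) - (d : ℝ) / m) * m) :=
            card_le_of_quarter_le hm h4 h2 hmd
        _ ≤ _ := mul_le_mul (by nlinarith) hexp hpos.le (by positivity)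
  · have hd1 : 1 ≤ d := by
      rcases Nat.eq_zero_or_pos d with rfl | h
      · norm_num at h2
      · exact h
    have hs := card_le_two_pow_of_le_hammingDist hd1 hdm hmd
    have h0 := kappaGV_eq_zero hε.le h2
    calc ((min n (ballCard m ((d + 1) / 2)) : ℕ) : ℝ) ≤ (n : ℝ) := by
          exact_mod_cast min_le_left _ _
      _ ≤ 2 * 2 ^ (m - d) := by
          rw [← pow_succ']; exact_mod_cast hs
      _ = 2 * (2 : ℝ) ^ ((1 - (d : ℝ) / m) * m) := by
          rw [← Real.rpow_natCast, Nat.cast_sub hdm]; congr 2; field_simp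
      _ ≤ _ := by
          refine mul_le_mul (by nlinarith) (two_rpow_le_two_rpow ?_)
            (Real.rpow_pos_of_pos two_pos _).le (by positivity)
          exact mul_le_mul_of_nonneg_right (by linarith) hm0.le

/-! ## Words as numbers -/

theorem mem_diffSet {m : ℕ} {v w : BVec m} {t : Fin m} : t ∈ diffSet v w ↔ v t ≠ w t := by
  simp [diffSet]

/-- The `t`-th bit of a word, as a number. -/
def wordBit {m : ℕ} (w : BVec m) (t : ℕ) : ℕ := if h : t < m then (w ⟨t, h⟩).val else 0

theorem wordBit_lt_two {m : ℕ} (w : BVec m) (t : ℕ) : wordBit w t < 2 := by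
  unfold wordBit
  split_ifs
  · exact ZMod.val_lt _
  · norm_num

/-- The number with binary digits `w 0, …, w (k - 1)`. -/
def codeUpTo {m : ℕ} (w : BVec m) (k : ℕ) : ℕ := ∑ t ∈ Finset.range k, wordBit w t * 2 ^ t

/-- The number whose binary digits form the word `w`. -/
def wordCode {m : ℕ} (w : BVec m) : ℕ := codeUpTo w m

theorem codeUpTo_succ {m : ℕ} (w : BVec m) (k : ℕ) :
    codeUpTo w (k + 1) = codeUpTo w k + wordBit w k * 2 ^ k := Finset.sum_range_succ _ _

theorem codeUpTo_lt {m : ℕ} (w : BVec m) (k : ℕ) : codeUpTo w k < 2 ^ k := by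
  induction k with
  | zero => simp [codeUpTo]
  | succ k ih =>
    rw [codeUpTo_succ, pow_succ]
    have h := wordBit_lt_two w k
    have : wordBit w k * 2 ^ k ≤ 1 * 2 ^ k := Nat.mul_le_mul_right _ (by omega)
    omega

/-- The top digit is read off by comparison with `2 ^ k`, the others by induction. Hence the table
cells of distinct words are distinct. -/
theorem wordBit_eq_of_codeUpTo_eq {m : ℕ} {v w : BVec m} {k : ℕ}
    (h : codeUpTo v k = codeUpTo w k) : ∀ t < k, wordBit v t = wordBit w t := by
  induction k with
  | zero => intro t ht; omega
  | succ k ih =>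
    rw [codeUpTo_succ, codeUpTo_succ] at h
    have hv := codeUpTo_lt v k
    have hw := codeUpTo_lt w k
    have bv := wordBit_lt_two v k
    have bw := wordBit_lt_two w k
    have hbit : wordBit v k = wordBit w k := by
      interval_cases wordBit v k <;> interval_cases wordBit w k <;> omega
    intro t ht
    rcases Nat.lt_succ_iff_lt_or_eq.1 ht with h1 | rfl
    · exact ih (by rw [hbit] at h; omega) t h1
    · exact hbit

theorem wordCode_injective {m : ℕ} : Function.Injective (wordCode (m := m)) := by
  intro v w h
  ext t
  have := wordBit_eq_of_codeUpTo_eq h t t.2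
  simp only [wordBit, t.2, dif_pos, Fin.eta] at this
  exact ZMod.val_injective 2 this

/-- Flip the bit at position `k`. -/
def flipBit {m : ℕ} (w : BVec m) (k : ℕ) : BVec m :=
  fun t => if (t : ℕ) = k then w t + 1 else w t

theorem flipBit_flipBit {m : ℕ} (w : BVec m) (k : ℕ) : flipBit (flipBit w k) k = w := by
  ext t
  by_cases h : (t : ℕ) = k
  · simp only [flipBit, h, if_true]
    rw [add_assoc, CharTwo.add_self_eq_zero, add_zero]
  · simp [flipBit, h]

theorem wordBit_flipBit_of_ne {m : ℕ} (w : BVec m) {k t : ℕ} (h : t ≠ k) :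
    wordBit (flipBit w k) t = wordBit w t := by
  simp [wordBit, flipBit, h]

theorem wordBit_flipBit_self {m : ℕ} (w : BVec m) {k : ℕ} (h : k < m) :
    wordBit (flipBit w k) k = 1 - wordBit w k := by
  have key : ∀ a : ZMod 2, (a + 1).val = 1 - a.val := by decide
  simp [wordBit, flipBit, h, key]

/-- The old digit is added on the left rather than subtracted on the right, to avoid truncated
subtraction. -/
theorem codeUpTo_flipBit {m : ℕ} (w : BVec m) {k : ℕ} (h : k < m) (u : ℕ) :
    codeUpTo (flipBit w k) u + (if k < u then wordBit w k * 2 ^ k else 0) =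
      codeUpTo w u + (if k < u then (1 - wordBit w k) * 2 ^ k else 0) := by
  induction u with
  | zero => simp [codeUpTo]
  | succ u ih =>
    rw [codeUpTo_succ, codeUpTo_succ]
    rcases lt_trichotomy k u with h1 | rfl | h1
    · rw [wordBit_flipBit_of_ne w (by omega), if_pos (by omega), if_pos (by omega)]
      rw [if_pos h1, if_pos h1] at ih
      omega
    · rw [wordBit_flipBit_self w h, if_pos (by omega), if_pos (by omega)]
      simp only [lt_irrefl, if_false] at ih
      omega
    · rw [wordBit_flipBit_of_ne w (by omega), if_neg (by omega), if_neg (by omega)]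
      rw [if_neg (by omega), if_neg (by omega)] at ih
      omega

/-- Thus the machine flips a bit with one addition or subtraction of a stored power of two. -/
theorem wordCode_flipBit {m : ℕ} (w : BVec m) {k : ℕ} (h : k < m) :
    wordCode (flipBit w k) =
      if 0 < wordBit w k then wordCode w - 2 ^ k else wordCode w + 2 ^ k := by
  have := codeUpTo_flipBit w h m
  rw [if_pos h, if_pos h] at this
  have hb := wordBit_lt_two w k
  unfold wordCode
  split_ifs with h1
  · have : wordBit w k = 1 := by omega
    simp_all
    omega
  · have : wordBit w k = 0 := by omega
    simp_all

/-- The number of positions below `k` at which two words differ. -/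
def distUpTo {m : ℕ} (v w : BVec m) (k : ℕ) : ℕ :=
  ∑ t ∈ Finset.range k, if wordBit v t = wordBit w t then 0 else 1

theorem distUpTo_succ {m : ℕ} (v w : BVec m) (k : ℕ) :
    distUpTo v w (k + 1) = distUpTo v w k + if wordBit v k = wordBit w k then 0 else 1 :=
  Finset.sum_range_succ _ _

theorem distUpTo_le {m : ℕ} (v w : BVec m) (k : ℕ) : distUpTo v w k ≤ k := by
  induction k with
  | zero => simp [distUpTo]
  | succ k ih => rw [distUpTo_succ]; split_ifs <;> omega

theorem distUpTo_eq_hammingDist {m : ℕ} (v w : BVec m) : distUpTo v w m = hammingDist v w := by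
  rw [distUpTo, Finset.sum_range, hammingDist, Finset.card_filter]
  refine Finset.sum_congr rfl fun t _ => ?_
  simp only [wordBit, t.2, dif_pos, Fin.eta, (ZMod.val_injective 2).eq_iff]
  by_cases h : v t = w t <;> simp [h]

/-! ## The search in Hamming balls -/

/-- A word together with the vector from which it is reached and a position before which all the
flipped bits are. -/
structure Item (n m : ℕ) where
  word : BVec m
  pos : ℕ
  src : Fin n

/-- Flip one more bit. -/
def Item.child {n m : ℕ} (e : Item n m) (k : ℕ) : Item n m := ⟨flipBit e.word k, k + 1, e.src⟩

/-- All ways to flip one more bit to the right of the flipped ones. -/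
def Item.children {n m : ℕ} (e : Item n m) : List (Item n m) :=
  (List.range' e.pos (m - e.pos)).map e.child

/-- The words at distance `l` from one of the vectors, level by level. -/
def searchLevel {n m : ℕ} (x : Fin n → BVec m) : ℕ → List (Item n m)
  | 0 => (List.finRange n).map fun i => ⟨x i, 0, i⟩
  | l + 1 => (searchLevel x l).flatMap Item.children

/-- The concatenation of the levels up to `ρ`. -/
def searchUpTo {n m : ℕ} (x : Fin n → BVec m) : ℕ → List (Item n m)
  | 0 => searchLevel x 0
  | ρ + 1 => searchUpTo x ρ ++ searchLevel x (ρ + 1)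

/-- The item is reached by flipping at most `l` bits before its position. -/
structure Item.Valid {n m : ℕ} (x : Fin n → BVec m) (l : ℕ) (e : Item n m) : Prop where
  dist_le : hammingDist e.word (x e.src) ≤ l
  pos_le : e.pos ≤ m
  agree : ∀ t, e.pos ≤ t → wordBit e.word t = wordBit (x e.src) t

theorem hammingDist_flipBit_le {m : ℕ} (w : BVec m) (k : ℕ) : hammingDist (flipBit w k) w ≤ 1 := by
  rw [← card_diffSet, Finset.card_le_one]
  intro a ha b hb
  rw [mem_diffSet, flipBit] at ha hb
  have h1 : (a : ℕ) = k := by by_contra h; simp [h] at ha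
  have h2 : (b : ℕ) = k := by by_contra h; simp [h] at hb
  exact Fin.ext (h1.trans h2.symm)

/-- The clause `agree` serves the machine: bits from `pos` on are not yet flipped, so they can be
read from the input vector and a word need only be stored as its code. -/
theorem Item.Valid.child {n m : ℕ} {x : Fin n → BVec m} {l : ℕ} {e : Item n m}
    (h : e.Valid x l) {k : ℕ} (hk : e.pos ≤ k) (hkm : k < m) : (e.child k).Valid x (l + 1) := by
  refine ⟨?_, hkm, fun t ht => ?_⟩
  · have h1 := hammingDist_triangle (flipBit e.word k) e.word (x e.src)
    have h2 := hammingDist_flipBit_le e.word k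
    have h3 := h.dist_le
    simp only [Item.child]
    omega
  · simp only [Item.child] at ht ⊢
    rw [wordBit_flipBit_of_ne _ (by omega)]
    exact h.agree t (by omega)

theorem valid_of_mem_searchLevel {n m : ℕ} {x : Fin n → BVec m} {l : ℕ} {e : Item n m}
    (h : e ∈ searchLevel x l) : e.Valid x l := by
  induction l generalizing e with
  | zero =>
    simp only [searchLevel, List.mem_map] at h
    obtain ⟨i, -, rfl⟩ := h
    exact ⟨by simp, by simp, fun t _ => rfl⟩
  | succ l ih =>
    simp only [searchLevel, List.mem_flatMap, Item.children, List.mem_map, List.mem_range'_1] at h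
    obtain ⟨e', he', k, hk, rfl⟩ := h
    have := (ih he').pos_le
    exact (ih he').child hk.1 (by omega)

theorem mem_searchUpTo {n m : ℕ} {x : Fin n → BVec m} {ρ : ℕ} {e : Item n m} :
    e ∈ searchUpTo x ρ ↔ ∃ l ≤ ρ, e ∈ searchLevel x l := by
  induction ρ with
  | zero => simp [searchUpTo]
  | succ ρ ih =>
    simp only [searchUpTo, List.mem_append, ih]
    constructor
    · rintro (⟨l, hl, h⟩ | h)
      · exact ⟨l, by omega, h⟩
      · exact ⟨ρ + 1, le_rfl, h⟩
    · rintro ⟨l, hl, h⟩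
      rcases hl.eq_or_lt with rfl | hl
      · exact Or.inr h
      · exact Or.inl ⟨l, by omega, h⟩

/-- Undo the flip at the largest differing position `q`. The remaining flips lie before `q`, so the
item found by induction has position at most `q` and may flip `q` next. The bound `p` carries this
through the induction. -/
theorem exists_mem_searchLevel {n m : ℕ} (x : Fin n → BVec m) (i : Fin n) (l : ℕ) (w : BVec m)
    (p : ℕ) (hl : hammingDist w (x i) = l) (hp : ∀ t : Fin m, p ≤ t → w t = x i t) :
    ∃ e ∈ searchLevel x l, e.word = w ∧ e.src = i ∧ e.pos ≤ p := by
  induction l generalizing w p with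
  | zero =>
    rw [hammingDist_eq_zero] at hl
    exact ⟨⟨x i, 0, i⟩, by simp [searchLevel], hl.symm, rfl, Nat.zero_le _⟩
  | succ l ih =>
    have hne : (diffSet w (x i)).Nonempty := by
      rw [← Finset.card_pos, card_diffSet]; omega
    set q := (diffSet w (x i)).max' hne with hq
    have hqm : q ∈ diffSet w (x i) := Finset.max'_mem _ _
    have hqd : w q ≠ x i q := mem_diffSet.1 hqm
    have herase : diffSet (flipBit w q) (x i) = (diffSet w (x i)).erase q := by
      ext t
      by_cases h : t = q
      · subst h
        have := ZMod.two_eq_add_one hqd.symm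
        simp [mem_diffSet, flipBit, this]
      · have h' : (t : ℕ) ≠ q := fun h0 => h (Fin.ext h0)
        simp [mem_diffSet, flipBit, h, h']
    have hmax : ∀ t ∈ diffSet w (x i), t ≤ q := fun t ht => Finset.le_max' _ _ ht
    obtain ⟨e, he, hew, hes, hep⟩ := ih (flipBit w q) q
      (by rw [← card_diffSet, herase, Finset.card_erase_of_mem hqm, card_diffSet, hl]; rfl)
      (by
        intro t ht
        by_contra hd
        have hmem : t ∈ diffSet (flipBit w q) (x i) := mem_diffSet.2 hd
        rw [herase, Finset.mem_erase] at hmem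
        exact hmem.1 (le_antisymm (hmax t hmem.2) ht))
    refine ⟨e.child q, ?_, ?_, hes, ?_⟩
    · simp only [searchLevel, List.mem_flatMap, Item.children, List.mem_map, List.mem_range'_1]
      exact ⟨e, he, q, ⟨hep, by omega⟩, rfl⟩
    · simp only [Item.child, hew, flipBit_flipBit]
    · simp only [Item.child]
      by_contra hlt
      exact hqd (hp q (by omega))

/-- The hockey-stick identity: `k` is the first of `j + 1` further flips, and the other `j` lie to
its right. -/
theorem sum_choose_range' {m j : ℕ} (q p : ℕ) (h : p + q = m) :
    ((List.range' p q).map fun k => (m - (k + 1)).choose j).sum = q.choose (j + 1) := by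
  induction q generalizing p with
  | zero => simp
  | succ q ih =>
    rw [List.range'_succ, List.map_cons, List.sum_cons, ih (p + 1) (by omega),
      show m - (p + 1) = q by omega, Nat.choose_succ_succ]

/-- The weight of an item counts its continuations by `j` more flips, so the sum is the same for all
`l` with `l + j` fixed. The case `j = 0` is the length of a level. -/
theorem sum_choose_searchLevel {n m : ℕ} (x : Fin n → BVec m) (l j : ℕ) :
    ((searchLevel x l).map fun e => (m - e.pos).choose j).sum = n * m.choose (l + j) := by
  induction l generalizing j with
  | zero => simp [searchLevel, Function.comp_def]
  | succ l ih =>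
    have hl : l + 1 + j = l + (j + 1) := by omega
    rw [searchLevel, List.map_flatMap, List.flatMap_def, List.sum_flatten, List.map_map, hl, ← ih]
    congr 1
    refine List.map_congr_left fun e he => ?_
    have := (valid_of_mem_searchLevel he).pos_le
    simp only [Function.comp_apply, Item.children, List.map_map]
    exact sum_choose_range' (m - e.pos) e.pos (by omega)

theorem length_searchLevel {n m : ℕ} (x : Fin n → BVec m) (l : ℕ) :
    (searchLevel x l).length = n * m.choose l := by
  have := sum_choose_searchLevel x l 0
  simpa using this

theorem length_searchUpTo {n m : ℕ} (x : Fin n → BVec m) (ρ : ℕ) :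
    (searchUpTo x ρ).length = n * ballCard m ρ := by
  induction ρ with
  | zero => simp [searchUpTo, length_searchLevel, ballCard]
  | succ ρ ih =>
    rw [searchUpTo, List.length_append, ih, length_searchLevel, ballCard, ballCard,
      Finset.sum_range_succ _ (ρ + 1)]
    ring

theorem ballCard_mono {m ρ σ : ℕ} (h : ρ ≤ σ) : ballCard m ρ ≤ ballCard m σ :=
  Finset.sum_le_sum_of_subset (Finset.range_mono (by omega))

theorem ballCard_le_two_pow (m ρ : ℕ) : ballCard m ρ ≤ 2 ^ m := by
  rcases le_total ρ m with h | h
  · rw [← Nat.sum_range_choose m]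
    exact Finset.sum_le_sum_of_subset (Finset.range_mono (by omega))
  · have : ballCard m ρ = ballCard m m := by
      refine (Finset.sum_subset (Finset.range_mono (by omega)) fun l _ hl => ?_).symm
      exact Nat.choose_eq_zero_of_lt (by simpa using hl)
    rw [this, ballCard, Nat.sum_range_choose]

/-! ## Collisions -/

/-- The table entry of the word `w` after the items in `P` have been inserted: `0` if the word has
not been met, otherwise the label of the vector from which it was reached first. -/
def tableEntry {n m : ℕ} (P : List (Item n m)) (w : BVec m) : ℕ :=
  ((P.find? fun e => e.word = w).map fun e => (e.src : ℕ) * m + 1).getD 0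

/-- `b` is at most the distance of any two vectors from which the same word was reached, one of them
being the first to reach it. -/
def Covers {n m : ℕ} (x : Fin n → BVec m) (P : List (Item n m)) (b : ℕ) : Prop :=
  ∀ e ∈ P, ∀ e', (P.find? fun a => a.word = e.word) = some e' → e'.src ≠ e.src →
    b ≤ hammingDist (x e'.src) (x e.src)

/-- `b` is infinite (that is, `m + 1`), or the distance of the pair at the addresses `a`, `a'`. -/
def Attained {n m : ℕ} (x : Fin n → BVec m) (b a a' : ℕ) : Prop :=
  b = m + 1 ∨ ∃ i j : Fin n, i < j ∧ a = i * m ∧ a' = j * m ∧ b = hammingDist (x i) (x j)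

theorem Covers.mono {n m : ℕ} {x : Fin n → BVec m} {P : List (Item n m)} {b b' : ℕ}
    (h : Covers x P b) (hb : b' ≤ b) : Covers x P b' :=
  fun e he e' he' hne => hb.trans (h e he e' he' hne)

/-- Appending never changes which item reached an old word first, so only the new item has to be
checked. -/
theorem Covers.append_singleton {n m : ℕ} {x : Fin n → BVec m} {P : List (Item n m)} {b : ℕ}
    (h : Covers x P b) {e : Item n m}
    (he : ∀ e', (P.find? fun a => a.word = e.word) = some e' → e'.src ≠ e.src →
      b ≤ hammingDist (x e'.src) (x e.src)) : Covers x (P ++ [e]) b := by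
  intro f hf f' hf' hne
  rw [List.find?_append] at hf'
  rcases hP : (P.find? fun a => a.word = f.word) with _ | g
  · rw [hP, Option.none_or] at hf'
    have hfe : f = e := by
      rcases List.mem_append.1 hf with h1 | h1
      · have := List.find?_eq_none.1 hP f h1
        simp at this
      · simpa using h1
    subst hfe
    simp at hf'
    exact absurd (by rw [hf']) hne
  · rw [hP, Option.some_or] at hf'
    obtain rfl : g = f' := by simpa using hf'
    rcases List.mem_append.1 hf with h1 | h1
    · exact h f h1 g hP hne
    · obtain rfl : f = e := by simpa using h1
      exact he g hP hne

theorem tableEntry_append_of_find {n m : ℕ} {P : List (Item n m)} {e : Item n m} {e' : Item n m}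
    (h : (P.find? fun a => a.word = e.word) = some e') (w : BVec m) :
    tableEntry (P ++ [e]) w = tableEntry P w := by
  unfold tableEntry
  rw [List.find?_append]
  rcases hP : (P.find? fun a => a.word = w) with _ | g
  · have : e.word ≠ w := by
      rintro rfl
      rw [h] at hP
      simp at hP
    simp [this]
  · rw [hP, Option.some_or]

theorem tableEntry_append_of_find_none {n m : ℕ} {P : List (Item n m)} {e : Item n m}
    (h : (P.find? fun a => a.word = e.word) = none) (w : BVec m) :
    tableEntry (P ++ [e]) w = if w = e.word then (e.src : ℕ) * m + 1 else tableEntry P w := by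
  unfold tableEntry
  rw [List.find?_append]
  split_ifs with hw
  · subst hw
    simp [h]
  · rcases hP : (P.find? fun a => a.word = w) with _ | g
    · simp [Ne.symm hw]
    · rw [hP, Option.some_or]

theorem find?_searchUpTo_mono {n m : ℕ} {x : Fin n → BVec m} {ρ σ : ℕ} (h : ρ ≤ σ)
    {f : Item n m → Bool} {e : Item n m} (he : (searchUpTo x ρ).find? f = some e) :
    (searchUpTo x σ).find? f = some e := by
  induction σ, h using Nat.le_induction with
  | base => exact he
  | succ σ _ ih => rw [searchUpTo, List.find?_append, ih, Option.some_or]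

/-- Once the balls around the closest pair meet, the pair has been examined: the word half-way
between the two was reached first from one of them. -/
theorem Covers.le_hammingDist {n m : ℕ} {x : Fin n → BVec m} {i j : Fin n}
    (hx : IsUniqueClosestPair x i j) {ρ b : ℕ} (h : Covers x (searchUpTo x ρ) b)
    (hρ : hammingDist (x i) (x j) ≤ 2 * ρ) : b ≤ hammingDist (x i) (x j) := by
  set d := hammingDist (x i) (x j) with hd
  obtain ⟨S, hS, hSc⟩ := Finset.exists_subset_card_eq
    (show d / 2 ≤ (diffSet (x i) (x j)).card by rw [card_diffSet]; omega)
  set w := x i + indWord S with hw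
  have hwi : hammingDist w (x i) = d / 2 := by rw [hw, hammingDist_add_indWord, hSc]
  have hwj : hammingDist w (x j) = d - d / 2 := by
    rw [hw, add_indWord_eq_add_indWord hS, hammingDist_add_indWord,
      Finset.card_sdiff_of_subset hS, card_diffSet, hSc]
  obtain ⟨ei, hei, heiw, heis, -⟩ := exists_mem_searchLevel x i _ w m hwi
    (fun t ht => absurd t.2 (by omega))
  obtain ⟨ej, hej, hejw, hejs, -⟩ := exists_mem_searchLevel x j _ w m hwj
    (fun t ht => absurd t.2 (by omega))
  have hi' : ei ∈ searchUpTo x (d / 2) := mem_searchUpTo.2 ⟨_, le_rfl, hei⟩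
  have hi : ei ∈ searchUpTo x ρ := mem_searchUpTo.2 ⟨_, by omega, hei⟩
  have hj : ej ∈ searchUpTo x ρ := mem_searchUpTo.2 ⟨_, by omega, hej⟩
  -- Rounding down matters: `w` appears by level `d / 2`, so its first finder `f` has a source
  -- within `2 * (d / 2) ≤ d` of `x i`, hence `i` or `j`.
  obtain ⟨f, hf⟩ : ∃ f, ((searchUpTo x (d / 2)).find? fun a => a.word = w) = some f := by
    rw [← Option.isSome_iff_exists, List.find?_isSome]
    exact ⟨ei, hi', by simpa using heiw⟩
  have hfρ := find?_searchUpTo_mono (show d / 2 ≤ ρ by omega) hf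
  have hfw : f.word = w := by simpa using List.find?_some hf
  obtain ⟨l, hl, hfl⟩ := mem_searchUpTo.1 (List.mem_of_find?_eq_some hf)
  have hfd := (valid_of_mem_searchLevel hfl).dist_le
  rw [hfw] at hfd
  have hfi : hammingDist (x f.src) (x i) ≤ d := by
    have := hammingDist_triangle_left (x f.src) (x i) w
    omega
  -- If `i` was first, the item of `j` collides with `f`; if `j` was first, the item of `i` does.
  by_cases hfs : f.src = i
  · have := h ej hj f (by rw [hejw]; exact hfρ) (by rw [hfs, hejs]; exact hx.1.ne)
    rwa [hfs, hejs] at this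
  · have hfj : f.src = j := by
      rcases hx.eq_of_hammingDist_le hfs hfi with h1 | h1
      · exact absurd h1.1 hfs
      · exact h1.1
    have := h ei hi f (by rw [heiw]; exact hfρ) (by rw [heis]; exact hfs)
    rwa [hfj, heis, hammingDist_comm] at this

theorem Attained.eq_of_le {n m : ℕ} {x : Fin n → BVec m} {i j : Fin n}
    (hx : IsUniqueClosestPair x i j) {b a a' : ℕ} (h : Attained x b a a')
    (hb : b ≤ hammingDist (x i) (x j)) :
    a = i * m ∧ a' = j * m ∧ b = hammingDist (x i) (x j) := by
  rcases h with h | ⟨k, l, hkl, rfl, rfl, rfl⟩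
  · have : hammingDist (x i) (x j) ≤ m := by
      simpa using hammingDist_le_card_fintype (x := x i) (y := x j)
    omega
  · rcases hx.eq_of_hammingDist_le hkl.ne hb with ⟨rfl, rfl⟩ | ⟨rfl, rfl⟩
    · exact ⟨rfl, rfl, rfl⟩
    · exact absurd hkl (lt_asymm hx.1)

theorem Attained.hammingDist_le {n m : ℕ} {x : Fin n → BVec m} {i j : Fin n}
    (hx : IsUniqueClosestPair x i j) {b a a' : ℕ} (h : Attained x b a a') :
    hammingDist (x i) (x j) ≤ b := by
  rcases h with h | ⟨k, l, hkl, rfl, rfl, rfl⟩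
  · have : hammingDist (x i) (x j) ≤ m := by
      simpa using hammingDist_le_card_fintype (x := x i) (y := x j)
    omega
  · exact hx.hammingDist_le hkl.ne

/-! ## Reasoning about programs -/

/-- Write `c` into the heap cell `a`. -/
def RAMState.put (s : RAMState) (a c : ℕ) : RAMState :=
  { s with heap := Function.update s.heap a c }

theorem RAMState.vars_set (s : RAMState) (v c w : ℕ) :
    (s.set v c).vars w = if w = v then c else s.vars w := by
  simp [RAMState.set, Function.update_apply]

theorem RAMState.heap_set (s : RAMState) (v c : ℕ) : (s.set v c).heap = s.heap := rfl

theorem RAMState.vars_put (s : RAMState) (a c : ℕ) : (s.put a c).vars = s.vars := rfl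

theorem RAMState.heap_put (s : RAMState) (a c p : ℕ) :
    (s.put a c).heap p = if p = a then c else s.heap p := by
  simp [RAMState.put, Function.update_apply]

/-- All numbers in the memory have at most `L` bits. -/
def RAMState.Bounded (L : ℕ) (s : RAMState) : Prop :=
  (∀ v, s.vars v < 2 ^ L) ∧ ∀ a, s.heap a < 2 ^ L

theorem RAMState.Bounded.set {L : ℕ} {s : RAMState} (h : s.Bounded L) (v : ℕ) {c : ℕ}
    (hc : c < 2 ^ L) : (s.set v c).Bounded L := by
  refine ⟨fun w => ?_, h.2⟩
  rw [RAMState.vars_set]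
  split_ifs
  · exact hc
  · exact h.1 w

theorem RAMState.Bounded.put {L : ℕ} {s : RAMState} (h : s.Bounded L) (a : ℕ) {c : ℕ}
    (hc : c < 2 ^ L) : (s.put a c).Bounded L := by
  refine ⟨h.1, fun p => ?_⟩
  rw [RAMState.heap_put]
  split_ifs
  · exact hc
  · exact h.2 p

/-- Every instruction other than a query handles at most two numbers, hence the unit `2 * L + 2` per
instruction in `Run`. -/
theorem bitCost_le {L a : ℕ} (h : a < 2 ^ L) : bitCost a ≤ L + 1 := by
  have := Nat.size_le.2 h
  unfold bitCost
  omega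

/-- Started in the state `s` with numbers of at most `L` bits, the program `p` halts after at most
`N` instructions in a state that satisfies `Q`, and never handles a number of more than `L` bits. -/
def Run {m : ℕ} (D : ℕ → BVec m → BVec m) (L : ℕ) (p : Cmd) (s : RAMState) (N : ℕ)
    (Q : RAMState → Prop) : Prop :=
  s.Bounded L → ∃ s' t, Exec D p s s' t ∧ t ≤ N * (2 * L + 2) ∧ s'.Bounded L ∧ Q s'

namespace Run

variable {m : ℕ} {D : ℕ → BVec m → BVec m} {L : ℕ} {s : RAMState} {Q : RAMState → Prop}

theorem mono {p : Cmd} {N N' : ℕ} {Q' : RAMState → Prop} (h : Run D L p s N Q') (hN : N ≤ N')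
    (hQ : ∀ s', Q' s' → Q s') : Run D L p s N' Q := by
  intro hs
  obtain ⟨s', t, h1, h2, h3, h4⟩ := h hs
  exact ⟨s', t, h1, h2.trans (Nat.mul_le_mul_right _ hN), h3, hQ _ h4⟩

theorem le {p : Cmd} {N N' : ℕ} (h : Run D L p s N Q) (hN : N ≤ N') : Run D L p s N' Q :=
  h.mono hN fun _ h => h

theorem skip (h : Q s) : Run D L .skip s 1 Q :=
  fun hs => ⟨s, 1, .skip s, by omega, hs, h⟩

theorem const {v c : ℕ} (hc : c < 2 ^ L) (h : Q (s.set v c)) : Run D L (.const v c) s 1 Q := by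
  intro hs
  have := bitCost_le hc
  exact ⟨_, _, .const s v c, by omega, hs.set v hc, h⟩

theorem add {v a b : ℕ} (hc : s.vars a + s.vars b < 2 ^ L)
    (h : Q (s.set v (s.vars a + s.vars b))) : Run D L (.add v a b) s 1 Q := by
  intro hs
  have h1 := bitCost_le (hs.1 a)
  have h2 := bitCost_le (hs.1 b)
  exact ⟨_, _, .add s v a b, by omega, hs.set v hc, h⟩

theorem sub {v a b : ℕ} (h : Q (s.set v (s.vars a - s.vars b))) :
    Run D L (.sub v a b) s 1 Q := by
  intro hs
  have h1 := bitCost_le (hs.1 a)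
  have h2 := bitCost_le (hs.1 b)
  exact ⟨_, _, .sub s v a b, by omega, hs.set v (lt_of_le_of_lt (Nat.sub_le _ _) (hs.1 a)), h⟩

theorem load {v a : ℕ} (h : Q (s.set v (s.heap (s.vars a)))) : Run D L (.load v a) s 1 Q := by
  intro hs
  have h1 := bitCost_le (hs.1 a)
  have h2 := bitCost_le (hs.2 (s.vars a))
  exact ⟨_, _, .load s v a, by omega, hs.set v (hs.2 _), h⟩

theorem store {a b : ℕ} (h : Q (s.put (s.vars a) (s.vars b))) : Run D L (.store a b) s 1 Q := by
  intro hs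
  have h1 := bitCost_le (hs.1 a)
  have h2 := bitCost_le (hs.1 b)
  exact ⟨_, _, .store s a b, by omega, hs.put _ (hs.1 b), h⟩

theorem seq {p q : Cmd} {N N' : ℕ} (h : Run D L p s N fun s' => Run D L q s' N' Q) :
    Run D L (.seq p q) s (N + N') Q := by
  intro hs
  obtain ⟨s', t, h1, h2, h3, h4⟩ := h hs
  obtain ⟨s'', t', h5, h6, h7, h8⟩ := h4 h3
  exact ⟨s'', t + t', .seq h1 h5, by rw [add_mul]; omega, h7, h8⟩

theorem ite {a b : ℕ} {p q : Cmd} {N N' : ℕ} (h : s.vars a < s.vars b → Run D L p s N Q)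
    (h' : ¬ s.vars a < s.vars b → Run D L q s N' Q) :
    Run D L (.ite a b p q) s (max N N' + 1) Q := by
  intro hs
  have h1 := bitCost_le (hs.1 a)
  have h2 := bitCost_le (hs.1 b)
  by_cases hab : s.vars a < s.vars b
  · obtain ⟨s', t, h3, h4, h5, h6⟩ := (h hab).le (le_max_left N N') hs
    exact ⟨s', _, .iteTrue hab h3, by rw [add_mul]; omega, h5, h6⟩
  · obtain ⟨s', t, h3, h4, h5, h6⟩ := (h' hab).le (le_max_right N N') hs
    exact ⟨s', _, .iteFalse hab h3, by rw [add_mul]; omega, h5, h6⟩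

/-- The rule for loops. The first argument of the invariant `I` bounds the number of remaining
iterations. -/
theorem loop {a b : ℕ} {p : Cmd} {N : ℕ} (I : ℕ → RAMState → Prop)
    (hI : ∀ j s, I j s → s.vars a < s.vars b → ∃ j', j = j' + 1 ∧ Run D L p s N (I j')) {k : ℕ}
    (h : I k s) :
    Run D L (.loop a b p) s (k * (N + 1) + 1)
      fun s' => ¬ s'.vars a < s'.vars b ∧ ∃ j, I j s' := by
  induction k generalizing s with
  | zero =>
    intro hs
    have h1 := bitCost_le (hs.1 a)
    have h2 := bitCost_le (hs.1 b)
    have hab : ¬ s.vars a < s.vars b := by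
      intro hab
      obtain ⟨j, hj, -⟩ := hI 0 s h hab
      omega
    exact ⟨s, _, .loopFalse hab, by omega, hs, hab, 0, h⟩
  | succ k ih =>
    intro hs
    have h1 := bitCost_le (hs.1 a)
    have h2 := bitCost_le (hs.1 b)
    by_cases hab : s.vars a < s.vars b
    · obtain ⟨j, hj, hrun⟩ := hI (k + 1) s h hab
      obtain rfl : j = k := by omega
      obtain ⟨s', t, h3, h4, h5, h6⟩ := hrun hs
      obtain ⟨s'', t', h7, h8, h9, h10⟩ := ih h6 h5
      refine ⟨s'', _, .loopTrue hab h3 h7, ?_, h9, h10⟩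
      have e : ((j + 1) * (N + 1) + 1) * (2 * L + 2) =
          (2 * L + 2) + N * (2 * L + 2) + (j * (N + 1) + 1) * (2 * L + 2) := by ring
      omega
    · refine ⟨s, _, .loopFalse hab, ?_, hs, hab, k + 1, h⟩
      rw [add_mul]
      omega

end Run

/-- The two states agree on all variables outside `S`. -/
def SameVars (S : List ℕ) (s s' : RAMState) : Prop := ∀ v, v ∉ S → s'.vars v = s.vars v

theorem SameVars.refl (S : List ℕ) (s : RAMState) : SameVars S s s := fun _ _ => rfl

theorem SameVars.trans {S T U : List ℕ} {s s' s'' : RAMState} (h : SameVars S s s')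
    (h' : SameVars T s' s'') (hS : S ⊆ U) (hT : T ⊆ U) : SameVars U s s'' :=
  fun v hv => (h' v fun h0 => hv (hT h0)).trans (h v fun h0 => hv (hS h0))

theorem SameVars.set {S : List ℕ} {s u : RAMState} (h : SameVars S s u) {v : ℕ} (c : ℕ)
    (hv : v ∈ S) : SameVars S s (u.set v c) := by
  intro w hw
  rw [RAMState.vars_set, if_neg (fun h0 : w = v => hw (h0 ▸ hv)), h w hw]

theorem SameVars.put {S : List ℕ} {s u : RAMState} (h : SameVars S s u) (a c : ℕ) :
    SameVars S s (u.put a c) := h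

theorem SameVars.mono {S T : List ℕ} {s u : RAMState} (h : SameVars S s u) (hST : S ⊆ T) :
    SameVars T s u := fun v hv => h v fun h0 => hv (hST h0)

/-! ## Examining a pair -/

/-- Compute the distance of the vectors at the addresses in the variables `a` and `b`, and update
the best pair found so far. -/
def examineCmd (a b : ℕ) : Cmd :=
  .seq (.const 22 0) <| .seq (.const 23 0) <| .seq
    (.loop 23 1 <|
      .seq (.add 26 a 23) <| .seq (.load 24 26) <| .seq (.add 26 b 23) <| .seq (.load 25 26) <|
      .seq (.ite 24 25 (.add 22 22 3) (.ite 25 24 (.add 22 22 3) .skip)) <|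
      .add 23 23 3) <|
    .ite 22 2 (.seq (.add 2 22 4) <| .seq (.add 10 a 4) <| .add 11 b 4) .skip

/-- The heap contains the vectors. -/
def HasInput {n m : ℕ} (x : Fin n → BVec m) (s : RAMState) : Prop :=
  ∀ i : Fin n, ∀ k < m, s.heap (i * m + k) = wordBit (x i) k

/-- Loop invariant: variable `22` counts the disagreements before the position in `23`. The
assumption `i < j` fixes the order in which the two addresses are recorded. -/
theorem run_examineCmd {n m : ℕ} {D : ℕ → BVec m → BVec m} {L : ℕ} {x : Fin n → BVec m}
    {s : RAMState} {a b : ℕ} {i j : Fin n} (hL : n * m + m + 2 < 2 ^ L) (hin : HasInput x s)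
    (h1 : s.vars 1 = m) (h3 : s.vars 3 = 1) (h4 : s.vars 4 = 0)
    (ha : a ∉ [2, 10, 11, 22, 23, 24, 25, 26]) (hb : b ∉ [2, 10, 11, 22, 23, 24, 25, 26])
    (hva : s.vars a = i * m) (hvb : s.vars b = j * m) (hij : i < j)
    (hatt : Attained x (s.vars 2) (s.vars 10) (s.vars 11)) :
    Run D L (examineCmd a b) s (10 * m + 8) fun s' =>
      s'.heap = s.heap ∧ SameVars [2, 10, 11, 22, 23, 24, 25, 26] s s' ∧
      Attained x (s'.vars 2) (s'.vars 10) (s'.vars 11) ∧ s'.vars 2 ≤ s.vars 2 ∧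
      s'.vars 2 ≤ hammingDist (x i) (x j) := by
  simp only [List.mem_cons, List.not_mem_nil, or_false, not_or] at ha hb
  have hle : ∀ i : Fin n, (i : ℕ) * m + m ≤ n * m := by
    intro i
    have := Nat.mul_le_mul_right m (show (i : ℕ) + 1 ≤ n from i.2)
    rwa [add_mul, one_mul] at this
  have hi := hle i
  have hj := hle j
  refine Run.le (N := 1 + (1 + ((m * (8 + 1) + 1) + (max (1 + (1 + 1)) 1 + 1)))) ?_ (by omega)
  refine .seq (.const (by omega) (.seq (.const (by omega) (.seq ?_))))
  set s0 := (s.set 22 0).set 23 0 with hs0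
  have hloop := Run.loop (D := D) (L := L) (a := 23) (b := 1) (N := 8)
    (p := .seq (.add 26 a 23) <| .seq (.load 24 26) <| .seq (.add 26 b 23) <|
      .seq (.load 25 26) <|
      .seq (.ite 24 25 (.add 22 22 3) (.ite 25 24 (.add 22 22 3) .skip)) <| .add 23 23 3)
    (fun t u => u.heap = s.heap ∧ SameVars [22, 23, 24, 25, 26] s u ∧ u.vars 23 ≤ m ∧
      t = m - u.vars 23 ∧ u.vars 22 = distUpTo (x i) (x j) (u.vars 23)) ?_ (s := s0) (k := m) ?_
  · refine hloop.mono le_rfl ?_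
    rintro u ⟨hexit, t, hheap, hsame, hkm, -, hd⟩
    have e1 : u.vars 1 = m := by rw [hsame 1 (by simp), h1]
    have e4 : u.vars 4 = 0 := by rw [hsame 4 (by simp), h4]
    have ea : u.vars a = i * m := by rw [hsame a (by simp [ha]), hva]
    have eb : u.vars b = j * m := by rw [hsame b (by simp [hb]), hvb]
    have e2 : u.vars 2 = s.vars 2 := hsame 2 (by simp)
    have e10 : u.vars 10 = s.vars 10 := hsame 10 (by simp)
    have e11 : u.vars 11 = s.vars 11 := hsame 11 (by simp)
    have ek : u.vars 23 = m := by omega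
    rw [ek, distUpTo_eq_hammingDist] at hd
    have hdm : hammingDist (x i) (x j) ≤ m := by
      simpa using hammingDist_le_card_fintype (x := x i) (y := x j)
    refine .ite (fun hlt => ?_) (fun hlt => ?_)
    · refine .seq (.add ?_ (.seq (.add ?_ (.add ?_ ?_))))
      · omega
      · simp [RAMState.vars_set, ha, ea, e4]; omega
      · simp [RAMState.vars_set, hb, eb, e4]; omega
      · simp only [RAMState.vars_set, RAMState.heap_set, ha, hb, ea, eb, e4, hd, hheap]
        simp only [SameVars, RAMState.vars_set]
        refine ⟨trivial, ?_, ?_, ?_, ?_⟩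
        · intro v hv
          have := hsame v (by simp at hv ⊢; tauto)
          simp at hv
          simp [hv, this]
        · exact Or.inr ⟨i, j, hij, by simp, by simp, by simp⟩
        · simp; omega
        · simp
    · refine .skip ⟨hheap, fun v hv => hsame v (by simp at hv ⊢; tauto), ?_, e2.le, by omega⟩
      rwa [e2, e10, e11]
  · rintro t u ⟨hheap, hsame, hkm, ht, hd⟩ hlt
    have e1 : u.vars 1 = m := by rw [hsame 1 (by simp), h1]
    have e3 : u.vars 3 = 1 := by rw [hsame 3 (by simp), h3]
    have ea : u.vars a = i * m := by rw [hsame a (by simp [ha]), hva]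
    have eb : u.vars b = j * m := by rw [hsame b (by simp [hb]), hvb]
    have hk : u.vars 23 < m := by omega
    have li : s.heap (i * m + u.vars 23) = wordBit (x i) (u.vars 23) := hin i _ hk
    have lj : s.heap (j * m + u.vars 23) = wordBit (x j) (u.vars 23) := hin j _ hk
    have hdl := distUpTo_le (x i) (x j) (u.vars 23)
    refine ⟨m - (u.vars 23 + 1), by omega, ?_⟩
    refine Run.le (N := 1 + (1 + (1 + (1 + ((max 1 (max 1 1 + 1) + 1) + 1))))) ?_ (by omega)
    refine .seq (.add (by omega) (.seq (.load (.seq (.add ?_ (.seq (.load (.seq ?_))))))))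
    · simp [RAMState.vars_set, hb, eb]; omega
    simp only [RAMState.vars_set, RAMState.heap_set, hb, ea, eb, hheap, if_true, if_false,
      Nat.reduceEqDiff, li, lj]
    refine .ite (fun h => ?_) (fun h => .ite (fun h' => ?_) (fun h' => ?_))
    · refine .add ?_ (.add ?_ ?_)
      · simp [RAMState.vars_set, e3]; omega
      · simp [RAMState.vars_set, e3]; omega
      · simp only [RAMState.vars_set, RAMState.heap_set, SameVars]
        simp only [RAMState.vars_set] at h
        refine ⟨hheap, ?_, ?_, ?_, ?_⟩
        · intro v hv
          have := hsame v hv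
          simp at hv
          simp [hv, this]
        · simp [e3]; omega
        · simp [e3]
        · simp at h
          simp [e3, distUpTo_succ, hd, h.ne]
    · refine .add ?_ (.add ?_ ?_)
      · simp [RAMState.vars_set, e3]; omega
      · simp [RAMState.vars_set, e3]; omega
      · simp only [RAMState.vars_set, RAMState.heap_set, SameVars]
        simp only [RAMState.vars_set] at h'
        refine ⟨hheap, ?_, ?_, ?_, ?_⟩
        · intro v hv
          have := hsame v hv
          simp at hv
          simp [hv, this]
        · simp [e3]; omega
        · simp [e3]
        · simp at h'
          simp [e3, distUpTo_succ, hd, h'.ne']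
    · refine .skip (.add ?_ ?_)
      · simp [RAMState.vars_set, e3]; omega
      · simp only [RAMState.vars_set, RAMState.heap_set, SameVars]
        simp only [RAMState.vars_set] at h h'
        refine ⟨hheap, ?_, ?_, ?_, ?_⟩
        · intro v hv
          have := hsame v hv
          simp at hv
          simp [hv, this]
        · simp [e3]; omega
        · simp [e3]
        · simp at h h'
          have := le_antisymm h' h
          simp [e3, distUpTo_succ, hd, this]
  · refine ⟨rfl, ?_, ?_, ?_, ?_⟩
    · intro v hv
      simp at hv
      simp [hs0, RAMState.vars_set, hv]
    · simp [hs0, RAMState.vars_set]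
    · simp [hs0, RAMState.vars_set]
    · simp [hs0, RAMState.vars_set, distUpTo]

theorem Fin.mul_add_le_mul {n : ℕ} (m : ℕ) (i : Fin n) : (i : ℕ) * m + m ≤ n * m := by
  have := Nat.mul_le_mul_right m (show (i : ℕ) + 1 ≤ n from i.2)
  rwa [add_mul, one_mul] at this

/-! ## The state of the search

The variables hold: `0`, `1` the parameters `n`, `m`; `2`, `10`, `11` the distance and the addresses
of the best pair; `3`, `4`, `28` the constants `1`, `0`, `2`; `5`, `6` the products `n * m`, `n * n`;
`7` the address of the table; `8`, `9` the end and the length of the queue. The heap contains the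
input, the powers of two, the table, which is indexed by the codes of words, and the queue. -/

/-- The address of the queue. -/
def queueBase (n m : ℕ) : ℕ := n * m + m + 2 ^ m

/-- The state of the memory when the items in `P` have been inserted. -/
structure SearchState {n m : ℕ} (x : Fin n → BVec m) (P : List (Item n m)) (s : RAMState) :
    Prop where
  v0 : s.vars 0 = n
  v1 : s.vars 1 = m
  v3 : s.vars 3 = 1
  v4 : s.vars 4 = 0
  v5 : s.vars 5 = n * m
  v6 : s.vars 6 = n * n
  v7 : s.vars 7 = n * m + m
  v8 : s.vars 8 = queueBase n m + 3 * P.length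
  v9 : s.vars 9 = P.length
  v28 : s.vars 28 = 2
  input : HasInput x s
  pow : ∀ k < m, s.heap (n * m + k) = 2 ^ k
  table : ∀ w : BVec m, s.heap (n * m + m + wordCode w) = tableEntry P w
  queue : ∀ t e, P[t]? = some e → s.heap (queueBase n m + 3 * t) = wordCode e.word ∧
    s.heap (queueBase n m + 3 * t + 1) = e.pos ∧ s.heap (queueBase n m + 3 * t + 2) = e.src * m
  attained : Attained x (s.vars 2) (s.vars 10) (s.vars 11)
  covers : Covers x P (s.vars 2)

theorem SearchState.congr {n m : ℕ} {x : Fin n → BVec m} {P : List (Item n m)} {s s' : RAMState}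
    (h : SearchState x P s) {S : List ℕ} (hv : SameVars S s s') (hh : s'.heap = s.heap)
    (hS : ∀ v ∈ [0, 1, 2, 3, 4, 5, 6, 7, 8, 9, 10, 11, 28], v ∉ S) : SearchState x P s' := by
  have e : ∀ v ∈ [0, 1, 2, 3, 4, 5, 6, 7, 8, 9, 10, 11, 28], s'.vars v = s.vars v :=
    fun v hvm => hv v (hS v hvm)
  refine ⟨?_, ?_, ?_, ?_, ?_, ?_, ?_, ?_, ?_, ?_, ?_, ?_, ?_, ?_, ?_, ?_⟩
  · rw [e 0 (by simp), h.v0]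
  · rw [e 1 (by simp), h.v1]
  · rw [e 3 (by simp), h.v3]
  · rw [e 4 (by simp), h.v4]
  · rw [e 5 (by simp), h.v5]
  · rw [e 6 (by simp), h.v6]
  · rw [e 7 (by simp), h.v7]
  · rw [e 8 (by simp), h.v8]
  · rw [e 9 (by simp), h.v9]
  · rw [e 28 (by simp), h.v28]
  · intro i k hk; rw [hh]; exact h.input i k hk
  · rw [hh]; exact h.pow
  · rw [hh]; exact h.table
  · rw [hh]; exact h.queue
  · rw [e 2 (by simp), e 10 (by simp), e 11 (by simp)]; exact h.attained
  · rw [e 2 (by simp)]; exact h.covers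

/-! ## Inserting an item -/

/-- Append the item in the variables `20`, `15`, `16` to the queue. -/
def enqueueCmd : Cmd :=
  .seq (.store 8 20) <| .seq (.add 8 8 3) <| .seq (.store 8 15) <| .seq (.add 8 8 3) <|
  .seq (.store 8 16) <| .seq (.add 8 8 3) <| .add 9 9 3

/-- Insert the item in the variables `20`, `15`, `16` into the queue and into the table, and examine
the pair of vectors if the word has been reached from another vector. -/
def insertCmd : Cmd :=
  .seq enqueueCmd <| .seq (.add 17 7 20) <| .seq (.load 21 17) <|
  .ite 4 21
    (.seq (.sub 21 21 3) <| .ite 21 16 (examineCmd 21 16) (.ite 16 21 (examineCmd 16 21) .skip))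
    (.seq (.add 21 16 3) <| .store 17 21)

section

variable {n m : ℕ} {D : ℕ → BVec m → BVec m} {L : ℕ} {x : Fin n → BVec m} {s : RAMState}
  {P : List (Item n m)}

theorem run_enqueueCmd (h3 : s.vars 3 = 1) (h8 : s.vars 8 + 3 < 2 ^ L)
    (h9 : s.vars 9 + 1 < 2 ^ L) :
    Run D L enqueueCmd s 7 fun s' => SameVars [8, 9] s s' ∧ s'.vars 8 = s.vars 8 + 3 ∧
      s'.vars 9 = s.vars 9 + 1 ∧ (∀ p, p < s.vars 8 → s'.heap p = s.heap p) ∧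
      s'.heap (s.vars 8) = s.vars 20 ∧ s'.heap (s.vars 8 + 1) = s.vars 15 ∧
      s'.heap (s.vars 8 + 2) = s.vars 16 := by
  refine Run.le (N := 1 + (1 + (1 + (1 + (1 + (1 + 1)))))) ?_ (by omega)
  refine .seq (.store (.seq (.add ?_ (.seq (.store (.seq (.add ?_ (.seq (.store (.seq (.add ?_
    (.add ?_ ?_))))))))))))
  · simp [RAMState.vars_put, h3]; omega
  · simp [RAMState.vars_put, RAMState.vars_set, h3]; omega
  · simp [RAMState.vars_put, RAMState.vars_set, h3]; omega
  · simp [RAMState.vars_put, RAMState.vars_set, h3]; omega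
  · refine ⟨?_, ?_, ?_, ?_, ?_, ?_, ?_⟩
    · exact (((((((SameVars.refl _ s).put _ _).set _ (by simp)).put _ _).set _ (by simp)).put _
        _).set _ (by simp)).set _ (by simp)
    · simp [RAMState.vars_put, RAMState.vars_set, h3]
    · simp [RAMState.vars_put, RAMState.vars_set, h3]
    · intro p hp
      simp only [RAMState.vars_put, RAMState.vars_set, RAMState.heap_set, RAMState.heap_put, h3]
      simp
      rw [if_neg (by omega), if_neg (by omega), if_neg (by omega)]
    · simp [RAMState.vars_put, RAMState.vars_set, RAMState.heap_set, RAMState.heap_put, h3]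
      intro h
      omega
    · simp [RAMState.vars_put, RAMState.vars_set, RAMState.heap_set, RAMState.heap_put, h3]
    · simp [RAMState.vars_put, RAMState.vars_set, RAMState.heap_set, RAMState.heap_put, h3]

/-- The variables changed by `insertCmd`. -/
abbrev insertVars : List ℕ := [2, 8, 9, 10, 11, 17, 21, 22, 23, 24, 25, 26]

theorem SearchState.append {s' : RAMState} {e : Item n m} (h : SearchState x P s)
    (hv : SameVars insertVars s s') (h8 : s'.vars 8 = s.vars 8 + 3)
    (h9 : s'.vars 9 = s.vars 9 + 1) (hlow : ∀ p, p < n * m + m → s'.heap p = s.heap p)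
    (htab : ∀ w : BVec m, s'.heap (n * m + m + wordCode w) = tableEntry (P ++ [e]) w)
    (hq : ∀ p, queueBase n m ≤ p → p < s.vars 8 → s'.heap p = s.heap p)
    (hq0 : s'.heap (s.vars 8) = wordCode e.word) (hq1 : s'.heap (s.vars 8 + 1) = e.pos)
    (hq2 : s'.heap (s.vars 8 + 2) = e.src * m)
    (hatt : Attained x (s'.vars 2) (s'.vars 10) (s'.vars 11))
    (hcov : Covers x (P ++ [e]) (s'.vars 2)) : SearchState x (P ++ [e]) s' := by
  refine ⟨?_, ?_, ?_, ?_, ?_, ?_, ?_, ?_, ?_, ?_, ?_, ?_, htab, ?_, hatt, hcov⟩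
  · rw [hv 0 (by simp), h.v0]
  · rw [hv 1 (by simp), h.v1]
  · rw [hv 3 (by simp), h.v3]
  · rw [hv 4 (by simp), h.v4]
  · rw [hv 5 (by simp), h.v5]
  · rw [hv 6 (by simp), h.v6]
  · rw [hv 7 (by simp), h.v7]
  · rw [h8, h.v8, List.length_append, List.length_singleton]; omega
  · rw [h9, h.v9, List.length_append, List.length_singleton]
  · rw [hv 28 (by simp), h.v28]
  · intro i k hk
    have := Fin.mul_add_le_mul m i
    rw [hlow _ (by omega)]
    exact h.input i k hk
  · intro k hk
    rw [hlow _ (by omega)]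
    exact h.pow k hk
  · intro t f hf
    rcases lt_trichotomy t P.length with ht | ht | ht
    · rw [List.getElem?_append_left ht] at hf
      have := h.v8
      rw [hq _ (by omega) (by omega), hq _ (by omega) (by omega), hq _ (by omega) (by omega)]
      exact h.queue t f hf
    · subst ht
      simp only [List.getElem?_concat_length, Option.some.injEq] at hf
      subst hf
      rw [← h.v8]
      exact ⟨hq0, hq1, hq2⟩
    · rw [List.getElem?_eq_none (by simp; omega)] at hf
      simp at hf

/-- Table entries are addresses plus one, so that `0` means "not met". After subtracting one,
comparing addresses orders the pair, and equal addresses mean equal sources, as `m` is positive. -/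
theorem run_insertCmd (hm : 1 ≤ m) (h : SearchState x P s) {e : Item n m}
    (h20 : s.vars 20 = wordCode e.word) (h15 : s.vars 15 = e.pos) (h16 : s.vars 16 = e.src * m)
    (hL : queueBase n m + 3 * (P.length + 1) + 2 < 2 ^ L) :
    Run D L insertCmd s (10 * m + 22) fun s' =>
      SearchState x (P ++ [e]) s' ∧ SameVars insertVars s s' := by
  have hcode := codeUpTo_lt e.word m
  have hsrc := Fin.mul_add_le_mul m e.src
  have hQ : queueBase n m = n * m + m + 2 ^ m := rfl
  have h8 := h.v8
  have h9 := h.v9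
  have hpw : 0 < 2 ^ m := by positivity
  refine Run.le (N := 7 + (1 + (1 + (max (1 + (max (10 * m + 8) (max (10 * m + 8) 1 + 1) + 1))
    (1 + 1) + 1)))) ?_ (by omega)
  refine .seq ((run_enqueueCmd h.v3 (by omega) (by omega)).mono le_rfl ?_)
  rintro u ⟨hsame, u8, u9, hlow, hq0, hq1, hq2⟩
  have u1 : u.vars 1 = m := by rw [hsame 1 (by simp), h.v1]
  have u3 : u.vars 3 = 1 := by rw [hsame 3 (by simp), h.v3]
  have u4 : u.vars 4 = 0 := by rw [hsame 4 (by simp), h.v4]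
  have u7 : u.vars 7 = n * m + m := by rw [hsame 7 (by simp), h.v7]
  have u20 : u.vars 20 = wordCode e.word := by rw [hsame 20 (by simp), h20]
  have u16 : u.vars 16 = e.src * m := by rw [hsame 16 (by simp), h16]
  have u2 : u.vars 2 = s.vars 2 := hsame 2 (by simp)
  have u10 : u.vars 10 = s.vars 10 := hsame 10 (by simp)
  have u11 : u.vars 11 = s.vars 11 := hsame 11 (by simp)
  have hwc : ∀ w : BVec m, wordCode w < 2 ^ m := fun w => codeUpTo_lt w m
  have utab : ∀ w : BVec m, u.heap (n * m + m + wordCode w) = tableEntry P w := by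
    intro w
    rw [hlow _ (by have := hwc w; omega)]
    exact h.table w
  have uin : HasInput x u := by
    intro i k hk
    have := Fin.mul_add_le_mul m i
    rw [hlow _ (by omega)]
    exact h.input i k hk
  have hc := hwc e.word
  refine .seq (.add (by omega) (.seq (.load ?_)))
  simp only [RAMState.vars_set, RAMState.heap_set, u7, u20, if_true]
  rw [utab]
  set u' := (u.set 17 (n * m + m + wordCode e.word)).set 21 (tableEntry P e.word) with hu'
  have hsame' : SameVars [8, 9, 17, 21] s u' :=
    ((hsame.mono (by simp)).set _ (by simp)).set _ (by simp)
  have w8 : u'.vars 8 = s.vars 8 + 3 := by simp [hu', RAMState.vars_set, u8]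
  have w9 : u'.vars 9 = s.vars 9 + 1 := by simp [hu', RAMState.vars_set, u9]
  have wheap : u'.heap = u.heap := rfl
  have w21 : u'.vars 21 = tableEntry P e.word := by simp [hu', RAMState.vars_set]
  have w17 : u'.vars 17 = n * m + m + wordCode e.word := by simp [hu', RAMState.vars_set]
  have w1 : u'.vars 1 = m := by rw [hsame' 1 (by simp), h.v1]
  have w3 : u'.vars 3 = 1 := by rw [hsame' 3 (by simp), h.v3]
  have w4 : u'.vars 4 = 0 := by rw [hsame' 4 (by simp), h.v4]
  have w16 : u'.vars 16 = e.src * m := by rw [hsame' 16 (by simp), h16]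
  have w2 : u'.vars 2 = s.vars 2 := hsame' 2 (by simp)
  have w10 : u'.vars 10 = s.vars 10 := hsame' 10 (by simp)
  have w11 : u'.vars 11 = s.vars 11 := hsame' 11 (by simp)
  clear_value u'
  rcases hP : (P.find? fun a => a.word = e.word) with _ | f
  · have h0 : tableEntry P e.word = 0 := by simp [tableEntry, hP]
    refine .ite (fun hlt => absurd hlt (by omega)) fun _ => ?_
    refine .seq (.add (by omega) (.store ?_))
    simp only [RAMState.vars_set, w17, w16, w3]
    simp only [Nat.reduceEqDiff, if_true, if_false]
    have hs2 : SameVars insertVars s ((u'.set 21 (e.src * m + 1)).put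
        (n * m + m + wordCode e.word) (e.src * m + 1)) :=
      ((hsame'.mono (by simp)).set _ (by simp)).put _ _
    refine ⟨h.append hs2 ?_ ?_ ?_ ?_ ?_ ?_ ?_ ?_ ?_ ?_, hs2⟩
    · simp [RAMState.vars_put, RAMState.vars_set, w8]
    · simp [RAMState.vars_put, RAMState.vars_set, w9]
    · intro p hp
      rw [RAMState.heap_put, if_neg (by omega), RAMState.heap_set, wheap, hlow _ (by omega)]
    · intro w
      rw [RAMState.heap_put, RAMState.heap_set, wheap, tableEntry_append_of_find_none hP, utab]
      congr 1
      simp [wordCode_injective.eq_iff]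
    · intro p hp hp'
      rw [RAMState.heap_put, if_neg (by omega), RAMState.heap_set, wheap, hlow _ (by omega)]
    · rw [RAMState.heap_put, if_neg (by omega), RAMState.heap_set, wheap, hq0, h20]
    · rw [RAMState.heap_put, if_neg (by omega), RAMState.heap_set, wheap, hq1, h15]
    · rw [RAMState.heap_put, if_neg (by omega), RAMState.heap_set, wheap, hq2, h16]
    · simpa [RAMState.vars_put, RAMState.vars_set, w2, w10, w11] using h.attained
    · have : Covers x (P ++ [e]) (s.vars 2) :=
        h.covers.append_singleton fun e' he' => by rw [hP] at he'; simp at he'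
      simpa [RAMState.vars_put, RAMState.vars_set, w2] using this
  · have hf : tableEntry P e.word = f.src * m + 1 := by simp [tableEntry, hP]
    have hfsrc := Fin.mul_add_le_mul m f.src
    have done : ∀ s', s'.heap = u.heap → SameVars insertVars s s' → s'.vars 8 = s.vars 8 + 3 →
        s'.vars 9 = s.vars 9 + 1 → Attained x (s'.vars 2) (s'.vars 10) (s'.vars 11) →
        s'.vars 2 ≤ s.vars 2 →
        (f.src ≠ e.src → s'.vars 2 ≤ hammingDist (x f.src) (x e.src)) →
        SearchState x (P ++ [e]) s' ∧ SameVars insertVars s s' := by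
      intro s' hh hv e8 e9 hatt hle hbest
      refine ⟨h.append hv e8 e9 ?_ ?_ ?_ ?_ ?_ ?_ hatt ?_, hv⟩
      · intro p hp; rw [hh, hlow _ (by omega)]
      · intro w; rw [hh, utab, tableEntry_append_of_find hP]
      · intro p hp hp'; rw [hh, hlow _ hp']
      · rw [hh, hq0, h20]
      · rw [hh, hq1, h15]
      · rw [hh, hq2, h16]
      · refine (h.covers.mono hle).append_singleton fun e' he' hne => ?_
        rw [hP] at he'
        obtain rfl : f = e' := by simpa using he'
        exact hbest hne
    refine .ite (fun _ => ?_) (fun hlt => absurd (by omega) hlt)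
    refine .seq (.sub ?_)
    rw [w21, w3, hf, Nat.add_sub_cancel]
    have y21 : (u'.set 21 (f.src * m)).vars 21 = f.src * m := by simp [RAMState.vars_set]
    have y16 : (u'.set 21 (f.src * m)).vars 16 = e.src * m := by simp [RAMState.vars_set, w16]
    have hs2 : SameVars [8, 9, 17, 21] s (u'.set 21 (f.src * m)) := hsame'.set _ (by simp)
    have y8 : (u'.set 21 (f.src * m)).vars 8 = s.vars 8 + 3 := by simp [RAMState.vars_set, w8]
    have y9 : (u'.set 21 (f.src * m)).vars 9 = s.vars 9 + 1 := by simp [RAMState.vars_set, w9]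
    have yheap : (u'.set 21 (f.src * m)).heap = u.heap := wheap
    generalize u'.set 21 (f.src * m) = y at *
    have y1 : y.vars 1 = m := by rw [hs2 1 (by simp), h.v1]
    have y3 : y.vars 3 = 1 := by rw [hs2 3 (by simp), h.v3]
    have y4 : y.vars 4 = 0 := by rw [hs2 4 (by simp), h.v4]
    have y2 : y.vars 2 = s.vars 2 := hs2 2 (by simp)
    have y10 : y.vars 10 = s.vars 10 := hs2 10 (by simp)
    have y11 : y.vars 11 = s.vars 11 := hs2 11 (by simp)
    have yin : HasInput x y := by intro i k hk; rw [yheap]; exact uin i k hk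
    have yatt : Attained x (y.vars 2) (y.vars 10) (y.vars 11) := by
      rw [y2, y10, y11]; exact h.attained
    have fin : ∀ s' : RAMState, SameVars [2, 10, 11, 22, 23, 24, 25, 26] y s' →
        SameVars insertVars s s' ∧ s'.vars 8 = s.vars 8 + 3 ∧ s'.vars 9 = s.vars 9 + 1 := by
      intro s' hv
      exact ⟨hs2.trans hv (by simp) (by simp), by rw [hv 8 (by simp), y8],
        by rw [hv 9 (by simp), y9]⟩
    refine .ite (fun hlt => ?_) (fun hlt => .ite (fun hlt' => ?_) (fun hlt' => ?_))
    · rw [y21, y16] at hlt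
      have hlt2 : f.src < e.src := by
        rw [Fin.lt_def]; exact lt_of_mul_lt_mul_right hlt (Nat.zero_le _)
      refine (run_examineCmd (by omega) yin y1 y3 y4 (by simp) (by simp) y21 y16 hlt2 yatt).mono
        le_rfl ?_
      rintro s' ⟨hh, hv, hatt, hle, hbest⟩
      obtain ⟨a1, a2, a3⟩ := fin s' hv
      exact done s' (hh.trans yheap) a1 a2 a3 hatt (by omega) fun _ => hbest
    · rw [y21, y16] at hlt'
      have hlt2 : e.src < f.src := by
        rw [Fin.lt_def]; exact lt_of_mul_lt_mul_right hlt' (Nat.zero_le _)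
      refine (run_examineCmd (by omega) yin y1 y3 y4 (by simp) (by simp) y16 y21 hlt2 yatt).mono
        le_rfl ?_
      rintro s' ⟨hh, hv, hatt, hle, hbest⟩
      obtain ⟨a1, a2, a3⟩ := fin s' hv
      refine done s' (hh.trans yheap) a1 a2 a3 hatt (by omega) fun _ => ?_
      rwa [hammingDist_comm]
    · rw [y21, y16] at hlt hlt'
      have heq : f.src = e.src := by
        rw [Fin.ext_iff]
        exact Nat.eq_of_mul_eq_mul_right hm (by omega)
      obtain ⟨a1, a2, a3⟩ := fin y (SameVars.refl _ _)
      exact .skip (done y yheap a1 a2 a3 yatt (by omega) fun hne => absurd heq hne)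

/-! ## Generating the next level -/

/-- Insert the children of the item in the variables `14`, `15`, `16`. -/
def childrenCmd : Cmd :=
  .loop 15 1 <|
    .seq (.add 17 16 15) <| .seq (.load 18 17) <| .seq (.add 17 5 15) <| .seq (.load 19 17) <|
    .seq (.ite 4 18 (.sub 20 14 19) (.add 20 14 19)) <| .seq (.add 15 15 3) insertCmd

/-- Take an item from the queue and insert its children. -/
def expandCmd : Cmd :=
  .seq (.load 14 12) <| .seq (.add 12 12 3) <| .seq (.load 15 12) <| .seq (.add 12 12 3) <|
  .seq (.load 16 12) <| .seq (.add 12 12 3) childrenCmd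

/-- Expand all the items from the address in the variable `12` to the present end of the queue. -/
def levelCmd : Cmd := .seq (.add 13 8 4) (.loop 12 13 expandCmd)

/-- The variables changed by `childrenCmd`. -/
abbrev childrenVars : List ℕ := [2, 8, 9, 10, 11, 15, 17, 18, 19, 20, 21, 22, 23, 24, 25, 26]

theorem run_childrenCmd (hm : 1 ≤ m) (h : SearchState x P s) {e : Item n m} {l : ℕ}
    (he : e.Valid x l) (h14 : s.vars 14 = wordCode e.word) (h15 : s.vars 15 = e.pos)
    (h16 : s.vars 16 = e.src * m)
    (hL : queueBase n m + 3 * (P.length + e.children.length) + 2 < 2 ^ L) :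
    Run D L childrenCmd s (m * (10 * m + 30) + 1) fun s' =>
      SearchState x (P ++ e.children) s' ∧ SameVars childrenVars s s' := by
  have hpos := he.pos_le
  have hsrc := Fin.mul_add_le_mul m e.src
  have hQ : queueBase n m = n * m + m + 2 ^ m := rfl
  have hclen : e.children.length = m - e.pos := by simp [Item.children]
  have hwc : ∀ w : BVec m, wordCode w < 2 ^ m := fun w => codeUpTo_lt w m
  have hloop := Run.loop (D := D) (L := L) (a := 15) (b := 1) (N := 10 * m + 29)
    (p := .seq (.add 17 16 15) <| .seq (.load 18 17) <| .seq (.add 17 5 15) <|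
      .seq (.load 19 17) <| .seq (.ite 4 18 (.sub 20 14 19) (.add 20 14 19)) <|
      .seq (.add 15 15 3) insertCmd)
    (fun t u => ∃ q, e.pos + q ≤ m ∧ u.vars 15 = e.pos + q ∧ t = m - (e.pos + q) ∧
      SearchState x (P ++ (List.range' e.pos q).map e.child) u ∧ SameVars childrenVars s u)
    ?_ (s := s) (k := m - e.pos) ?_
  · refine hloop.mono ?_ ?_
    · exact Nat.add_le_add_right (Nat.mul_le_mul (by omega) (by omega)) 1
    · rintro u ⟨hexit, t, q, hq, u15, -, hu, hv⟩
      have := hu.v1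
      have hqm : q = m - e.pos := by omega
      subst hqm
      exact ⟨hu, hv⟩
  · rintro t u ⟨q, hq, u15, ht, hu, hv⟩ hlt
    have u1 := hu.v1
    have u3 := hu.v3
    have u4 := hu.v4
    have u5 := hu.v5
    have hk : e.pos + q < m := by omega
    have u14 : u.vars 14 = wordCode e.word := by rw [hv 14 (by simp), h14]
    have u16 : u.vars 16 = e.src * m := by rw [hv 16 (by simp), h16]
    have l1 : u.heap (e.src * m + (e.pos + q)) = wordBit e.word (e.pos + q) := by
      rw [hu.input e.src _ hk, he.agree _ (by omega)]
    have l2 := hu.pow _ hk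
    have hpw : 2 ^ (e.pos + q) ≤ 2 ^ m := Nat.pow_le_pow_right (by norm_num) hk.le
    have hw := hwc e.word
    have hmp : m < 2 ^ m := Nat.lt_two_pow_self
    have hflip := wordCode_flipBit e.word hk
    have hflt := hwc (flipBit e.word (e.pos + q))
    refine ⟨m - (e.pos + (q + 1)), by omega, ?_⟩
    refine Run.le (N := 1 + (1 + (1 + (1 + ((max 1 1 + 1) + (1 + (10 * m + 22))))))) ?_ (by omega)
    refine .seq (.add (by omega) (.seq (.load (.seq (.add ?_ (.seq (.load (.seq ?_))))))))
    · simp [RAMState.vars_set, u5, u15]; omega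
    simp only [RAMState.vars_set, RAMState.heap_set, u16, u15, u5, if_true, if_false,
      Nat.reduceEqDiff, l1, l2]
    set u' := (((u.set 17 (e.src * m + (e.pos + q))).set 18 (wordBit e.word (e.pos + q))).set 17
      (n * m + (e.pos + q))).set 19 (2 ^ (e.pos + q)) with hu'
    have hsame : SameVars [15, 17, 18, 19, 20] u u' :=
      ((((SameVars.refl _ u).set _ (by simp)).set _ (by simp)).set _ (by simp)).set _ (by simp)
    have w18 : u'.vars 18 = wordBit e.word (e.pos + q) := by simp [hu', RAMState.vars_set]
    have w19 : u'.vars 19 = 2 ^ (e.pos + q) := by simp [hu', RAMState.vars_set]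
    have w15 : u'.vars 15 = e.pos + q := by simp [hu', RAMState.vars_set, u15]
    have w14 : u'.vars 14 = wordCode e.word := by rw [hsame 14 (by simp), u14]
    have w4 : u'.vars 4 = 0 := by rw [hsame 4 (by simp), u4]
    have w3 : u'.vars 3 = 1 := by rw [hsame 3 (by simp), u3]
    have w16 : u'.vars 16 = e.src * m := by rw [hsame 16 (by simp), u16]
    have wheap : u'.heap = u.heap := rfl
    clear_value u'
    -- The loop counter is advanced before the insertion, so variable `15` already holds the
    -- position `k + 1` of the child.
    have final : Run D L (.seq (.add 15 15 3) insertCmd)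
        (u'.set 20 (wordCode (flipBit e.word (e.pos + q)))) (1 + (10 * m + 22)) fun s' =>
        ∃ q', e.pos + q' ≤ m ∧ s'.vars 15 = e.pos + q' ∧ m - (e.pos + (q + 1)) = m - (e.pos + q') ∧
          SearchState x (P ++ (List.range' e.pos q').map e.child) s' ∧
          SameVars childrenVars s s' := by
      refine .seq (.add ?_ ?_)
      · simp [RAMState.vars_set, w15, w3]; omega
      have hsame2 := (hsame.set (v := 20) (wordCode (flipBit e.word (e.pos + q)))
        (by simp)).set (v := 15) (e.pos + q + 1) (by simp)
      have e1 : (u'.set 20 (wordCode (flipBit e.word (e.pos + q)))).vars 15 +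
          (u'.set 20 (wordCode (flipBit e.word (e.pos + q)))).vars 3 = e.pos + q + 1 := by
        simp [RAMState.vars_set, w15, w3]
      rw [e1]
      refine (run_insertCmd (e := e.child (e.pos + q)) hm (hu.congr hsame2 wheap (by simp))
        ?_ ?_ ?_ ?_).mono le_rfl ?_
      · simp [RAMState.vars_set, Item.child]
      · simp [RAMState.vars_set, Item.child]
      · simp [RAMState.vars_set, Item.child, w16]
      · simp; omega
      · rintro s' ⟨hs', hv'⟩
        refine ⟨q + 1, by omega, ?_, rfl, ?_, ?_⟩
        · rw [hv' 15 (by simp)]; simp [RAMState.vars_set]; omega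
        · rw [List.range'_1_concat, List.map_append, ← List.append_assoc]
          exact hs'
        · exact hv.trans (hsame2.trans hv' (U := childrenVars) (by simp) (by simp)) (by simp)
            (by simp)
    refine .ite (fun hb => .sub ?_) (fun hb => .add ?_ ?_)
    · rw [w14, w19]
      rw [w4, w18] at hb
      rw [if_pos hb] at hflip
      rw [← hflip]
      exact final
    · rw [w4, w18] at hb
      rw [if_neg hb] at hflip
      omega
    · rw [w14, w19]
      rw [w4, w18] at hb
      rw [if_neg hb] at hflip
      rw [← hflip]
      exact final
  · exact ⟨0, by omega, by omega, by omega, by simpa using h, SameVars.refl _ _⟩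

end

section

variable {n m : ℕ} {D : ℕ → BVec m → BVec m} {L : ℕ} {x : Fin n → BVec m} {s : RAMState}
  {P : List (Item n m)}

/-- The variables changed by `levelCmd`. -/
abbrev levelVars : List ℕ :=
  [2, 8, 9, 10, 11, 12, 13, 14, 15, 16, 17, 18, 19, 20, 21, 22, 23, 24, 25, 26]

theorem run_expandCmd (hm : 1 ≤ m) (h : SearchState x P s) {e : Item n m} {l t : ℕ}
    (he : e.Valid x l) (ht : P[t]? = some e) (h12 : s.vars 12 = queueBase n m + 3 * t)
    (hL : queueBase n m + 3 * (P.length + e.children.length) + 2 < 2 ^ L) :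
    Run D L expandCmd s (m * (10 * m + 30) + 7) fun s' =>
      SearchState x (P ++ e.children) s' ∧ s'.vars 12 = queueBase n m + 3 * (t + 1) ∧
        s'.vars 13 = s.vars 13 ∧ SameVars levelVars s s' := by
  have h3 := h.v3
  obtain ⟨q0, q1, q2⟩ := h.queue t e ht
  have htl : t < P.length := (List.getElem?_eq_some_iff.1 ht).1
  refine Run.le (N := 1 + (1 + (1 + (1 + (1 + (1 + (m * (10 * m + 30) + 1))))))) ?_ (by omega)
  refine .seq (.load (.seq (.add ?_ (.seq (.load (.seq (.add ?_ (.seq (.load (.seq (.add ?_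
    ?_)))))))))))
  · simp [RAMState.vars_set, h12, h3]; omega
  · simp [RAMState.vars_set, h12, h3]; omega
  · simp [RAMState.vars_set, h12, h3]; omega
  simp only [RAMState.vars_set, RAMState.heap_set, h12, h3, if_true, if_false, Nat.reduceEqDiff,
    q0, add_assoc, Nat.reduceAdd]
  simp only [← add_assoc, q1, q2]
  have hv : SameVars [12, 14, 15, 16] s ((((((s.set 14 (wordCode e.word)).set 12
      (queueBase n m + 3 * t + 1)).set 15 e.pos).set 12 (queueBase n m + 3 * t + 2)).set 16
      (e.src * m)).set 12 (queueBase n m + 3 * t + 3)) :=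
    ((((((SameVars.refl _ s).set _ (by simp)).set _ (by simp)).set _ (by simp)).set _
      (by simp)).set _ (by simp)).set _ (by simp)
  refine (run_childrenCmd hm (h.congr hv rfl (by simp)) he ?_ ?_ ?_ hL).mono le_rfl ?_
  · simp [RAMState.vars_set]
  · simp [RAMState.vars_set]
  · simp [RAMState.vars_set]
  · rintro s' ⟨hs', hv'⟩
    refine ⟨hs', ?_, ?_, hv.trans hv' (by simp) (by simp)⟩
    · rw [hv' 12 (by simp)]
      simp [RAMState.vars_set]
      omega
    · rw [hv' 13 (by simp), hv 13 (by simp)]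

/-- `A` has been expanded already and `B` is the current level. The end mark in variable `13` is
taken before the loop, so the appended children wait for the next level. -/
theorem run_levelCmd (hm : 1 ≤ m) {A B : List (Item n m)} (h : SearchState x (A ++ B) s) {l : ℕ}
    (hB : ∀ e ∈ B, e.Valid x l) (h12 : s.vars 12 = queueBase n m + 3 * A.length)
    (hL : queueBase n m + 3 * ((A ++ B).length + (B.flatMap Item.children).length) + 2 < 2 ^ L) :
    Run D L levelCmd s (B.length * (m * (10 * m + 30) + 8) + 2) fun s' =>
      SearchState x (A ++ B ++ B.flatMap Item.children) s' ∧
        s'.vars 12 = queueBase n m + 3 * (A ++ B).length ∧ SameVars levelVars s s' := by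
  have h4 := h.v4
  have h8 := h.v8
  refine Run.le (N := 1 + (B.length * (m * (10 * m + 30) + 7 + 1) + 1)) ?_
    (by rw [add_assoc (m * (10 * m + 30))]; omega)
  refine .seq (.add (by omega) ?_)
  rw [h8, h4, add_zero]
  have hloop := Run.loop (D := D) (L := L) (a := 12) (b := 13) (N := m * (10 * m + 30) + 7)
    (p := expandCmd)
    (fun t u => ∃ q, q ≤ B.length ∧ t = B.length - q ∧
      u.vars 12 = queueBase n m + 3 * (A.length + q) ∧
      u.vars 13 = queueBase n m + 3 * (A ++ B).length ∧
      SearchState x (A ++ B ++ (B.take q).flatMap Item.children) u ∧ SameVars levelVars s u)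
    ?_ (s := s.set 13 (queueBase n m + 3 * (A ++ B).length)) (k := B.length) ?_
  · refine hloop.mono le_rfl ?_
    rintro u ⟨hexit, t, q, hq, -, u12, u13, hu, hv⟩
    have hqB : q = B.length := by
      rw [List.length_append] at u13
      omega
    subst hqB
    rw [List.take_length] at hu
    exact ⟨hu, by rw [u12, List.length_append], hv⟩
  · rintro t u ⟨q, hq, rfl, u12, u13, hu, hv⟩ hlt
    have hqB : q < B.length := by
      rw [List.length_append] at u13
      omega
    refine ⟨B.length - (q + 1), by omega, ?_⟩
    have htake : B.take (q + 1) = B.take q ++ [B[q]] := by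
      rw [List.take_add_one, List.getElem?_eq_getElem hqB]; rfl
    have hflat : (B.take (q + 1)).flatMap Item.children =
        (B.take q).flatMap Item.children ++ B[q].children := by
      rw [htake, List.flatMap_append]; simp
    have hlen : ((B.take (q + 1)).flatMap Item.children).length ≤
        (B.flatMap Item.children).length := by
      conv_rhs => rw [← List.take_append_drop (q + 1) B, List.flatMap_append, List.length_append]
      omega
    rw [hflat, List.length_append] at hlen
    have hget : (A ++ B ++ (B.take q).flatMap Item.children)[A.length + q]? = some B[q] := by
      rw [List.getElem?_append_left (by rw [List.length_append]; omega),
        List.getElem?_append_right (by omega), Nat.add_sub_cancel_left,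
        List.getElem?_eq_getElem hqB]
    refine (run_expandCmd hm hu (hB _ (List.getElem_mem hqB)) hget u12 ?_).mono le_rfl ?_
    · rw [List.length_append (as := A ++ B)]; omega
    · rintro s' ⟨hs', s12, s13, hv'⟩
      refine ⟨q + 1, by omega, rfl, ?_, by rw [s13, u13], ?_, hv.trans hv' (by simp) (by simp)⟩
      · rw [s12]; omega
      · rw [hflat, ← List.append_assoc]; exact hs'
  · refine ⟨0, by omega, by omega, ?_, ?_, ?_, (SameVars.refl _ s).set _ (by simp)⟩
    · simpa [RAMState.vars_set] using h12
    · simp [RAMState.vars_set]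
    · simpa using h.congr ((SameVars.refl [13] s).set (v := 13)
        (queueBase n m + 3 * (A ++ B).length) (by simp)) rfl (by simp)

/-! ## The search -/

/-- Set the bound for the search radius: the best distance, or `0` if the queue is too long. -/
def limitCmd : Cmd := .ite 9 6 (.add 29 2 4) (.const 29 0)

/-- Search in larger and larger balls, until the radius is half the best distance or the queue has
`n ^ 2` items. -/
def searchCmd : Cmd :=
  .seq (.const 27 0) <| .seq limitCmd <|
  .loop 27 29 (.seq levelCmd <| .seq (.add 27 27 28) limitCmd)

theorem Attained.le_succ {b a a' : ℕ} (h : Attained x b a a') : b ≤ m + 1 := by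
  rcases h with h | ⟨i, j, -, -, -, rfl⟩
  · exact h.le
  · have : hammingDist (x i) (x j) ≤ m := by
      simpa using hammingDist_le_card_fintype (x := x i) (y := x j)
    omega

/-- The bound `0` stops the search at once, so a single comparison of `27` with `29` tests both
stopping conditions. -/
theorem run_limitCmd (h : SearchState x P s) (hL : m + 1 < 2 ^ L) :
    Run D L limitCmd s 2 fun s' => s'.heap = s.heap ∧ SameVars [29] s s' ∧
      s'.vars 29 = if s.vars 9 < s.vars 6 then s.vars 2 else 0 := by
  have h2 := h.attained.le_succ
  have h4 := h.v4
  refine .ite (fun hlt => .add (by omega) ?_) (fun hlt => .const (by omega) ?_)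
  · refine ⟨rfl, (SameVars.refl _ s).set _ (by simp), ?_⟩
    simp [RAMState.vars_set, hlt, h4]
  · refine ⟨rfl, (SameVars.refl _ s).set _ (by simp), ?_⟩
    simp [RAMState.vars_set, hlt]

theorem exists_searchUpTo_eq_append (x : Fin n → BVec m) (ρ : ℕ) :
    ∃ A, searchUpTo x ρ = A ++ searchLevel x ρ := by
  cases ρ with
  | zero => exact ⟨[], rfl⟩
  | succ ρ => exact ⟨searchUpTo x ρ, rfl⟩

/-- The invariant of the main loop, after the levels up to `ρ`. -/
structure SearchInv (x : Fin n → BVec m) (ρ : ℕ) (s : RAMState) : Prop where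
  state : SearchState x (searchUpTo x ρ) s
  v27 : s.vars 27 = 2 * ρ
  v29 : s.vars 29 = if s.vars 9 < s.vars 6 then s.vars 2 else 0
  v12 : s.vars 12 + 3 * (searchLevel x ρ).length = queueBase n m + 3 * (searchUpTo x ρ).length

/-- Two facts bound the cost: there are at most `K` rounds, and each expands at most `n * M` items.
-/
theorem run_searchCmd (hm : 1 ≤ m) {i j : Fin n} (hx : IsUniqueClosestPair x i j)
    (h : SearchState x (searchUpTo x 0) s) (h12 : s.vars 12 = queueBase n m)
    (hL : queueBase n m + 3 * (n * 2 ^ m) + 2 < 2 ^ L) {K M : ℕ}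
    (hK : K = (hammingDist (x i) (x j) + 1) / 2) (hM : M = min n (ballCard m K)) :
    Run D L searchCmd s (m * (n * M * (m * (10 * m + 30) + 8) + 6) + 4) fun s' =>
      ∃ ρ ≤ K, SearchInv x ρ s' ∧ s'.vars 29 ≤ 2 * ρ := by
  have hQ : queueBase n m = n * m + m + 2 ^ m := rfl
  have hdm : hammingDist (x i) (x j) ≤ m := by
    simpa using hammingDist_le_card_fintype (x := x i) (y := x j)
  have hpw : 0 < 2 ^ m := by positivity
  have hn : 0 < n := by have := i.2; omega
  have hnp : 0 < n * 2 ^ m := by positivity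
  refine Run.le (N := 1 + (2 + (K * ((n * M * (m * (10 * m + 30) + 8) + 2 + (1 + 2)) + 1) + 1))) ?_
    ?_
  swap
  · have : K * ((n * M * (m * (10 * m + 30) + 8) + 2 + (1 + 2)) + 1) ≤
        m * (n * M * (m * (10 * m + 30) + 8) + 6) := Nat.mul_le_mul (by omega) (by omega)
    omega
  refine .seq (.const (by omega) (.seq ?_))
  have hv0 : SameVars [27] s (s.set 27 0) := (SameVars.refl _ s).set _ (by simp)
  have h0 := h.congr hv0 rfl (by simp)
  refine (run_limitCmd h0 (by omega)).mono le_rfl ?_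
  rintro u ⟨uh, uv, u29⟩
  have hu := h0.congr uv uh (by simp)
  have u27 : u.vars 27 = 0 := by rw [uv 27 (by simp)]; simp [RAMState.vars_set]
  have u12 : u.vars 12 = queueBase n m := by
    rw [uv 12 (by simp), hv0 12 (by simp), h12]
  rw [← uv 9 (by simp), ← uv 6 (by simp), ← uv 2 (by simp)] at u29
  have hloop := Run.loop (D := D) (L := L) (a := 27) (b := 29)
    (N := n * M * (m * (10 * m + 30) + 8) + 2 + (1 + 2))
    (p := .seq levelCmd <| .seq (.add 27 27 28) limitCmd)
    (fun t u => ∃ ρ ≤ K, t = K - ρ ∧ SearchInv x ρ u) ?_ (s := u) (k := K) ?_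
  · refine hloop.mono le_rfl ?_
    rintro s' ⟨hexit, t, ρ, hρ, -, hs'⟩
    have := hs'.v27
    exact ⟨ρ, hρ, hs', by omega⟩
  · rintro t w ⟨ρ, hρ, rfl, hw⟩ hlt
    have w27 := hw.v27
    have w29 := hw.v29
    have hcnt : w.vars 9 < w.vars 6 := by
      by_contra hcon
      rw [if_neg hcon] at w29
      omega
    rw [if_pos hcnt] at w29
    -- At radius `K` the collision has happened: the best distance is at most `d ≤ 2 * K`, and the
    -- guard fails.
    have hρK : ρ < K := by
      by_contra hcon
      have := hw.state.covers.le_hammingDist hx (by omega)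
      omega
    rw [hw.state.v9, hw.state.v6, length_searchUpTo] at hcnt
    -- The queue has `n * ballCard m ρ` items, so a length below `n * n` means a ball with fewer
    -- than `n` words.
    have hball : ballCard m ρ < n := lt_of_mul_lt_mul_left hcnt (Nat.zero_le _)
    have hlevel : (searchLevel x ρ).length ≤ n * M := by
      rw [length_searchLevel]
      refine Nat.mul_le_mul_left n ?_
      have h1 : m.choose ρ ≤ ballCard m ρ :=
        Finset.single_le_sum (f := fun l => m.choose l) (fun _ _ => Nat.zero_le _)
          (Finset.mem_range.2 (by omega))
      rw [hM]
      exact le_min (h1.trans hball.le) (h1.trans (ballCard_mono hρ))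
    obtain ⟨A, hA⟩ := exists_searchUpTo_eq_append x ρ
    have hst := hw.state
    have w12 := hw.v12
    rw [hA] at hst
    rw [hA, List.length_append] at w12
    refine ⟨K - (ρ + 1), by omega, .seq ?_⟩
    have hlen : (A ++ searchLevel x ρ).length +
        ((searchLevel x ρ).flatMap Item.children).length ≤ n * 2 ^ m := by
      have h1 := length_searchUpTo x (ρ + 1)
      rw [searchUpTo, List.length_append, hA] at h1
      have h2 := Nat.mul_le_mul_left n (ballCard_le_two_pow m (ρ + 1))
      rw [← h1] at h2
      exact h2
    refine (run_levelCmd hm hst (fun e he => valid_of_mem_searchLevel he) (by omega)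
      (by omega)).mono (Nat.add_le_add_right (Nat.mul_le_mul_right _ hlevel) 2) ?_
    rintro y ⟨hy, y12, yv⟩
    have y27 : y.vars 27 = 2 * ρ := by rw [yv 27 (by simp), w27]
    have y28 := hy.v28
    have hmp : m < 2 ^ m := Nat.lt_two_pow_self
    refine .seq (.add (by omega) ?_)
    have zv : SameVars [27] y (y.set 27 (y.vars 27 + y.vars 28)) :=
      (SameVars.refl _ y).set _ (by simp)
    have z27 : (y.set 27 (y.vars 27 + y.vars 28)).vars 27 = 2 * (ρ + 1) := by
      simp [RAMState.vars_set, y27, y28]; ring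
    have hz := hy.congr zv rfl (by simp)
    rw [← hA] at hz y12
    refine (run_limitCmd hz (by omega)).mono le_rfl ?_
    rintro s' ⟨sh, sv, s29⟩
    rw [← sv 9 (by simp), ← sv 6 (by simp), ← sv 2 (by simp)] at s29
    refine ⟨ρ + 1, by omega, rfl, hz.congr sv sh (by simp), ?_, s29, ?_⟩
    · rw [sv 27 (by simp), z27]
    · rw [sv 12 (by simp), zv 12 (by simp), y12, searchUpTo, List.length_append]; ring
  · refine ⟨0, by omega, by omega, hu, by omega, u29, ?_⟩
    rw [u12]; rfl

/-! ## Examining all pairs -/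

/-- Examine all pairs of vectors. -/
def allPairsCmd : Cmd :=
  .seq (.const 30 0) <| .loop 30 5 <| .seq (.add 31 30 1) <|
    .seq (.loop 31 5 (.seq (examineCmd 30 31) (.add 31 31 1))) (.add 30 30 1)

/-- The variables changed by `allPairsCmd`. -/
abbrev allPairsVars : List ℕ := [2, 10, 11, 22, 23, 24, 25, 26, 30, 31]

/-- The loop variables are addresses, advanced by `m` up to `n * m`; the index `c` occurs only in
the invariants. -/
theorem run_allPairsCmd (hm : 1 ≤ m) (h : SearchState x P s) (hL : n * m + m + 2 < 2 ^ L) :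
    Run D L allPairsCmd s (n * (n * (10 * m + 10) + 4) + 2) fun s' =>
      s'.vars 1 = m ∧ s'.vars 3 = 1 ∧ s'.vars 4 = 0 ∧
      Attained x (s'.vars 2) (s'.vars 10) (s'.vars 11) ∧
      ∀ k l : Fin n, k < l → s'.vars 2 ≤ hammingDist (x k) (x l) := by
  have lt_of : ∀ {a b : ℕ}, a * m < b * m → a < b := fun h => lt_of_mul_lt_mul_right h (Nat.zero_le _)
  have hinner : ∀ (a : Fin n) (u : RAMState), u.heap = s.heap → SameVars allPairsVars s u →
      u.vars 30 = a * m → u.vars 31 = (a + 1 : ℕ) * m →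
      Attained x (u.vars 2) (u.vars 10) (u.vars 11) →
      Run D L (.loop 31 5 (.seq (examineCmd 30 31) (.add 31 31 1))) u (n * (10 * m + 10) + 1)
        fun s' => s'.heap = s.heap ∧ SameVars allPairsVars s s' ∧ s'.vars 30 = a * m ∧
          Attained x (s'.vars 2) (s'.vars 10) (s'.vars 11) ∧ s'.vars 2 ≤ u.vars 2 ∧
          ∀ l : Fin n, a < l → s'.vars 2 ≤ hammingDist (x a) (x l) := by
    intro a u uh uv u30 u31 uatt
    have hloop := Run.loop (D := D) (L := L) (a := 31) (b := 5) (N := 10 * m + 9)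
      (p := .seq (examineCmd 30 31) (.add 31 31 1))
      (fun t w => ∃ c : ℕ, (a : ℕ) < c ∧ c ≤ n ∧ t = n - c ∧ w.vars 31 = c * m ∧
        w.heap = s.heap ∧ SameVars allPairsVars s w ∧ w.vars 30 = a * m ∧
        Attained x (w.vars 2) (w.vars 10) (w.vars 11) ∧ w.vars 2 ≤ u.vars 2 ∧
        ∀ l : Fin n, a < l → (l : ℕ) < c → w.vars 2 ≤ hammingDist (x a) (x l))
      ?_ (s := u) (k := n - (a + 1)) ?_
    · refine hloop.mono (Nat.add_le_add_right (Nat.mul_le_mul (by omega) (by omega)) 1) ?_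
      rintro w ⟨hexit, t, c, hac, hcn, -, w31, wh, wv, w30, watt, wle, wall⟩
      have w5 : w.vars 5 = n * m := by rw [wv 5 (by simp), h.v5]
      have hc : c = n := by
        refine le_antisymm hcn (le_of_not_gt fun hlt => hexit ?_)
        rw [w31, w5]
        exact Nat.mul_lt_mul_of_pos_right hlt hm
      subst hc
      exact ⟨wh, wv, w30, watt, wle, fun l hl => wall l hl l.2⟩
    · rintro t w ⟨c, hac, hcn, rfl, w31, wh, wv, w30, watt, wle, wall⟩ hlt
      have w5 : w.vars 5 = n * m := by rw [wv 5 (by simp), h.v5]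
      have w1 : w.vars 1 = m := by rw [wv 1 (by simp), h.v1]
      have w3 : w.vars 3 = 1 := by rw [wv 3 (by simp), h.v3]
      have w4 : w.vars 4 = 0 := by rw [wv 4 (by simp), h.v4]
      rw [w31, w5] at hlt
      have hc := lt_of hlt
      have win : HasInput x w := by intro i k hk; rw [wh]; exact h.input i k hk
      refine ⟨n - (c + 1), by omega, ?_⟩
      refine Run.le (N := (10 * m + 8) + 1) (.seq ?_) (by omega)
      refine (run_examineCmd (i := a) (j := ⟨c, hc⟩) hL win w1 w3 w4 (by simp) (by simp) w30 w31
        hac watt).mono le_rfl ?_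
      rintro y ⟨yh, yv, yatt, yle, ybest⟩
      have y31 : y.vars 31 = c * m := by rw [yv 31 (by simp), w31]
      have y1 : y.vars 1 = m := by rw [yv 1 (by simp), w1]
      refine .add (by omega) ?_
      refine ⟨c + 1, by omega, by omega, rfl, ?_, yh.trans wh, ?_, ?_, ?_, ?_, ?_⟩
      · simp [RAMState.vars_set, y31, y1]; ring
      · exact (wv.trans yv (U := allPairsVars) (by simp) (by simp)).set _ (by simp)
      · simp [RAMState.vars_set, yv 30 (by simp), w30]
      · simpa [RAMState.vars_set] using yatt
      · simp [RAMState.vars_set]; omega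
      · intro l hl hlc
        simp only [RAMState.vars_set]
        rcases Nat.lt_succ_iff_lt_or_eq.1 hlc with h1 | h1
        · have := wall l hl h1
          simp; omega
        · obtain rfl : l = ⟨c, hc⟩ := Fin.ext h1
          simpa using ybest
    · exact ⟨a + 1, by omega, a.2, rfl, u31, uh, uv, u30, uatt, le_rfl,
        fun l hl hlc => absurd hl (by rw [Fin.lt_def]; omega)⟩
  refine Run.le (N := 1 + (n * (1 + ((n * (10 * m + 10) + 1) + 1) + 1) + 1)) ?_ (by
    have : n * (1 + ((n * (10 * m + 10) + 1) + 1) + 1) = n * (n * (10 * m + 10) + 4) := by ring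
    omega)
  refine .seq (.const (by omega) ?_)
  have hloop := Run.loop (D := D) (L := L) (a := 30) (b := 5)
    (N := 1 + ((n * (10 * m + 10) + 1) + 1))
    (p := .seq (.add 31 30 1) <|
      .seq (.loop 31 5 (.seq (examineCmd 30 31) (.add 31 31 1))) (.add 30 30 1))
    (fun t w => ∃ c : ℕ, c ≤ n ∧ t = n - c ∧ w.vars 30 = c * m ∧ w.heap = s.heap ∧
      SameVars allPairsVars s w ∧ Attained x (w.vars 2) (w.vars 10) (w.vars 11) ∧
      ∀ k l : Fin n, k < l → (k : ℕ) < c → w.vars 2 ≤ hammingDist (x k) (x l))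
    ?_ (s := s.set 30 0) (k := n) ?_
  · refine hloop.mono le_rfl ?_
    rintro w ⟨hexit, t, c, hcn, -, w30, wh, wv, watt, wall⟩
    have w5 : w.vars 5 = n * m := by rw [wv 5 (by simp), h.v5]
    have hc : c = n := by
      refine le_antisymm hcn (le_of_not_gt fun hlt => hexit ?_)
      rw [w30, w5]
      exact Nat.mul_lt_mul_of_pos_right hlt hm
    subst hc
    exact ⟨by rw [wv 1 (by simp), h.v1], by rw [wv 3 (by simp), h.v3],
      by rw [wv 4 (by simp), h.v4], watt, fun k l hkl => wall k l hkl k.2⟩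
  · rintro t w ⟨c, hcn, rfl, w30, wh, wv, watt, wall⟩ hlt
    have w5 : w.vars 5 = n * m := by rw [wv 5 (by simp), h.v5]
    have w1 : w.vars 1 = m := by rw [wv 1 (by simp), h.v1]
    rw [w30, w5] at hlt
    have hc := lt_of hlt
    refine ⟨n - (c + 1), by omega, .seq (.add (by omega) (.seq ?_))⟩
    refine (hinner ⟨c, hc⟩ (w.set 31 (w.vars 30 + w.vars 1)) wh (wv.set _ (by simp)) ?_ ?_ ?_).mono le_rfl ?_
    · simp [RAMState.vars_set, w30]
    · simp [RAMState.vars_set, w30, w1]; ring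
    · simpa [RAMState.vars_set] using watt
    · rintro y ⟨yh, yv, y30, yatt, yle, yall⟩
      have y1 : y.vars 1 = m := by rw [yv 1 (by simp), h.v1]
      simp only at y30
      refine .add (by omega) ⟨c + 1, by omega, rfl, ?_, yh, yv.set _ (by simp), ?_, ?_⟩
      · simp [RAMState.vars_set, y30, y1]; ring
      · simpa [RAMState.vars_set] using yatt
      · intro k l hkl hk
        simp [RAMState.vars_set] at yle ⊢
        rcases Nat.lt_succ_iff_lt_or_eq.1 hk with h1 | h1
        · have := wall k l hkl h1
          omega
        · obtain rfl : k = ⟨c, hc⟩ := Fin.ext h1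
          exact yall l hkl
  · refine ⟨0, by omega, by omega, ?_, rfl, (SameVars.refl _ s).set _ (by simp), ?_, ?_⟩
    · simp [RAMState.vars_set]
    · simpa [RAMState.vars_set] using h.attained
    · intro k l _ hk; omega

/-! ## Output -/

/-- Divide the variable `v` by `m`. -/
def divCmd (q v : ℕ) : Cmd :=
  .seq (.const q 0) <| .seq (.const 32 0) <| .loop 32 v (.seq (.add 32 32 1) (.add q q 3))

/-- Convert the addresses of the best pair to indices. -/
def outputCmd : Cmd :=
  .seq (divCmd 33 10) <| .seq (divCmd 34 11) <| .seq (.add 0 33 4) (.add 1 34 4)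

/-- Multiples of `m` are counted. The quotient is an index below `n`, so linear time suffices. -/
theorem run_divCmd (hm : 1 ≤ m) {q v : ℕ} {a : Fin n} (h1 : s.vars 1 = m) (h3 : s.vars 3 = 1)
    (hv : s.vars v = a * m) (hq : q ∉ [1, 3, 32, v]) (hvq : v ∉ [q, 32])
    (hL : n * m + m + 2 < 2 ^ L) :
    Run D L (divCmd q v) s (3 * n + 3) fun s' => s'.vars q = a ∧ SameVars [q, 32] s s' := by
  simp only [List.mem_cons, List.not_mem_nil, or_false, not_or] at hq hvq
  obtain ⟨hq1, hq3, hq32, hqv⟩ := hq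
  have hsrc := Fin.mul_add_le_mul m a
  refine Run.le (N := 1 + (1 + (a * ((1 + 1) + 1) + 1))) ?_ (by have := a.2; omega)
  refine .seq (.const (by omega) (.seq (.const (by omega) ?_)))
  have hloop := Run.loop (D := D) (L := L) (a := 32) (b := v) (N := 1 + 1)
    (p := .seq (.add 32 32 1) (.add q q 3))
    (fun t w => ∃ c : ℕ, c ≤ a ∧ t = a - c ∧ w.vars 32 = c * m ∧ w.vars q = c ∧
      SameVars [q, 32] s w)
    ?_ (s := (s.set q 0).set 32 0) (k := a) ?_
  · refine hloop.mono le_rfl ?_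
    rintro w ⟨hexit, t, c, hca, -, w32, wq, wv⟩
    have hwv : w.vars v = a * m := by rw [wv v (by simp [hvq]), hv]
    have hc : c = a := by
      refine le_antisymm hca (le_of_not_gt fun hlt => hexit ?_)
      rw [w32, hwv]
      exact Nat.mul_lt_mul_of_pos_right hlt hm
    exact ⟨by rw [wq, hc], wv⟩
  · rintro t w ⟨c, hca, rfl, w32, wq, wv⟩ hlt
    have hwv : w.vars v = a * m := by rw [wv v (by simp [hvq]), hv]
    have w1 : w.vars 1 = m := by rw [wv 1 (by simp [Ne.symm hq1]), h1]
    have w3 : w.vars 3 = 1 := by rw [wv 3 (by simp [Ne.symm hq3]), h3]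
    rw [w32, hwv] at hlt
    have hc : c < a := lt_of_mul_lt_mul_right hlt (Nat.zero_le _)
    have hcm : c ≤ c * m := Nat.le_mul_of_pos_right _ hm
    refine ⟨a - (c + 1), by omega, .seq (.add (by omega) (.add ?_ ?_))⟩
    · simp [RAMState.vars_set, hq32, wq, w3]; omega
    · refine ⟨c + 1, by omega, rfl, ?_, ?_, (wv.set _ (by simp)).set _ (by simp)⟩
      · simp [RAMState.vars_set, Ne.symm hq32, w32, w1]; ring
      · simp [RAMState.vars_set, hq32, wq, w3]
  · refine ⟨0, by omega, by omega, ?_, ?_, ((SameVars.refl _ s).set _ (by simp)).set _ (by simp)⟩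
    · simp [RAMState.vars_set]
    · simp [RAMState.vars_set, hq32]

theorem run_outputCmd (hm : 1 ≤ m) {a b : Fin n} (h1 : s.vars 1 = m) (h3 : s.vars 3 = 1)
    (h4 : s.vars 4 = 0) (h10 : s.vars 10 = a * m) (h11 : s.vars 11 = b * m)
    (hL : n * m + m + 2 < 2 ^ L) :
    Run D L outputCmd s (6 * n + 8) fun s' =>
      s'.vars 0 = a ∧ s'.vars 1 = b ∧ s'.vars 2 = s.vars 2 := by
  have hn : n ≤ n * m := Nat.le_mul_of_pos_right _ hm
  have ha := a.2
  have hb := b.2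
  refine Run.le (N := (3 * n + 3) + ((3 * n + 3) + (1 + 1))) (.seq ?_) (by omega)
  refine (run_divCmd hm h1 h3 h10 (by simp) (by simp) hL).mono le_rfl ?_
  rintro u ⟨u33, uv⟩
  refine .seq ((run_divCmd hm (a := b) (by rw [uv 1 (by simp), h1]) (by rw [uv 3 (by simp), h3])
    (by rw [uv 11 (by simp), h11]) (by simp) (by simp) hL).mono le_rfl ?_)
  rintro w ⟨w34, wv⟩
  have w33 : w.vars 33 = a := by rw [wv 33 (by simp), u33]
  have w4 : w.vars 4 = 0 := by rw [wv 4 (by simp), uv 4 (by simp), h4]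
  have w2 : w.vars 2 = s.vars 2 := by rw [wv 2 (by simp), uv 2 (by simp)]
  refine .seq (.add (by omega) (.add ?_ ?_))
  · simp [RAMState.vars_set, w34, w4]; omega
  · simp [RAMState.vars_set, w33, w34, w4, w2]

end

/-! ## Preparation -/

/-- Compute the constants and products. -/
def constantsCmd : Cmd :=
  .seq (.const 3 1) <| .seq (.const 28 2) <|
  .loop 32 0 (.seq (.add 5 5 1) <| .seq (.add 6 6 0) <| .add 32 32 3)

/-- Write the powers of two behind the input. -/
def powersCmd : Cmd :=
  .seq (.const 19 1) <| .seq (.add 7 5 4) <| .loop 15 1 <|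
    .seq (.store 7 19) <| .seq (.add 19 19 19) <| .seq (.add 7 7 3) (.add 15 15 3)

/-- Set the remaining variables. -/
def startCmd : Cmd :=
  .seq constantsCmd <| .seq powersCmd <| .seq (.add 8 7 19) <| .seq (.add 12 8 4) (.add 2 1 3)

/-- Compute the code of the vector at the address in the variable `16`. -/
def codeCmd : Cmd :=
  .seq (.const 20 0) <| .seq (.const 15 0) <| .loop 15 1 <|
    .seq (.add 17 16 15) <| .seq (.load 18 17) <|
    .seq (.ite 4 18 (.seq (.add 17 5 15) <| .seq (.load 19 17) (.add 20 20 19)) .skip) <|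
    .add 15 15 3

/-- Insert all the vectors. -/
def sourcesCmd : Cmd :=
  .loop 16 5 (.seq codeCmd <| .seq (.const 15 0) <| .seq insertCmd (.add 16 16 1))

section

variable {n m : ℕ} {D : ℕ → BVec m → BVec m} {L : ℕ} {x : Fin n → BVec m} {s : RAMState}
  {P : List (Item n m)}

theorem run_constantsCmd (h0 : s.vars 0 = n) (h1 : s.vars 1 = m) (h5 : s.vars 5 = 0)
    (h6 : s.vars 6 = 0) (h32 : s.vars 32 = 0) (hL : n * m + n * n + n + 2 < 2 ^ L) :
    Run D L constantsCmd s (4 * n + 3) fun s' => s'.heap = s.heap ∧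
      SameVars [3, 5, 6, 28, 32] s s' ∧ s'.vars 3 = 1 ∧ s'.vars 28 = 2 ∧ s'.vars 5 = n * m ∧
      s'.vars 6 = n * n := by
  refine Run.le (N := 1 + (1 + (n * ((1 + (1 + 1)) + 1) + 1))) ?_ (by omega)
  refine .seq (.const (by omega) (.seq (.const (by omega) ?_)))
  have hloop := Run.loop (D := D) (L := L) (a := 32) (b := 0) (N := 1 + (1 + 1))
    (p := .seq (.add 5 5 1) <| .seq (.add 6 6 0) <| .add 32 32 3)
    (fun t w => w.vars 32 ≤ n ∧ t = n - w.vars 32 ∧ w.heap = s.heap ∧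
      SameVars [3, 5, 6, 28, 32] s w ∧ w.vars 3 = 1 ∧ w.vars 28 = 2 ∧
      w.vars 5 = w.vars 32 * m ∧ w.vars 6 = w.vars 32 * n)
    ?_ (s := (s.set 3 1).set 28 2) (k := n) ?_
  · refine hloop.mono le_rfl ?_
    rintro w ⟨hexit, t, hle, -, wh, wv, w3, w28, w5, w6⟩
    have w0 : w.vars 0 = n := by rw [wv 0 (by simp), h0]
    have w32 : w.vars 32 = n := by omega
    rw [w32] at w5 w6
    exact ⟨wh, wv, w3, w28, w5, w6⟩
  · rintro t w ⟨hle, rfl, wh, wv, w3, w28, w5, w6⟩ hlt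
    have w0 : w.vars 0 = n := by rw [wv 0 (by simp), h0]
    have w1 : w.vars 1 = m := by rw [wv 1 (by simp), h1]
    rw [w0] at hlt
    have b1 : w.vars 32 * m + m ≤ n * m := by
      have := Nat.mul_le_mul_right m hlt
      rwa [Nat.succ_mul] at this
    have b2 : w.vars 32 * n + n ≤ n * n := by
      have := Nat.mul_le_mul_right n hlt
      rwa [Nat.succ_mul] at this
    refine ⟨n - (w.vars 32 + 1), by omega, .seq (.add (by omega) (.seq (.add ?_ (.add ?_ ?_))))⟩
    · simp [RAMState.vars_set, w6, w0]; omega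
    · simp [RAMState.vars_set, w3]; omega
    · refine ⟨?_, ?_, wh, ((wv.set _ (by simp)).set _ (by simp)).set _ (by simp), ?_, ?_, ?_, ?_⟩
      · simp [RAMState.vars_set, w3]; omega
      · simp [RAMState.vars_set, w3]
      · simp [RAMState.vars_set, w3]
      · simp [RAMState.vars_set, w28]
      · simp [RAMState.vars_set, w3, w5, w1]; ring
      · simp [RAMState.vars_set, w3, w6, w0]; ring
  · refine ⟨?_, ?_, rfl, ((SameVars.refl _ s).set _ (by simp)).set _ (by simp), ?_, ?_, ?_, ?_⟩ <;>
      simp [RAMState.vars_set, h32, h5, h6]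

theorem run_powersCmd (h1 : s.vars 1 = m) (h3 : s.vars 3 = 1) (h4 : s.vars 4 = 0)
    (h5 : s.vars 5 = n * m) (h15 : s.vars 15 = 0) (hL : queueBase n m < 2 ^ L) :
    Run D L powersCmd s (5 * m + 3) fun s' => SameVars [7, 15, 19] s s' ∧
      s'.vars 7 = n * m + m ∧ s'.vars 19 = 2 ^ m ∧
      (∀ p, p < n * m ∨ n * m + m ≤ p → s'.heap p = s.heap p) ∧
      ∀ k < m, s'.heap (n * m + k) = 2 ^ k := by
  have hQ : queueBase n m = n * m + m + 2 ^ m := rfl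
  have hpw : 0 < 2 ^ m := by positivity
  refine Run.le (N := 1 + (1 + (m * ((1 + (1 + (1 + 1))) + 1) + 1))) ?_ (by omega)
  refine .seq (.const (by omega) (.seq (.add ?_ ?_)))
  · simp [RAMState.vars_set, h5, h4]; omega
  have hloop := Run.loop (D := D) (L := L) (a := 15) (b := 1) (N := 1 + (1 + (1 + 1)))
    (p := .seq (.store 7 19) <| .seq (.add 19 19 19) <| .seq (.add 7 7 3) (.add 15 15 3))
    (fun t w => ∃ k ≤ m, w.vars 15 = k ∧ t = m - k ∧ SameVars [7, 15, 19] s w ∧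
      w.vars 7 = n * m + k ∧ w.vars 19 = 2 ^ k ∧
      (∀ p, p < n * m ∨ n * m + k ≤ p → w.heap p = s.heap p) ∧
      ∀ l < k, w.heap (n * m + l) = 2 ^ l)
    ?_ (s := (s.set 19 1).set 7 ((s.set 19 1).vars 5 + (s.set 19 1).vars 4)) (k := m) ?_
  · refine hloop.mono le_rfl ?_
    rintro w ⟨hexit, t, k, hk, w15, -, wv, w7, w19, wh, wp⟩
    have w1 : w.vars 1 = m := by rw [wv 1 (by simp), h1]
    obtain rfl : k = m := by omega
    exact ⟨wv, w7, w19, wh, wp⟩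
  · rintro t w ⟨k, hk, w15, rfl, wv, w7, w19, wh, wp⟩ hlt
    have w1 : w.vars 1 = m := by rw [wv 1 (by simp), h1]
    have w3 : w.vars 3 = 1 := by rw [wv 3 (by simp), h3]
    have hkm : k < m := by omega
    have hp : 2 ^ k + 2 ^ k ≤ 2 ^ m := by
      rw [← two_mul, ← pow_succ']
      exact Nat.pow_le_pow_right (by norm_num) hkm
    refine ⟨m - (k + 1), by omega,
      .seq (.store (.seq (.add ?_ (.seq (.add ?_ (.add ?_ ?_))))))⟩
    · simp only [RAMState.vars_put, w19]; omega
    · simp [RAMState.vars_put, RAMState.vars_set, w7, w3]; omega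
    · simp [RAMState.vars_put, RAMState.vars_set, w15, w3]; omega
    · refine ⟨k + 1, by omega, ?_, rfl, ?_, ?_, ?_, ?_, ?_⟩
      · simp [RAMState.vars_put, RAMState.vars_set, w15, w3]
      · exact (((wv.put _ _).set _ (by simp)).set _ (by simp)).set _ (by simp)
      · simp [RAMState.vars_put, RAMState.vars_set, w7, w3]; ring
      · simp [RAMState.vars_put, RAMState.vars_set, w19]; ring
      · intro p hp
        simp only [RAMState.heap_set, RAMState.heap_put, w7]
        rw [if_neg (by omega), wh p (by omega)]
      · intro l hl
        simp only [RAMState.heap_set, RAMState.heap_put, w7, w19]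
        rcases Nat.lt_succ_iff_lt_or_eq.1 hl with h | rfl
        · rw [if_neg (by omega), wp l h]
        · rw [if_pos rfl]
  · refine ⟨0, by omega, ?_, by omega, ((SameVars.refl _ s).set _ (by simp)).set _ (by simp), ?_,
      ?_, fun p _ => rfl, fun l hl => by omega⟩
    · simp [RAMState.vars_set, h15]
    · simp [RAMState.vars_set, h5, h4]
    · simp [RAMState.vars_set]

theorem inputState_heap_of_lt (x : Fin n → BVec m) (ω : ℕ → Bool) :
    HasInput x (inputState x ω) := by
  intro i k hk
  have h1 := Fin.mul_add_le_mul m i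
  have hlt : (i : ℕ) * m + k < n * m := by omega
  have e : (⟨(i : ℕ) * m + k, hlt⟩ : Fin (n * m)) = finProdFinEquiv (i, ⟨k, hk⟩) := by
    ext
    simp [mul_comm, add_comm]
  simp only [inputState, dif_pos hlt, wordBit, dif_pos hk]
  rw [e, Equiv.symm_apply_apply]

theorem inputState_heap_of_le (x : Fin n → BVec m) (ω : ℕ → Bool) {a : ℕ} (h : n * m ≤ a) :
    (inputState x ω).heap a = 0 := by
  simp [inputState, not_lt.2 h]

/-- Cells beyond the input are zero, which is exactly the empty table: its `2 ^ m` entries need no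
initialization and do not enter the running time. -/
theorem run_startCmd (x : Fin n → BVec m) (ω : ℕ → Bool)
    (hL : queueBase n m + n * n + n + 2 < 2 ^ L) :
    Run D L startCmd (inputState x ω) (4 * n + 5 * m + 9) fun s' =>
      SearchState x [] s' ∧ s'.vars 12 = queueBase n m ∧ s'.vars 16 = 0 := by
  have hQ : queueBase n m = n * m + m + 2 ^ m := rfl
  have hpw : 0 < 2 ^ m := by positivity
  refine Run.le (N := (4 * n + 3) + ((5 * m + 3) + (1 + (1 + 1)))) (.seq ?_) (by omega)
  refine (run_constantsCmd (n := n) (m := m) (by simp [inputState]) (by simp [inputState])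
    (by simp [inputState]) (by simp [inputState]) (by simp [inputState]) (by omega)).mono
    le_rfl ?_
  rintro u ⟨uh, uv, u3, u28, u5, u6⟩
  have u0 : u.vars 0 = n := by rw [uv 0 (by simp)]; simp [inputState]
  have u1 : u.vars 1 = m := by rw [uv 1 (by simp)]; simp [inputState]
  have uz : ∀ v ∈ [4, 9, 15, 16], u.vars v = 0 := by
    intro v hv
    simp only [List.mem_cons, List.not_mem_nil, or_false] at hv
    rcases hv with rfl | rfl | rfl | rfl <;> rw [uv _ (by simp)] <;> simp [inputState]
  have u4 := uz 4 (by simp)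
  refine .seq ((run_powersCmd u1 u3 u4 u5 (uz 15 (by simp)) (by omega)).mono le_rfl ?_)
  rintro w ⟨wv, w7, w19, wh, wp⟩
  have w4 : w.vars 4 = 0 := by rw [wv 4 (by simp), u4]
  have w1 : w.vars 1 = m := by rw [wv 1 (by simp), u1]
  have w3 : w.vars 3 = 1 := by rw [wv 3 (by simp), u3]
  have hmp : m < 2 ^ m := Nat.lt_two_pow_self
  refine .seq (.add (by omega) (.seq (.add ?_ (.add ?_ ?_))))
  · simp [RAMState.vars_set, w7, w19, w4]; omega
  · simp [RAMState.vars_set, w1, w3]; omega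
  refine ⟨⟨?_, ?_, ?_, ?_, ?_, ?_, ?_, ?_, ?_, ?_, ?_, ?_, ?_, ?_, ?_, ?_⟩, ?_, ?_⟩
  · simp [RAMState.vars_set, wv 0, u0]
  · simp [RAMState.vars_set, w1]
  · simp [RAMState.vars_set, w3]
  · simp [RAMState.vars_set, w4]
  · simp [RAMState.vars_set, wv 5, u5]
  · simp [RAMState.vars_set, wv 6, u6]
  · simp [RAMState.vars_set, w7]
  · simp [RAMState.vars_set, w7, w19, queueBase]
  · simp [RAMState.vars_set, wv 9, uz 9]
  · simp [RAMState.vars_set, wv 28, u28]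
  · intro i k hk
    have := Fin.mul_add_le_mul m i
    simp only [RAMState.heap_set]
    rw [wh _ (by omega), uh]
    exact inputState_heap_of_lt x ω i k hk
  · intro k hk
    exact wp k hk
  · intro z
    simp only [RAMState.heap_set]
    rw [wh _ (by omega), uh, inputState_heap_of_le x ω (by omega)]
    rfl
  · intro t e ht
    simp at ht
  -- Variable `2` starts at `m + 1`, larger than any distance.
  · left
    simp [RAMState.vars_set, w1, w3]
  · intro e he
    simp at he
  · simp [RAMState.vars_set, w7, w19, w4, queueBase]
  · simp [RAMState.vars_set, wv 16, uz 16]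

theorem run_codeCmd (h : SearchState x P s) {i : Fin n} (h16 : s.vars 16 = i * m)
    (hL : queueBase n m + 2 < 2 ^ L) :
    Run D L codeCmd s (8 * m + 3) fun s' => s'.heap = s.heap ∧ s'.vars 20 = wordCode (x i) ∧
      SameVars [15, 17, 18, 19, 20] s s' := by
  have hQ : queueBase n m = n * m + m + 2 ^ m := rfl
  have hsrc := Fin.mul_add_le_mul m i
  refine Run.le (N := 1 + (1 + (m * ((1 + (1 + ((max (1 + (1 + 1)) 1 + 1) + 1))) + 1) + 1))) ?_
    (by simp; omega)
  refine .seq (.const (by omega) (.seq (.const (by omega) ?_)))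
  have hloop := Run.loop (D := D) (L := L) (a := 15) (b := 1)
    (N := 1 + (1 + ((max (1 + (1 + 1)) 1 + 1) + 1)))
    (p := .seq (.add 17 16 15) <| .seq (.load 18 17) <|
      .seq (.ite 4 18 (.seq (.add 17 5 15) <| .seq (.load 19 17) (.add 20 20 19)) .skip) <|
      .add 15 15 3)
    (fun t w => w.vars 15 ≤ m ∧ t = m - w.vars 15 ∧ w.heap = s.heap ∧
      SameVars [15, 17, 18, 19, 20] s w ∧ w.vars 20 = codeUpTo (x i) (w.vars 15))
    ?_ (s := (s.set 20 0).set 15 0) (k := m) ?_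
  · refine hloop.mono le_rfl ?_
    rintro w ⟨hexit, t, hle, -, wh, wv, w20⟩
    have w1 : w.vars 1 = m := by rw [wv 1 (by simp), h.v1]
    have w15 : w.vars 15 = m := by omega
    rw [w15] at w20
    exact ⟨wh, w20, wv⟩
  · rintro t w ⟨hle, rfl, wh, wv, w20⟩ hlt
    have w1 : w.vars 1 = m := by rw [wv 1 (by simp), h.v1]
    have w3 : w.vars 3 = 1 := by rw [wv 3 (by simp), h.v3]
    have w4 : w.vars 4 = 0 := by rw [wv 4 (by simp), h.v4]
    have w5 : w.vars 5 = n * m := by rw [wv 5 (by simp), h.v5]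
    have w16 : w.vars 16 = i * m := by rw [wv 16 (by simp), h16]
    have hk : w.vars 15 < m := by omega
    have l1 := h.input i _ hk
    have l2 := h.pow _ hk
    have hbit := wordBit_lt_two (x i) (w.vars 15)
    have hsucc := codeUpTo_succ (x i) (w.vars 15)
    have hlt' := codeUpTo_lt (x i) (w.vars 15 + 1)
    have hpw : 2 ^ (w.vars 15 + 1) ≤ 2 ^ m := Nat.pow_le_pow_right (by norm_num) hk
    refine ⟨m - (w.vars 15 + 1), by omega, .seq (.add (by omega) (.seq (.load (.seq ?_))))⟩
    simp only [RAMState.vars_set, RAMState.heap_set, w16, wh, if_true, l1]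
    refine .ite (fun hb => ?_) (fun hb => ?_)
    · simp [RAMState.vars_set, w4] at hb
      have hb1 : wordBit (x i) (w.vars 15) = 1 := by omega
      rw [hb1, one_mul] at hsucc
      refine .seq (.add ?_ (.seq (.load (.add ?_ (.add ?_ ?_)))))
      · simp [RAMState.vars_set, w5]; omega
      · simp [RAMState.vars_set, RAMState.heap_set, wh, w5, l2, w20]; omega
      · simp [RAMState.vars_set, w3]; omega
      · refine ⟨?_, ?_, wh, (((((wv.set _ (by simp)).set _ (by simp)).set _ (by simp)).set _
          (by simp)).set _ (by simp)).set _ (by simp), ?_⟩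
        · simp [RAMState.vars_set, w3]; omega
        · simp [RAMState.vars_set, w3]
        · simp [RAMState.vars_set, RAMState.heap_set, w3, w5, w20, wh, l2, hsucc]
    · simp [RAMState.vars_set, w4] at hb
      rw [hb, zero_mul, add_zero] at hsucc
      refine .skip (.add ?_ ?_)
      · simp [RAMState.vars_set, w3]; omega
      · refine ⟨?_, ?_, wh, ((wv.set _ (by simp)).set _ (by simp)).set _ (by simp), ?_⟩
        · simp [RAMState.vars_set, w3]; omega
        · simp [RAMState.vars_set, w3]
        · simp [RAMState.vars_set, w3, w20, hsucc]
  · refine ⟨?_, ?_, rfl, ((SameVars.refl _ s).set _ (by simp)).set _ (by simp), ?_⟩ <;>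
      simp [RAMState.vars_set, codeUpTo]

/-- This is level `0`, the only one whose codes are computed bit by bit. Equal vectors already
collide here. -/
theorem run_sourcesCmd (hm : 1 ≤ m) (h : SearchState x [] s) (h12 : s.vars 12 = queueBase n m)
    (h16 : s.vars 16 = 0) (hL : queueBase n m + 3 * n + 2 < 2 ^ L) :
    Run D L sourcesCmd s (n * (18 * m + 28) + 1) fun s' =>
      SearchState x (searchUpTo x 0) s' ∧ s'.vars 12 = queueBase n m := by
  have hQ : queueBase n m = n * m + m + 2 ^ m := rfl
  have hlen : (searchLevel x 0).length = n := by simp [searchLevel]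
  have hloop := Run.loop (D := D) (L := L) (a := 16) (b := 5)
    (N := (8 * m + 3) + (1 + ((10 * m + 22) + 1)))
    (p := .seq codeCmd <| .seq (.const 15 0) <| .seq insertCmd (.add 16 16 1))
    (fun t w => ∃ c ≤ n, t = n - c ∧ w.vars 16 = c * m ∧ w.vars 12 = queueBase n m ∧
      SearchState x ((searchLevel x 0).take c) w)
    ?_ (s := s) (k := n) ?_
  · refine hloop.mono (Nat.add_le_add_right (Nat.mul_le_mul_left _ (by omega)) 1) ?_
    rintro w ⟨hexit, t, c, hc, -, w16, w12, hw⟩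
    have hcn : c = n := by
      refine le_antisymm hc (le_of_not_gt fun hlt => hexit ?_)
      rw [w16, hw.v5]
      exact Nat.mul_lt_mul_of_pos_right hlt hm
    rw [List.take_of_length_le (by omega)] at hw
    exact ⟨hw, w12⟩
  · rintro t w ⟨c, hc, rfl, w16, w12, hw⟩ hlt
    rw [w16, hw.v5] at hlt
    have hcn : c < n := lt_of_mul_lt_mul_right hlt (Nat.zero_le _)
    have htl : ((searchLevel x 0).take c).length = c := by
      rw [List.length_take, hlen]; omega
    refine ⟨n - (c + 1), by omega, .seq ?_⟩
    refine (run_codeCmd (i := ⟨c, hcn⟩) hw w16 (by omega)).mono le_rfl ?_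
    rintro u ⟨uh, u20, uv⟩
    have vv : SameVars [15, 17, 18, 19, 20] w (u.set 15 0) := uv.set _ (by simp)
    refine .seq (.const (by omega) (.seq ?_))
    refine (run_insertCmd (e := ⟨x ⟨c, hcn⟩, 0, ⟨c, hcn⟩⟩) hm (hw.congr vv uh (by simp)) ?_ ?_ ?_
      (by rw [htl]; omega)).mono le_rfl ?_
    · simpa [RAMState.vars_set] using u20
    · simp [RAMState.vars_set]
    · simp [RAMState.vars_set, uv 16, w16]
    · rintro y ⟨hy, yv⟩
      have y16 : y.vars 16 = c * m := by rw [yv 16 (by simp), vv 16 (by simp), w16]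
      have y12 : y.vars 12 = queueBase n m := by rw [yv 12 (by simp), vv 12 (by simp), w12]
      have y1 := hy.v1
      have hpw : 0 < 2 ^ m := by positivity
      refine .add (by omega) ⟨c + 1, by omega, rfl, ?_, ?_, ?_⟩
      · simp [RAMState.vars_set, y16, y1]; ring
      · simp [RAMState.vars_set, y12]
      · have htake : (searchLevel x 0).take (c + 1) =
            (searchLevel x 0).take c ++ [⟨x ⟨c, hcn⟩, 0, ⟨c, hcn⟩⟩] := by
          rw [List.take_add_one, List.getElem?_eq_getElem (by omega)]
          simp [searchLevel]
        rw [htake]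
        exact hy.congr ((SameVars.refl [16] y).set _ (by simp)) rfl (by simp)
  · exact ⟨0, by omega, by omega, by omega, h12, by simpa using h⟩

/-! ## The whole program -/

/-- The program: search in balls around the vectors, or among all pairs if these are fewer. -/
def closestPairCmd : Cmd :=
  .seq startCmd <| .seq sourcesCmd <| .seq searchCmd <| .seq (.ite 27 2 allPairsCmd .skip) outputCmd

theorem queryFree_closestPairCmd : closestPairCmd.QueryFree := by
  simp [closestPairCmd, startCmd, constantsCmd, powersCmd, sourcesCmd, codeCmd, insertCmd,
    enqueueCmd, examineCmd, searchCmd, limitCmd, levelCmd, expandCmd, childrenCmd, allPairsCmd,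
    outputCmd, divCmd, Cmd.QueryFree]

/-- If the best distance still exceeds `2 * ρ` after the search, the queue was too long, so `n ≤
ballCard m ρ`, hence `M = n`, and all pairs are affordable. Otherwise `d` is at most the best
distance and so at most `2 * ρ`; the balls meet and the best distance is `d`. -/
theorem run_closestPairCmd (hm : 1 ≤ m) {i j : Fin n} (hx : IsUniqueClosestPair x i j)
    (ω : ℕ → Bool) (hL : queueBase n m + 3 * (n * 2 ^ m) + n * n + n + 2 < 2 ^ L) {M : ℕ}
    (hM : M = min n (ballCard m ((hammingDist (x i) (x j) + 1) / 2))) :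
    Run D L closestPairCmd (inputState x ω) (n * M * (300 * m ^ 3)) fun s' =>
      s'.vars 0 = (i : ℕ) ∧ s'.vars 1 = (j : ℕ) ∧ s'.vars 2 = hammingDist (x i) (x j) := by
  have hQ : queueBase n m = n * m + m + 2 ^ m := rfl
  have hn : 0 < n := by have := i.2; omega
  have hpw : 0 < 2 ^ m := by positivity
  have hnp : n ≤ n * 2 ^ m := Nat.le_mul_of_pos_right _ hpw
  have hM1 : 1 ≤ M := by
    rw [hM, le_min_iff]
    refine ⟨hn, ?_⟩
    calc 1 = ballCard m 0 := by simp [ballCard]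
      _ ≤ _ := ballCard_mono (Nat.zero_le _)
  refine Run.le (N := (4 * n + 5 * m + 9) + ((n * (18 * m + 28) + 1) +
    ((m * (n * M * (m * (10 * m + 30) + 8) + 6) + 4) +
    ((max (n * M * (10 * m + 10) + 4 * n + 2) 1 + 1) + (6 * n + 8))))) ?_ ?_
  swap
  · obtain ⟨a, ha⟩ : ∃ a, a = n * M := ⟨_, rfl⟩
    have hna : n ≤ a := by rw [ha]; exact Nat.le_mul_of_pos_right _ hM1
    rw [max_eq_left (by omega), ← ha]
    have hm2 : m ≤ m ^ 3 := Nat.le_self_pow (by norm_num) m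
    have hm3 : m ^ 2 ≤ m ^ 3 := Nat.pow_le_pow_right hm (by norm_num)
    have k1 : a * m ≤ a * m ^ 3 := Nat.mul_le_mul_left _ hm2
    have k2 : a * m ^ 2 ≤ a * m ^ 3 := Nat.mul_le_mul_left _ hm3
    have k3 : a ≤ a * m := Nat.le_mul_of_pos_right _ hm
    have k4 : n * m ≤ a * m := Nat.mul_le_mul_right _ hna
    have k5 : m ≤ a * m := Nat.le_mul_of_pos_left _ (by omega)
    have e1 : m * (a * (m * (10 * m + 30) + 8) + 6) =
        10 * (a * m ^ 3) + 30 * (a * m ^ 2) + 8 * (a * m) + 6 * m := by ring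
    have e2 : a * (10 * m + 10) = 10 * (a * m) + 10 * a := by ring
    have e3 : n * (18 * m + 28) = 18 * (n * m) + 28 * n := by ring
    have e4 : a * (300 * m ^ 3) = 300 * (a * m ^ 3) := by ring
    rw [e1, e2, e3, e4]
    omega
  refine .seq ((run_startCmd x ω (by omega)).mono le_rfl ?_)
  rintro s1 ⟨hs1, s12, s16⟩
  refine .seq ((run_sourcesCmd hm hs1 s12 s16 (by omega)).mono le_rfl ?_)
  rintro s2 ⟨hs2, s12⟩
  refine .seq ((run_searchCmd hm hx hs2 s12 (by omega) rfl hM).mono le_rfl ?_)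
  rintro u ⟨ρ, hρ, hu, u29⟩
  have u27 := hu.v27
  have out : ∀ s' : RAMState, s'.vars 1 = m → s'.vars 3 = 1 → s'.vars 4 = 0 →
      Attained x (s'.vars 2) (s'.vars 10) (s'.vars 11) →
      s'.vars 2 ≤ hammingDist (x i) (x j) →
      Run D L outputCmd s' (6 * n + 8) fun s' =>
        s'.vars 0 = (i : ℕ) ∧ s'.vars 1 = (j : ℕ) ∧ s'.vars 2 = hammingDist (x i) (x j) := by
    intro s' e1 e3 e4 hatt hle
    obtain ⟨e10, e11, e2⟩ := hatt.eq_of_le hx hle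
    refine (run_outputCmd hm e1 e3 e4 e10 e11 (by omega)).mono le_rfl ?_
    rintro y ⟨y0, y1, y2⟩
    exact ⟨y0, y1, y2.trans e2⟩
  refine .seq (.ite (fun hlt => ?_) (fun hlt => .skip ?_))
  · have hcnt : ¬ u.vars 9 < u.vars 6 := by
      intro hcon
      have := hu.v29
      rw [if_pos hcon] at this
      omega
    rw [hu.state.v9, hu.state.v6, length_searchUpTo, not_lt] at hcnt
    have hnb : n ≤ ballCard m ρ := le_of_mul_le_mul_left hcnt hn
    have hMn : M = n := by
      rw [hM, min_eq_left (hnb.trans (ballCard_mono hρ))]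
    refine (run_allPairsCmd hm hu.state (by omega)).mono ?_ ?_
    · rw [hMn]
      have : n * (n * (10 * m + 10) + 4) = n * n * (10 * m + 10) + 4 * n := by ring
      omega
    · rintro y ⟨y1, y3, y4, yatt, yall⟩
      exact out y y1 y3 y4 yatt (yall i j hx.1)
  · have hst := hu.state
    refine out u hst.v1 hst.v3 hst.v4 hst.attained ?_
    refine hst.covers.le_hammingDist hx ?_
    have := hst.attained.hammingDist_le hx
    omega

end

/-! ### From instruction counts to the stated time bound -/

theorem bounded_inputState {n m L : ℕ} (x : Fin n → BVec m) (ω : ℕ → Bool)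
    (hL : n + m + 2 < 2 ^ L) : (inputState x ω).Bounded L := by
  constructor
  · intro v
    simp only [inputState]
    split_ifs <;> omega
  · intro a
    simp only [inputState]
    split_ifs with h
    · have := ZMod.val_lt (x (finProdFinEquiv.symm ⟨a, h⟩).1 (finProdFinEquiv.symm ⟨a, h⟩).2)
      omega
    · omega

instance : IsProbabilityMeasure coinLaw := by
  unfold coinLaw
  infer_instance

/-- The running time of the program in terms of the number of words it handles. -/
theorem exec_closestPairCmd {n m : ℕ} (D : ℕ → BVec m → BVec m) {x : Fin n → BVec m} {i j : Fin n}
    (hm : 1 ≤ m) (hx : IsUniqueClosestPair x i j) (ω : ℕ → Bool) :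
    ∃ s t, Exec D closestPairCmd (inputState x ω) s t ∧
      t ≤ n * min n (ballCard m ((hammingDist (x i) (x j) + 1) / 2)) * (300 * m ^ 3) *
        (22 * (m * Nat.log 2 n)) ∧
      s.vars 0 = (i : ℕ) ∧ s.vars 1 = (j : ℕ) ∧ s.vars 2 = hammingDist (x i) (x j) := by
  have hn2 : 2 ≤ n := by
    have := hx.1
    have h1 := j.2
    rw [Fin.lt_def] at this
    omega
  set l := Nat.log 2 n with hl
  have hl1 : 1 ≤ l := Nat.log_pos one_lt_two hn2
  have hnl : n ≤ 2 ^ (l + 1) := (Nat.lt_pow_succ_log_self one_lt_two n).le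
  have hmm : m ≤ 2 ^ m := Nat.lt_two_pow_self.le
  -- With `N = 2 ^ (l + 1)` and `q = 2 ^ m`, `2 ^ L` is `16 * N * N * q`, while the memory bound is
  -- a sum of nine terms, each at most `N * N * q`.
  set L := 2 * (l + 1) + m + 4 with hLdef
  have hL : queueBase n m + 3 * (n * 2 ^ m) + n * n + n + 2 < 2 ^ L := by
    have e : 2 ^ L = 2 ^ (l + 1) * 2 ^ (l + 1) * 2 ^ m * 16 := by
      rw [hLdef, pow_add, pow_add, two_mul, pow_add]; norm_num
    have p1 : 2 ≤ 2 ^ m := by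
      calc 2 = 2 ^ 1 := rfl
        _ ≤ 2 ^ m := Nat.pow_le_pow_right (by norm_num) hm
    generalize 2 ^ (l + 1) = N at *
    rw [e, queueBase]
    generalize 2 ^ m = q at *
    have a0 : 1 ≤ N := by omega
    have a1 : n * m ≤ N * N * q :=
      (Nat.mul_le_mul hnl hmm).trans (Nat.mul_le_mul_right _ (Nat.le_mul_of_pos_left _ a0))
    have a2 : n * q ≤ N * N * q :=
      (Nat.mul_le_mul_right _ hnl).trans (Nat.mul_le_mul_right _ (Nat.le_mul_of_pos_left _ a0))
    have a3 : n * n ≤ N * N * q :=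
      (Nat.mul_le_mul hnl hnl).trans (Nat.le_mul_of_pos_right _ (by omega))
    have a4 : q ≤ N * N * q := Nat.le_mul_of_pos_left _ (by positivity)
    have a5 : n ≤ N * N * q :=
      (Nat.le_mul_of_pos_right n (by omega)).trans a2
    omega
  have hnn : n ≤ n * 2 ^ m := Nat.le_mul_of_pos_right _ (by positivity)
  have hQ : queueBase n m = n * m + m + 2 ^ m := rfl
  obtain ⟨s, t, h1, h2, -, h3⟩ := run_closestPairCmd (D := D) (L := L) hm hx ω hL rfl
    (bounded_inputState x ω (by omega))
  refine ⟨s, t, h1, h2.trans (Nat.mul_le_mul_left _ ?_), h3⟩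
  -- The cost unit is `2 * L + 2 = 4 * l + 2 * m + 14`, at most `20 * (m * l)`.
  have b1 : m ≤ m * l := Nat.le_mul_of_pos_right _ hl1
  have b2 : l ≤ m * l := Nat.le_mul_of_pos_left _ hm
  omega

/-- The constants are `13200 = 2 * 300 * 22` and `m ^ 6 = m ^ 2 * m ^ 3 * m`. The factor `ε⁻¹ ≥ 1`
and the second logarithm are slack, and the success event is the whole space. -/
theorem finds_closestPairCmd {n m : ℕ} (D : ℕ → BVec m → BVec m) {x : Fin n → BVec m}
    {i j : Fin n} (hm : 1 ≤ m) (hx : IsUniqueClosestPair x i j) {κ : ℝ → ℝ}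
    (hκ : ∀ t, 0 ≤ t → κ t ≤ kappaGV t) {ε : ℝ} (hε : 0 < ε) (hε1 : ε ≤ 1) :
    Finds closestPairCmd D x i j (timeBound κ 13200 6 ε n m (hammingDist (x i) (x j))) := by
  constructor
  · intro ω
    obtain ⟨s, t, h1, h2, -⟩ := exec_closestPairCmd D hm hx ω
    refine ⟨s, t, h1, ?_⟩
    have hn2 : 2 ≤ n := by
      have := hx.1
      have h1 := j.2
      rw [Fin.lt_def] at this
      omega
    have hb := min_card_ballCard_le hm hx hκ hε
    unfold timeBound
    set X := (2 : ℝ) ^ ((1 - κ ((1 + ε) * ((hammingDist (x i) (x j) : ℝ) / m)) -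
        (hammingDist (x i) (x j) : ℝ) / m * H2 ((1 - ε) / 2)) * m)
    have hX : 0 < X := Real.rpow_pos_of_pos two_pos _
    have hlog : (Nat.log 2 n : ℝ) ≤ Real.logb 2 n := by
      have := Real.natLog_le_logb n 2
      exact_mod_cast this
    have hlog1 : 1 ≤ Real.logb 2 n := by
      rw [Real.le_logb_iff_rpow_le one_lt_two (by positivity)]
      simpa using (by exact_mod_cast hn2 : (2 : ℝ) ≤ n)
    have hlog2 : (Nat.log 2 n : ℝ) ≤ Real.logb 2 n ^ 2 := by nlinarith
    have hinv : 1 ≤ ε⁻¹ := (one_le_inv₀ hε).2 hε1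
    have h2' : (t : ℝ) ≤ n * ((min n (ballCard m ((hammingDist (x i) (x j) + 1) / 2)) : ℕ) : ℝ) *
        (300 * (m : ℝ) ^ 3) * (22 * (m * (Nat.log 2 n : ℝ))) := by
      exact_mod_cast h2
    calc (t : ℝ) ≤ _ := h2'
      _ ≤ n * (2 * (m : ℝ) ^ 2 * X) * (300 * (m : ℝ) ^ 3) * (22 * (m * Real.logb 2 n ^ 2)) := by
        gcongr
      _ = 1 * (13200 * n * Real.logb 2 n ^ 2 * X * (m : ℝ) ^ 6) := by ring
      _ ≤ ε⁻¹ * (13200 * n * Real.logb 2 n ^ 2 * X * (m : ℝ) ^ 6) :=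
        mul_le_mul_of_nonneg_right hinv (by positivity)
      _ = _ := by ring
  · have huniv : {ω : ℕ → Bool | ∃ (s : RAMState) (t : ℕ),
        Exec D closestPairCmd (inputState x ω) s t ∧
          s.vars 0 = (i : ℕ) ∧ s.vars 1 = (j : ℕ) ∧ s.vars 2 = hammingDist (x i) (x j)} =
        Set.univ := by
      refine Set.eq_univ_of_forall fun ω => ?_
      obtain ⟨s, t, h1, -, h3⟩ := exec_closestPairCmd D hm hx ω
      exact ⟨s, t, h1, h3⟩
    rw [huniv, probReal_univ]
    have : 0 ≤ 1 / (n : ℝ) ^ 2 := by positivity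
    linarith

theorem mainTheorem4 :
    (∃ (A : ℝ) (c : ℕ), ∀ ε : ℝ, 0 < ε → ε ≤ 1 →
      (∃ p : Cmd, p.QueryFree ∧
        ∀ (n m : ℕ) (x : Fin n → BVec m) (i j : Fin n),
          1 ≤ m → IsUniqueClosestPair x i j →
          Finds p (fun _ v => v) x i j
            (timeBound kappaZ A c ε n m (hammingDist (x i) (x j)))) ∧
      (∃ p : Cmd,
        ∀ (n m : ℕ) (C : ℕ → Finset (BVec m)) (D : ℕ → BVec m → BVec m)
          (x : Fin n → BVec m) (i j : Fin n),
          1 ≤ m → IsGVEnsemble ε m C D → IsUniqueClosestPair x i j →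
          Finds p D x i j
            (timeBound kappaGV A c ε n m (hammingDist (x i) (x j))))) ∧
    (∀ (n m : ℕ) (x : Fin n → BVec m) (i j : Fin n) (C : Finset (BVec m)) (d r : ℕ)
        (D : BVec m → BVec m),
      IsUniqueClosestPair x i j → HasMinDist C d → r = (d - 1) / 2 → Decodes C r D →
      hammingDist (x i) (x j) ≤ 2 * r → r ≤ hammingDist (x i) (x j) →
      C.card * (hammingDist (x i) (x j)).choose r ≤
        {y : BVec m | IsGoodShift x i j D r y}.ncard) := by
  -- One program, the same for all `ε`, serves both statements.
  refine ⟨⟨13200, 6, fun ε hε hε1 => ⟨⟨closestPairCmd, queryFree_closestPairCmd, ?_⟩,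
    closestPairCmd, ?_⟩⟩, ?_⟩
  · intro n m x i j hm hx
    exact finds_closestPairCmd _ hm hx (fun t ht => kappaZ_le_kappaGV ht) hε hε1
  · intro n m C D x i j hm _ hx
    exact finds_closestPairCmd D hm hx (fun t _ => le_rfl) hε hε1
  · intro n m x i j C d r D hx _ _ hD h1 h2
    exact card_mul_choose_le_ncard_goodShift hx hD h1 h2
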